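/- Fix a finite alphabet $L$ partitioned into call, return and simple symbols. A VPTS over $L$ is a finite transition system with a stack: it has finitely many states, a set of initial states and a finite stack alphabet; a call move pushes a stack symbol, a return move pops the topmost stack symbol (or tests the empty stack without changing it), and a simple move or a move labeled by the internal action $\varsigma\notin L$ leaves the stack unchanged. Runs start in an initial state with the empty stack, and $otr(S)\subseteq L^\star$ is the set of words obtained from the labels of the runs of $S$ by erasing $\varsigma$. A VPTS is deterministic if every $\sigma\in L^\star$ leads, through runs with observable label $\sigma$, from the initial configurations to at most one configuration (state and stack). An IOVPTS is a VPTS together with a partition of $L$ into input and output symbols. A VPA over $L$ is the same kind of device with final states, where moves labeled $\varepsilon$ replace those labeled $\varsigma$; it accepts by final state, with any stack. A VPA is deterministic if it has at most one initial state, at most one call move for each state and call symbol, at most one return move for each state, return symbol and topmost stack symbol (or empty stack), at most one simple move for each state and simple symbol, at most one $\varepsilon$-move from each state, and no other move from a state that has an $\varepsilon$-move. It is non-blocking if from every state and every stack it can read every word. For $D,F\subseteq L^\star$, a VPTS $I$ $(D,F)$-conforms to a VPTS $S$ if $otr(I)\cap F\cap otr(S)=\emptyset$ and $otr(I)\cap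 D\subseteq otr(S)$. A language $T\subseteq L^\star$ is a complete test suite for $S$ and $(D,F)$ if, for every VPTS $I$ over $L$, $otr(I)\cap T=\emptyset$ if and only if $I$ $(D,F)$-conforms to $S$. Proposition. Let $S$ and $I$ be deterministic IOVPTSs over $L$ with $n_S$ and $n_I$ states, and let $A_D$ and $A_F$ be deterministic VPAs over $L$ with $n_D$ and $n_F$ states, $D=L(A_D)$ and $F=L(A_F)$. (1) There is a deterministic, non-blocking VPA $T$ over $L$ without $\varepsilon$-moves, with at most $(n_Sn_F+1)(n_Sn_D+n_D+1)$ states, such that $L(T)$ is a complete test suite for $S$ and $(D,F)$. (2) There is an algorithm that, given $I$, $S$, $A_D$, $A_F$ (each with at least one state), decides whether $I$ $(D,F)$-conforms to $S$ in time $O\big((n_In_S^2n_Fn_D)^3\big)$, where the implied constant depends only on $|L|$, and polynomially so. The algorithm is one program, for all $L$ and all inputs, of a unit-cost random access machine with arrays, whose arithmetic consists of successor, predecessor and comparisons. The input is given by transition tables, which list the call and simple moves of each state and symbol, the return moves of each state, symbol and topmost stack symbol, and the $\varsigma$- or $\varepsilon$-moves of each state. -/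

import Mathlib

/-- The three classes of symbols of a visibly pushdown alphabet. A partition of an alphabet `L`
into call (push), return (pop) and simple symbols is a function `L → LKind`. -/
inductive LKind where
  | call
  | ret
  | simple

/-- A visibly pushdown labeled transition system over the partitioned alphabet `(L, kind)`.
The bottom symbol is not an element of `Stk`; in `pop`, `none` stands for the bottom symbol.
In `flat` (the moves that leave the stack alone) the label `none` is the internal action. -/
structure VPTS {L : Type} (kind : L → LKind) where
  State : Type
  Stk : Type
  finite_state : Finite State
  finite_stk : Finite Stk
  start : Set State
  push : State → L → Stk → State → Prop
  pop : State → L → Option Stk → State → Prop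
  flat : State → Option L → State → Prop
  push_call : ∀ {p a Z q}, push p a Z q → kind a = LKind.call
  pop_ret : ∀ {p a Z q}, pop p a Z q → kind a = LKind.ret
  flat_simple : ∀ {p a q}, flat p (some a) q → kind a = LKind.simple

namespace VPTS

/-- A configuration: a state and the stack content above the bottom symbol, topmost symbol
first. -/
abbrev Config {L : Type} {kind : L → LKind} (S : VPTS kind) : Type := S.State × List S.Stk

/-- Elementary moves, labeled by a symbol or by the internal action `none`. -/
inductive Step {L : Type} {kind : L → LKind} (S : VPTS kind) :
    S.Config → Option L → S.Config → Prop where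
  | push {p a Z q} (α : List S.Stk) (h : S.push p a Z q) : Step S (p, α) (some a) (q, Z :: α)
  | pop {p a Z q} (α : List S.Stk) (h : S.pop p a (some Z) q) :
      Step S (p, Z :: α) (some a) (q, α)
  | popBot {p a q} (h : S.pop p a none q) : Step S (p, []) (some a) (q, [])
  | flat {p x q} (α : List S.Stk) (h : S.flat p x q) : Step S (p, α) x (q, α)

/-- Finite sequences of moves, labeled by the word of their labels. -/
inductive Run {L : Type} {kind : L → LKind} (S : VPTS kind) :
    S.Config → List (Option L) → S.Config → Prop where
  | nil (c : S.Config) : Run S c [] c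
  | cons {c d e : S.Config} {x : Option L} {τ : List (Option L)} :
      S.Step c x d → Run S d τ e → Run S c (x :: τ) e

/-- Observable runs: the internal actions are erased from the label of the run. -/
def ObsRun {L : Type} {kind : L → LKind} (S : VPTS kind) (c : S.Config) (σ : List L)
    (d : S.Config) : Prop :=
  ∃ τ : List (Option L), τ.reduceOption = σ ∧ S.Run c τ d

/-- Observable traces. -/
def otr {L : Type} {kind : L → LKind} (S : VPTS kind) : Language L :=
  {σ | ∃ s ∈ S.start, ∃ d : S.Config, S.ObsRun (s, []) σ d}

/-- A VPTS is deterministic when an observable word leads from the initial configurations to at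
most one configuration. -/
def Deterministic {L : Type} {kind : L → LKind} (S : VPTS kind) : Prop :=
  ∀ s ∈ S.start, ∀ s' ∈ S.start, ∀ (σ : List L) (d d' : S.Config),
    S.ObsRun (s, []) σ d → S.ObsRun (s', []) σ d' → d = d'

/-- The number of states. -/
noncomputable def size {L : Type} {kind : L → LKind} (S : VPTS kind) : ℕ := Nat.card S.State

end VPTS

/-- An input/output VPTS: the alphabet is also partitioned into input and output symbols. -/
structure IOVPTS {L : Type} (kind : L → LKind) extends VPTS kind where
  inputs : Set L
  outputs : Set L
  disjoint_io : Disjoint inputs outputs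
  union_io : inputs ∪ outputs = Set.univ

/-- A visibly pushdown automaton: the same transition structure with final states, where now a
`flat` move labeled `none` is an ε-move. -/
structure VPA {L : Type} (kind : L → LKind) extends VPTS kind where
  final : Set State

namespace VPA

/-- One move between configurations (state, remaining input, stack). -/
inductive Move {L : Type} {kind : L → LKind} (A : VPA kind) :
    A.State × List L × List A.Stk → A.State × List L × List A.Stk → Prop where
  | push {p a Z q} (σ : List L) (α : List A.Stk) (h : A.push p a Z q) :
      Move A (p, a :: σ, α) (q, σ, Z :: α)
  | pop {p a Z q} (σ : List L) (α : List A.Stk) (h : A.pop p a (some Z) q) :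
      Move A (p, a :: σ, Z :: α) (q, σ, α)
  | popBot {p a q} (σ : List L) (h : A.pop p a none q) : Move A (p, a :: σ, []) (q, σ, [])
  | simple {p a q} (σ : List L) (α : List A.Stk) (h : A.flat p (some a) q) :
      Move A (p, a :: σ, α) (q, σ, α)
  | eps {p q} (σ : List L) (α : List A.Stk) (h : A.flat p none q) : Move A (p, σ, α) (q, σ, α)

/-- The reflexive and transitive closure of the moves. -/
def Moves {L : Type} {kind : L → LKind} (A : VPA kind) :
    A.State × List L × List A.Stk → A.State × List L × List A.Stk → Prop :=
  Relation.ReflTransGen A.Move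

/-- The accepted language (acceptance by final state, with any stack). -/
def language {L : Type} {kind : L → LKind} (A : VPA kind) : Language L :=
  {σ | ∃ s ∈ A.start, ∃ p ∈ A.final, ∃ β : List A.Stk, A.Moves (s, σ, []) (p, [], β)}

structure Deterministic {L : Type} {kind : L → LKind} (A : VPA kind) : Prop where
  start_subsingleton : A.start.Subsingleton
  push_unique : ∀ {p a Z₁ Z₂ q₁ q₂}, A.push p a Z₁ q₁ → A.push p a Z₂ q₂ → Z₁ = Z₂ ∧ q₁ = q₂
  pop_unique : ∀ {p a Z q₁ q₂}, A.pop p a Z q₁ → A.pop p a Z q₂ → q₁ = q₂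
  flat_unique : ∀ {p x q₁ q₂}, A.flat p x q₁ → A.flat p x q₂ → q₁ = q₂
  eps_only : ∀ {p q}, A.flat p none q →
    (∀ a Z r, ¬ A.push p a Z r) ∧ (∀ a Z r, ¬ A.pop p a Z r) ∧ (∀ a r, ¬ A.flat p (some a) r)

def EpsFree {L : Type} {kind : L → LKind} (A : VPA kind) : Prop :=
  ∀ p q, ¬ A.flat p none q

/-- Every word can be read from every state and with every stack. -/
def NonBlocking {L : Type} {kind : L → LKind} (A : VPA kind) : Prop :=
  ∀ (s : A.State) (σ : List L) (α : List A.Stk),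
    ∃ (p : A.State) (β : List A.Stk), A.Moves (s, σ, α) (p, [], β)

end VPA

/-- `I` `(D,F)`-visibly conforms to `S`. -/
def Conforms {L : Type} {kind : L → LKind} (D F : Language L) (I S : VPTS kind) : Prop :=
  (∀ σ, σ ∈ I.otr → σ ∈ F → σ ∉ S.otr) ∧ (∀ σ, σ ∈ I.otr → σ ∈ D → σ ∈ S.otr)

/-- `Q` adheres to the test suite `T`. -/
def Adheres {L : Type} {kind : L → LKind} (Q : VPTS kind) (T : Language L) : Prop :=
  ∀ σ ∈ Q.otr, σ ∉ T

def SoundSuite {L : Type} {kind : L → LKind} (T : Language L) (S : VPTS kind)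
    (D F : Language L) : Prop :=
  ∀ I : VPTS kind, Adheres I T → Conforms D F I S

def ExhaustiveSuite {L : Type} {kind : L → LKind} (T : Language L) (S : VPTS kind)
    (D F : Language L) : Prop :=
  ∀ I : VPTS kind, Conforms D F I S → Adheres I T

def CompleteSuite {L : Type} {kind : L → LKind} (T : Language L) (S : VPTS kind)
    (D F : Language L) : Prop :=
  SoundSuite T S D F ∧ ExhaustiveSuite T S D F

/-! Random access machines, as structured programs over registers and arrays of natural numbers.
The only arithmetic is successor and predecessor, so every number that occurs in a computation is
bounded by the numbers in the input and in the program plus the number of steps. -/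

namespace RAM

/-- The memory: registers, and arrays that are indexed by tuples of natural numbers. -/
structure Mem where
  reg : ℕ → ℕ
  arr : ℕ → List ℕ → ℕ

/-- Write a register. -/
def Mem.setReg (m : Mem) (x v : ℕ) : Mem :=
  { m with reg := Function.update m.reg x v }

/-- Write an array cell. -/
def Mem.setArr (m : Mem) (a : ℕ) (i : List ℕ) (v : ℕ) : Mem :=
  { m with arr := Function.update m.arr a (Function.update (m.arr a) i v) }

/-- Comparisons of two registers. -/
inductive Test where
  | eq (x y : ℕ)
  | ne (x y : ℕ)
  | lt (x y : ℕ)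
  | le (x y : ℕ)

def Test.Holds : Test → Mem → Prop
  | .eq x y, m => m.reg x = m.reg y
  | .ne x y, m => m.reg x ≠ m.reg y
  | .lt x y, m => m.reg x < m.reg y
  | .le x y, m => m.reg x ≤ m.reg y

/-- Programs. All arguments that are natural numbers name registers, except that `c` is a numeral
and `a` names an array; `is` lists the registers that hold the index tuple. -/
inductive Program where
  | skip
  | const (x c : ℕ)
  | copy (x y : ℕ)
  | succ (x y : ℕ)
  | pred (x y : ℕ)
  | load (x a : ℕ) (is : List ℕ)
  | store (a : ℕ) (is : List ℕ) (y : ℕ)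
  | seq (P Q : Program)
  | cond (b : Test) (P Q : Program)
  | loop (b : Test) (P : Program)

/-- `Exec P m t m'`: the program `P`, started in memory `m`, halts after `t` steps in memory `m'`.
An elementary instruction or a test is one step; an array access with an index tuple of length `k`
is charged `k + 1` steps. -/
inductive Exec : Program → Mem → ℕ → Mem → Prop where
  | skip (m) : Exec .skip m 1 m
  | const (m x c) : Exec (.const x c) m 1 (m.setReg x c)
  | copy (m x y) : Exec (.copy x y) m 1 (m.setReg x (m.reg y))
  | succ (m x y) : Exec (.succ x y) m 1 (m.setReg x (m.reg y + 1))
  | pred (m x y) : Exec (.pred x y) m 1 (m.setReg x (m.reg y - 1))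
  | load (m x a is) :
      Exec (.load x a is) m (is.length + 1) (m.setReg x (m.arr a (is.map m.reg)))
  | store (m a is y) :
      Exec (.store a is y) m (is.length + 1) (m.setArr a (is.map m.reg) (m.reg y))
  | seq {P Q m₁ m₂ m₃ t₁ t₂} : Exec P m₁ t₁ m₂ → Exec Q m₂ t₂ m₃ →
      Exec (.seq P Q) m₁ (t₁ + t₂) m₃
  | cond_true {b P Q m t m'} : b.Holds m → Exec P m t m' → Exec (.cond b P Q) m (t + 1) m'
  | cond_false {b P Q m t m'} : ¬ b.Holds m → Exec Q m t m' → Exec (.cond b P Q) m (t + 1) m'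
  | loop_false {b P m} : ¬ b.Holds m → Exec (.loop b P) m 1 m
  | loop_true {b P m₁ m₂ m₃ t₁ t₂} : b.Holds m₁ → Exec P m₁ t₁ m₂ →
      Exec (.loop b P) m₂ t₂ m₃ → Exec (.loop b P) m₁ (t₁ + t₂ + 1) m₃

/-- The cells of array `a` whose index extends `i` hold a list of pairs, and this list enumerates
the pairs `(u, v)` with `R u v`: the length is in cell `i ++ [0]`, and the components of the
`j`-th pair, `1 ≤ j`, are in the cells `i ++ [j, 0]` and `i ++ [j, 1]`. -/
def Mem.Lists (m : Mem) (a : ℕ) (i : List ℕ) (R : ℕ → ℕ → Prop) : Prop :=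
  ∀ u v : ℕ, R u v ↔ ∃ j : ℕ, 1 ≤ j ∧ j ≤ m.arr a (i ++ [0]) ∧
    m.arr a (i ++ [j, 0]) = u ∧ m.arr a (i ++ [j, 1]) = v

/-- The code of a stack symbol: `0` for the bottom symbol, `1 + i` for the symbol number `i`. -/
def stkCode {Γ : Type} {g : ℕ} (e : Γ ≃ Fin g) : Option Γ → ℕ
  | none => 0
  | some Z => (e Z : ℕ) + 1

/-- The alphabet in memory: its size, and the class of each symbol. -/
structure Mem.HoldsAlphabet {L : Type} (m : Mem) (kind : L → LKind)
    (eL : L ≃ Fin (Nat.card L)) : Prop where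
  card : m.arr 0 [0] = Nat.card L
  call : ∀ a, kind a = LKind.call → m.arr 1 [(eL a : ℕ)] = 0
  ret : ∀ a, kind a = LKind.ret → m.arr 1 [(eL a : ℕ)] = 1
  simple : ∀ a, kind a = LKind.simple → m.arr 1 [(eL a : ℕ)] = 2

/-- A transition system in the arrays `b, …, b + 5`, for given numberings of symbols, states and
stack symbols: the numbers of states and of stack symbols; the list of initial states; for each
state and symbol, the list of the push moves (pushed symbol and target) and of the simple moves;
for each state, symbol and topmost stack symbol, the list of the pop moves; for each state, the
list of the internal moves (ε-moves). -/
structure Mem.HoldsSystem {L : Type} {kind : L → LKind} (m : Mem) (b : ℕ)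
    (eL : L ≃ Fin (Nat.card L)) (S : VPTS kind) (eS : S.State ≃ Fin (Nat.card S.State))
    (eG : S.Stk ≃ Fin (Nat.card S.Stk)) : Prop where
  states : m.arr b [0] = Nat.card S.State
  stks : m.arr b [1] = Nat.card S.Stk
  start : m.Lists (b + 1) [] fun u v => u = 0 ∧ ∃ q ∈ S.start, v = (eS q : ℕ)
  push : ∀ p a, m.Lists (b + 2) [(eS p : ℕ), (eL a : ℕ)] fun u v =>
    ∃ Z q, S.push p a Z q ∧ u = stkCode eG (some Z) ∧ v = (eS q : ℕ)
  pop : ∀ p a Z, m.Lists (b + 3) [(eS p : ℕ), (eL a : ℕ), stkCode eG Z] fun u v =>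
    u = 0 ∧ ∃ q, S.pop p a Z q ∧ v = (eS q : ℕ)
  simple : ∀ p a, m.Lists (b + 4) [(eS p : ℕ), (eL a : ℕ)] fun u v =>
    u = 0 ∧ ∃ q, S.flat p (some a) q ∧ v = (eS q : ℕ)
  internal : ∀ p, m.Lists (b + 5) [(eS p : ℕ)] fun u v =>
    u = 0 ∧ ∃ q, S.flat p none q ∧ v = (eS q : ℕ)

/-- The final states, as a table of truth values in array `c`. -/
def Mem.HoldsFinal {Q : Type} {n : ℕ} (m : Mem) (c : ℕ) (e : Q ≃ Fin n) (F : Set Q) : Prop :=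
  (∀ q ∈ F, m.arr c [(e q : ℕ)] = 1) ∧ (∀ q ∉ F, m.arr c [(e q : ℕ)] = 0)

/-- `m` is an initial memory for the input `(I, S, A, B)`: the arrays below `100` describe the
input for some numberings of the symbols, states and stack symbols, and the registers and the
other arrays are zero. -/
def Mem.IsInput {L : Type} {kind : L → LKind} (m : Mem) (I S : VPTS kind) (A B : VPA kind) :
    Prop :=
  (∃ eL : L ≃ Fin (Nat.card L), m.HoldsAlphabet kind eL ∧
    (∃ eI gI, m.HoldsSystem 10 eL I eI gI) ∧
    (∃ eS gS, m.HoldsSystem 20 eL S eS gS) ∧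
    (∃ eA gA, m.HoldsSystem 30 eL A.toVPTS eA gA ∧ m.HoldsFinal 36 eA A.final) ∧
    (∃ eB gB, m.HoldsSystem 40 eL B.toVPTS eB gB ∧ m.HoldsFinal 46 eB B.final)) ∧
  (∀ x, m.reg x = 0) ∧ (∀ a, 100 ≤ a → ∀ i, m.arr a i = 0)

end RAM

/-! Conformance of `I` to `S` fails exactly when some trace of `I` lies in `(F ∩ otr S) ∪ (D \ otr
S)`. This set does not mention `I`, so an automaton for it is a complete test suite
(`completeSuite_iff_of_mem`), and deciding conformance is a reachability question about the product
of `I`, `S`, `A_D` and `A_F`.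

Each device is replaced by a total machine without internal moves. A `Selector` fixes one move
wherever there is one; before a visible move the machine runs to the end of the chosen chain of
internal moves, and a missing move leads to the state `none`. The property `Faithful` says that
nothing is lost by this choice. It follows from both notions of determinism, for different reasons:
in a deterministic VPTS the internal moves of reachable configurations are loops, and in a
deterministic VPA a state with a visible move ends its ε-chain. Hence traces are the words that
avoid `none` (`Faithful.mem_otr`), and a word is accepted when the chain after its last letter meets
a final state (`VPA.mem_language_iff`). The stack of a `CallMachine` stores the state and the symbol
of each pending call instead of the pushed symbol, which can be recomputed from them. The kind of a
letter alone decides whether the stack grows or shrinks, so machines run in lockstep and products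
act on states only.

For the test suite, `S × A_F` is collapsed to one dead state as soon as a component blocks, which
leaves `n_S n_F + 1` states. In `S × A_D` the blocked state of `S` has to stay alive, since it
witnesses a word outside `otr S`; only a blocked `A_D` is dead, which leaves `(n_S + 1) n_D + 1`
states. The product of the two collapsed machines is the required automaton
(`exists_complete_suite`).

For the algorithm, let `N` be the product of the four numbers `n + 1`. The rules `NumSystem.Der`
derive the pairs of states linked by a well-matched word, with two extra rows for the states
reachable with empty and with arbitrary stack; `der_top_iff` says that the last row is the reachable
set. There are at most `(N + 2) N` pairs, and handling one of them costs `O(N |L| ^ 2)`, hence `O(N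
^ 3 |L| ^ 2)` in all. Since every `n` is positive, `N ≤ 16 n_I n_S n_D n_F`, which is within the
stated bound.

The program is written with counting loops only. Such a `Cmd` has a total evaluation function and a
cost that can be read off its syntax (`exists_exec`, `cost_le`), so correctness is a statement about
`eval`: `eval_saturate` for the worklist, `ProductTables.hom` for the machine in memory,
`not_conforms_iff` for the verdict, joined in `conformance_spec`. -/

/-! ### Choosing one move everywhere, and why determinism makes the choice harmless. -/

/-- A chosen element of a set, `none` only if the set is empty. -/
def Selects {α : Type} (o : Option α) (R : α → Prop) : Prop :=
  (∀ x, o = some x → R x) ∧ (o = none → ∀ x, ¬ R x)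

theorem exists_selects {α : Type} (R : α → Prop) : ∃ o, Selects o R := by
  by_cases h : ∃ x, R x
  · obtain ⟨x, hx⟩ := h
    exact ⟨some x, by rintro y ⟨⟩; exact hx, by simp⟩
  · push Not at h
    exact ⟨none, by simp, fun _ => h⟩

theorem Selects.exists_some {α : Type} {o : Option α} {R : α → Prop} (h : Selects o R) {x : α}
    (hx : R x) : ∃ y, o = some y ∧ R y := by
  cases o with
  | none => exact absurd hx (h.2 rfl x)
  | some y => exact ⟨y, rfl, h.1 y rfl⟩

namespace VPTS

variable {L : Type} {kind : L → LKind} {S : VPTS kind}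

theorem Run.append {c d e : S.Config} {τ τ' : List (Option L)} (h : S.Run c τ d)
    (h' : S.Run d τ' e) : S.Run c (τ ++ τ') e := by
  induction h with
  | nil => exact h'
  | cons hs _ ih => exact .cons hs (ih h')

theorem Run.of_append {c e : S.Config} {τ τ' : List (Option L)} (h : S.Run c (τ ++ τ') e) :
    ∃ d, S.Run c τ d ∧ S.Run d τ' e := by
  induction τ generalizing c with
  | nil => exact ⟨c, .nil c, h⟩
  | cons x τ ih =>
    cases h with
    | cons hs hr =>
      obtain ⟨d, h1, h2⟩ := ih hr
      exact ⟨d, .cons hs h1, h2⟩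

theorem ObsRun.refl (c : S.Config) : S.ObsRun c [] c := ⟨[], rfl, .nil c⟩

theorem ObsRun.snoc {c d e : S.Config} {σ : List L} {a : L} (h : S.ObsRun c σ d)
    (hs : S.Step d (some a) e) : S.ObsRun c (σ ++ [a]) e := by
  obtain ⟨τ, rfl, hr⟩ := h
  exact ⟨τ ++ [some a], by simp [List.reduceOption_append], hr.append (.cons hs (.nil e))⟩

theorem ObsRun.internal {c d e : S.Config} {σ : List L} (h : S.ObsRun c σ d)
    (hs : S.Step d none e) : S.ObsRun c σ e := by
  obtain ⟨τ, rfl, hr⟩ := h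
  exact ⟨τ ++ [none], by simp [List.reduceOption_append], hr.append (.cons hs (.nil e))⟩

/-- States linked by internal moves. -/
def EpsReach (S : VPTS kind) : S.State → S.State → Prop :=
  Relation.ReflTransGen fun p q => S.flat p none q

theorem ObsRun.epsReach {c : S.Config} {σ : List L} {p q : S.State} {α : List S.Stk}
    (h : S.ObsRun c σ (p, α)) (hq : S.EpsReach p q) : S.ObsRun c σ (q, α) := by
  induction hq with
  | refl => exact h
  | tail _ hs ih => exact ih.internal (.flat α hs)

/-- A choice of one move wherever there is one. -/
structure Selector (S : VPTS kind) where
  init : Option S.State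
  eps : S.State → Option S.State
  push : S.State → L → Option (S.Stk × S.State)
  pop : S.State → L → Option S.Stk → Option S.State
  simple : S.State → L → Option S.State
  init_spec : Selects init (· ∈ S.start)
  eps_spec : ∀ p, Selects (eps p) (S.flat p none)
  push_spec : ∀ p a, Selects (push p a) fun Zq => S.push p a Zq.1 Zq.2
  pop_spec : ∀ p a Z, Selects (pop p a Z) (S.pop p a Z)
  simple_spec : ∀ p a, Selects (simple p a) (S.flat p (some a))

theorem nonempty_selector (S : VPTS kind) : Nonempty S.Selector := by
  obtain ⟨i, hi⟩ := exists_selects (· ∈ S.start)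
  choose e he using fun p => exists_selects (S.flat p none)
  choose f hf using fun p a => exists_selects fun Zq : S.Stk × S.State => S.push p a Zq.1 Zq.2
  choose g hg using fun p a Z => exists_selects (S.pop p a Z)
  choose h hh using fun p a => exists_selects (S.flat p (some a))
  exact ⟨⟨i, e, f, g, h, hi, he, hf, hg, hh⟩⟩

namespace Selector

variable (X : S.Selector)

/-- One chosen internal move, if there is one. -/
def next (p : S.State) : S.State := (X.eps p).getD p

/-- The state where the chosen internal moves end, unless they cycle. -/
noncomputable def rep (p : S.State) : S.State := X.next^[S.size + 1] p

theorem epsReach_next (p : S.State) : S.EpsReach p (X.next p) := by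
  unfold next
  cases h : X.eps p with
  | none => exact .refl
  | some q => exact .single ((X.eps_spec p).1 q h)

theorem epsReach_iterate (k : ℕ) (p : S.State) : S.EpsReach p (X.next^[k] p) := by
  induction k with
  | zero => exact .refl
  | succ k ih =>
    rw [Function.iterate_succ_apply']
    exact ih.trans (X.epsReach_next _)

theorem epsReach_rep (p : S.State) : S.EpsReach p (X.rep p) := X.epsReach_iterate _ p

/-- When internal moves are unique, the chosen chain is the only one, and a shortest way to a state
on it repeats no state. The bound `S.size + 1` is not sharp; it is the loop limit that the program
has at hand. -/
theorem exists_iterate_of_epsReach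
    (hu : ∀ {p q₁ q₂}, S.flat p none q₁ → S.flat p none q₂ → q₁ = q₂) {p q : S.State}
    (h : S.EpsReach p q) : ∃ k ≤ S.size + 1, X.next^[k] p = q := by
  have h1 : ∃ k, X.next^[k] p = q := by
    induction h with
    | refl => exact ⟨0, rfl⟩
    | @tail b c _ hs ih =>
      obtain ⟨k, hk⟩ := ih
      refine ⟨k + 1, ?_⟩
      rw [Function.iterate_succ_apply', hk]
      obtain ⟨y, hy, hy'⟩ := (X.eps_spec b).exists_some hs
      rw [next, hy]
      exact hu hy' hs
  classical
  refine ⟨Nat.find h1, ?_, Nat.find_spec h1⟩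
  by_contra hlt
  push Not at hlt
  have := S.finite_state
  have := Fintype.ofFinite S.State
  -- Two of the first `S.size + 1` iterates coincide; cutting out the cycle between them contradicts
  -- minimality.
  obtain ⟨i, j, hij, he⟩ := Fintype.exists_ne_map_eq_of_card_lt
    (fun i : Fin (S.size + 1) => X.next^[(i : ℕ)] p) (by simp [size])
  wlog hlt' : i < j generalizing i j
  · exact this j i hij.symm he.symm (lt_of_le_of_ne (not_lt.1 hlt') hij.symm)
  have hj := j.2
  have hlt'' : (i : ℕ) < j := hlt'
  refine Nat.find_min h1 (m := Nat.find h1 - j + i) (by omega) ?_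
  rw [Function.iterate_add_apply, he, ← Function.iterate_add_apply,
    Nat.sub_add_cancel (by omega)]
  exact Nat.find_spec h1

/-- A state without internal moves is a fixed point of `next`, so the surplus iterations in `rep` do
no harm. -/
theorem rep_eq_of_epsReach
    (hu : ∀ {p q₁ q₂}, S.flat p none q₁ → S.flat p none q₂ → q₁ = q₂) {p q : S.State}
    (h : S.EpsReach p q) (hq : ∀ r, ¬ S.flat q none r) : X.rep p = q := by
  obtain ⟨k, hk, rfl⟩ := X.exists_iterate_of_epsReach hu h
  have hfix : X.next (X.next^[k] p) = X.next^[k] p := by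
    rw [next]
    cases h : X.eps (X.next^[k] p) with
    | none => rfl
    | some r => exact absurd ((X.eps_spec _).1 r h) (hq r)
  rw [rep, ← Nat.sub_add_cancel hk, Function.iterate_add_apply]
  exact Function.iterate_fixed hfix _

/-- On reachable configurations, visible moves are unique and start where the chosen internal
moves end. -/
structure Faithful (X : S.Selector) : Prop where
  start_subsingleton : S.start.Subsingleton
  rep_eq : ∀ {s σ q α e a d}, s ∈ S.start → S.ObsRun (s, []) σ (q, α) → S.EpsReach q e →
    S.Step (e, α) (some a) d → X.rep q = e
  unique : ∀ {s σ c a d d'}, s ∈ S.start → S.ObsRun (s, []) σ c → S.Step c (some a) d →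
    S.Step c (some a) d' → d = d'

/-- Internal moves do not change the observable word, so determinism forces every internal move of a
reachable configuration to be a loop. Two equally labeled visible moves extend the word in the same
way. -/
theorem faithful_of_deterministic (h : S.Deterministic) : X.Faithful where
  start_subsingleton s hs s' hs' :=
    congrArg Prod.fst (h s hs s' hs' [] _ _ (.refl _) (.refl _))
  rep_eq {s σ q _ _ _ _} hs hr he _ :=
    congrArg Prod.fst (h s hs s hs σ _ _ (hr.epsReach (X.epsReach_rep q)) (hr.epsReach he))
  unique hs hr h1 h2 := h _ hs _ hs _ _ _ (hr.snoc h1) (hr.snoc h2)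

end Selector

end VPTS

/-- A state with a visible move has no ε-move, so it is the end of the unique ε-chain. The kind of
the symbol decides the type of the move, and within each type moves are unique. -/
theorem VPA.faithful_of_deterministic {L : Type} {kind : L → LKind} {A : VPA kind}
    (h : A.Deterministic) (X : A.toVPTS.Selector) : X.Faithful where
  start_subsingleton := h.start_subsingleton
  rep_eq hs hr he hst := by
    refine X.rep_eq_of_epsReach (fun h1 h2 => h.flat_unique h1 h2) he fun r hr => ?_
    obtain ⟨h1, h2, h3⟩ := h.eps_only hr
    cases hst with
    | push _ h => exact h1 _ _ _ h
    | pop _ h => exact h2 _ _ _ h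
    | popBot h => exact h2 _ _ _ h
    | flat _ h => exact h3 _ _ h
  unique hs hr h1 h2 := by
    cases h1 with
    | push _ h1 =>
      have hk := A.push_call h1
      cases h2 with
      | push _ h2 => obtain ⟨rfl, rfl⟩ := h.push_unique h1 h2; rfl
      | pop _ h2 => simp [A.pop_ret h2] at hk
      | popBot h2 => simp [A.pop_ret h2] at hk
      | flat _ h2 => simp [A.flat_simple h2] at hk
    | pop _ h1 =>
      have hk := A.pop_ret h1
      cases h2 with
      | push _ h2 => simp [A.push_call h2] at hk
      | pop _ h2 => rw [h.pop_unique h1 h2]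
      | flat _ h2 => simp [A.flat_simple h2] at hk
    | popBot h1 =>
      have hk := A.pop_ret h1
      cases h2 with
      | push _ h2 => simp [A.push_call h2] at hk
      | popBot h2 => rw [h.pop_unique h1 h2]
      | flat _ h2 => simp [A.flat_simple h2] at hk
    | flat _ h1 =>
      have hk := A.flat_simple h1
      cases h2 with
      | push _ h2 => simp [A.push_call h2] at hk
      | pop _ h2 => simp [A.pop_ret h2] at hk
      | popBot h2 => simp [A.pop_ret h2] at hk
      | flat _ h2 => rw [h.flat_unique h1 h2]

/-! ### Call machines: homomorphisms, products, and identification of dead states. -/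

/-- A total deterministic visibly pushdown machine whose stack records, for each pending call, the
state and the symbol of the call. -/
structure CallMachine (L Q : Type) where
  init : Q
  simple : Q → L → Q
  call : Q → L → Q
  bot : Q → L → Q
  ret : Q → L → Q → L → Q

namespace CallMachine

variable {L Q R : Type} (kind : L → LKind)

def step (M : CallMachine L Q) (c : Q × List (Q × L)) (a : L) :
    Q × List (Q × L) :=
  match kind a, c with
  | .simple, (q, γ) => (M.simple q a, γ)
  | .call, (q, γ) => (M.call q a, (q, a) :: γ)
  | .ret, (q, []) => (M.bot q a, [])
  | .ret, (q, (p, b) :: γ) => (M.ret q a p b, γ)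

section step

variable {kind} (M : CallMachine L Q) {a : L}

theorem step_simple (h : kind a = .simple) (q : Q) (γ : List (Q × L)) :
    M.step kind (q, γ) a = (M.simple q a, γ) := by simp [step, h]

theorem step_call (h : kind a = .call) (q : Q) (γ : List (Q × L)) :
    M.step kind (q, γ) a = (M.call q a, (q, a) :: γ) := by simp [step, h]

theorem step_bot (h : kind a = .ret) (q : Q) :
    M.step kind (q, []) a = (M.bot q a, []) := by simp [step, h]

theorem step_ret (h : kind a = .ret) (q : Q) (x : Q × L) (γ : List (Q × L)) :
    M.step kind (q, x :: γ) a = (M.ret q a x.1 x.2, γ) := by simp [step, h]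

end step

def run (M : CallMachine L Q) (σ : List L) : Q × List (Q × L) :=
  σ.foldl (M.step kind) (M.init, [])

@[simp] theorem run_nil (M : CallMachine L Q) : M.run kind [] = (M.init, []) := rfl

@[simp] theorem run_snoc (M : CallMachine L Q) (σ : List L) (a : L) :
    M.run kind (σ ++ [a]) = M.step kind (M.run kind σ) a := by
  simp [run]

/-- Homomorphisms of machines. -/
structure Hom (M : CallMachine L Q) (N : CallMachine L R) where
  toFun : Q → R
  init : toFun M.init = N.init
  simple : ∀ q a, toFun (M.simple q a) = N.simple (toFun q) a
  call : ∀ q a, toFun (M.call q a) = N.call (toFun q) a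
  bot : ∀ q a, toFun (M.bot q a) = N.bot (toFun q) a
  ret : ∀ q a p b, toFun (M.ret q a p b) = N.ret (toFun q) a (toFun p) b

/-- Stack entries are states with symbols, so a map of states acts on stacks entrywise and commutes
with every step. -/
theorem Hom.run {M : CallMachine L Q} {N : CallMachine L R} (f : Hom M N) (σ : List L) :
    N.run kind σ = (f.toFun (M.run kind σ).1, (M.run kind σ).2.map (Prod.map f.toFun id)) := by
  induction σ using List.reverseRecOn with
  | nil => simp [f.init]
  | append_singleton σ a ih =>
    rw [run_snoc, run_snoc, ih]
    rcases M.run kind σ with ⟨q, _ | ⟨⟨p, b⟩, γ⟩⟩ <;> cases h : kind a <;>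
      simp [step, h, f.simple, f.call, f.bot, f.ret]

def prod (M : CallMachine L Q) (N : CallMachine L R) : CallMachine L (Q × R) where
  init := (M.init, N.init)
  simple q a := (M.simple q.1 a, N.simple q.2 a)
  call q a := (M.call q.1 a, N.call q.2 a)
  bot q a := (M.bot q.1 a, N.bot q.2 a)
  ret q a p b := (M.ret q.1 a p.1 b, N.ret q.2 a p.2 b)

/-- Both projections are homomorphisms. -/
theorem prod_run_fst (M : CallMachine L Q) (N : CallMachine L R) (σ : List L) :
    ((M.prod N).run kind σ).1 = ((M.run kind σ).1, (N.run kind σ).1) := by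
  rw [Hom.run kind (M := M.prod N) (N := M)
      ⟨Prod.fst, rfl, fun _ _ => rfl, fun _ _ => rfl, fun _ _ => rfl, fun _ _ _ _ => rfl⟩ σ,
    Hom.run kind (M := M.prod N) (N := N)
      ⟨Prod.snd, rfl, fun _ _ => rfl, fun _ _ => rfl, fun _ _ => rfl, fun _ _ _ _ => rfl⟩ σ]

/-- A part `Y` of the states is kept; the other states are absorbing and are identified. -/
structure Collapse (M : CallMachine L Q) (Y : Type) where
  proj : Q → Option Y
  lift : Y → Q
  lift_of_proj : ∀ {x y}, proj x = some y → x = lift y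
  simple : ∀ {x} a, proj x = none → proj (M.simple x a) = none
  call : ∀ {x} a, proj x = none → proj (M.call x a) = none
  bot : ∀ {x} a, proj x = none → proj (M.bot x a) = none
  ret : ∀ {x} a p b, proj x = none → proj (M.ret x a p b) = none

namespace Collapse

variable {kind} {M : CallMachine L Q} {Y : Type} (c : M.Collapse Y)

def machine : CallMachine L (Option Y) where
  init := c.proj M.init
  simple q a := q.bind fun y => c.proj (M.simple (c.lift y) a)
  call q a := q.bind fun y => c.proj (M.call (c.lift y) a)
  bot q a := q.bind fun y => c.proj (M.bot (c.lift y) a)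
  ret q a p b := q.bind fun y => p.bind fun z => c.proj (M.ret (c.lift y) a (c.lift z) b)

/-- Dead states are absorbing, so while the current state is alive every state on the stack is alive
too, and the stacks correspond. Once it is dead, the stacks no longer matter. -/
theorem run_spec (σ : List L) : (c.machine.run kind σ).1 = c.proj (M.run kind σ).1 ∧
    (c.proj (M.run kind σ).1 ≠ none → List.Forall₂
      (fun x y => x.2 = y.2 ∧ ∃ z, x.1 = some z ∧ y.1 = c.lift z)
      (c.machine.run kind σ).2 (M.run kind σ).2) := by
  induction σ using List.reverseRecOn with
  | nil => exact ⟨rfl, fun _ => .nil⟩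
  | append_singleton σ a ih =>
    rw [run_snoc, run_snoc]
    obtain ⟨h1, h2⟩ := ih
    rcases hM : M.run kind σ with ⟨x, γ⟩
    rcases hC : c.machine.run kind σ with ⟨o, δ⟩
    rw [hM, hC] at h1 h2
    dsimp only at h1 h2
    subst h1
    cases hx : c.proj x with
    | none =>
      rcases γ with _ | ⟨⟨p, b⟩, γ⟩ <;> rcases δ with _ | ⟨⟨p', b'⟩, δ⟩ <;> cases h : kind a <;>
        simp [step, h, machine, c.simple _ hx, c.call _ hx, c.bot _ hx, c.ret _ _ _ hx]
    | some y =>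
      have h3 := h2 (by simp [hx])
      obtain rfl := c.lift_of_proj hx
      cases h : kind a with
      | simple => exact ⟨by simp [step, h, machine], fun _ => by simpa [step, h] using h3⟩
      | call => exact ⟨by simp [step, h, machine], fun _ => by simpa [step, h] using h3⟩
      | ret =>
        cases h3 with
        | nil => simp [step, h, machine]
        | cons h4 h5 =>
          rename_i u v _ _
          obtain ⟨u1, u2⟩ := u
          obtain ⟨v1, v2⟩ := v
          obtain ⟨rfl, z, rfl, rfl⟩ := h4
          exact ⟨by simp [step, h, machine], fun _ => by simpa [step, h] using h5⟩

end Collapse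

end CallMachine

/-! ### The machine of a selector recognizes traces and languages. -/

namespace VPTS.Selector

open CallMachine

variable {L : Type} {kind : L → LKind} {S : VPTS kind} (X : S.Selector)

/-- The machine that follows the chosen moves; the state `none` is reached when no move exists. -/
noncomputable def machine : CallMachine L (Option S.State) where
  init := X.init
  simple o a := o.bind fun p => X.simple (X.rep p) a
  call o a := o.bind fun p => (X.push (X.rep p) a).map Prod.snd
  bot o a := o.bind fun p => X.pop (X.rep p) a none
  ret o b o' a := o.bind fun r => o'.bind fun p =>
    (X.push (X.rep p) a).bind fun Zq => X.pop (X.rep r) b (some Zq.1)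

/-- The stack symbol pushed by a pending call. -/
def Pushed (x : Option S.State × L) (Z : S.Stk) : Prop :=
  ∃ p q, x.1 = some p ∧ X.push (X.rep p) x.2 = some (Z, q)

/-- The machine only takes moves of `S`, so this direction needs no determinism. -/
theorem obsRun_of_run {σ : List L} : ∀ {q : S.State} {γ}, X.machine.run kind σ = (some q, γ) →
    ∃ s ∈ S.start, ∃ α, List.Forall₂ X.Pushed γ α ∧ S.ObsRun (s, []) σ (q, α) := by
  induction σ using List.reverseRecOn with
  | nil =>
    intro q γ h
    simp only [run_nil, Prod.mk.injEq] at h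
    obtain ⟨h1, rfl⟩ := h
    exact ⟨q, X.init_spec.1 q h1, [], .nil, .refl _⟩
  | append_singleton σ a ih =>
    intro q γ h
    rw [run_snoc] at h
    rcases hC : X.machine.run kind σ with ⟨o, δ⟩
    rw [hC] at h
    cases o with
    | none =>
      rcases δ with _ | ⟨⟨p', b'⟩, δ⟩ <;> cases hk : kind a <;> simp [step, hk, machine] at h
    | some p =>
      obtain ⟨s, hs, α, hα, hr⟩ := ih hC
      replace hr := hr.epsReach (X.epsReach_rep p)
      refine ⟨s, hs, ?_⟩
      cases hk : kind a with
      | simple =>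
        simp only [step, hk, machine, Option.bind_some, Prod.mk.injEq] at h
        obtain ⟨h1, rfl⟩ := h
        exact ⟨α, hα, hr.snoc (.flat α ((X.simple_spec _ _).1 _ h1))⟩
      | call =>
        simp only [step, hk, machine, Option.bind_some, Prod.mk.injEq, Option.map_eq_some_iff] at h
        obtain ⟨⟨⟨Z, q'⟩, h1, rfl⟩, rfl⟩ := h
        exact ⟨Z :: α, .cons ⟨p, q', rfl, h1⟩ hα, hr.snoc (.push α ((X.push_spec _ _).1 _ h1))⟩
      | ret =>
        cases hα with
        | nil =>
          simp only [step, hk, machine, Option.bind_some, Prod.mk.injEq] at h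
          obtain ⟨h1, rfl⟩ := h
          exact ⟨[], .nil, hr.snoc (.popBot ((X.pop_spec _ _ _).1 _ h1))⟩
        | @cons x Z γ' α hx hα =>
          obtain ⟨x1, x2⟩ := x
          obtain ⟨p', q', rfl, hp'⟩ := hx
          dsimp only at hp'
          simp only [step, hk, machine, Option.bind_some, hp', Prod.mk.injEq] at h
          obtain ⟨h1, rfl⟩ := h
          exact ⟨α, hα, hr.snoc (.pop α ((X.pop_spec _ _ _).1 _ h1))⟩

variable {X}

/-- The machine is lazy: it postpones internal moves until the next visible one. Its state therefore
lags behind the run by a chain of internal moves, which is the reason for `EpsReach` in the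
conclusion. -/
theorem Faithful.run_of_obsRun (hX : X.Faithful) {s : S.State} (hs : s ∈ S.start)
    {σ : List L} {d : S.State} {α : List S.Stk} (h : S.ObsRun (s, []) σ (d, α)) :
    ∃ q γ, X.machine.run kind σ = (some q, γ) ∧ List.Forall₂ X.Pushed γ α ∧ S.EpsReach q d := by
  obtain ⟨τ, rfl, h⟩ := h
  induction τ using List.reverseRecOn generalizing d α with
  | nil =>
    cases h
    obtain ⟨y, hy, hy'⟩ := X.init_spec.exists_some hs
    obtain rfl := hX.start_subsingleton hs hy'
    exact ⟨s, [], by simp [machine, hy], .nil, .refl⟩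
  | append_singleton τ x ih =>
    obtain ⟨⟨e, β⟩, h1, h2⟩ := h.of_append
    obtain ⟨q, γ, hq, hγ, he⟩ := ih h1
    have hst : S.Step (e, β) x (d, α) := by
      cases h2 with
      | cons h2 h3 => cases h3; exact h2
    clear h h2
    cases x with
    | none =>
      cases hst with
      | flat _ h2 => exact ⟨q, γ, by simpa [List.reduceOption_append] using hq, hγ, he.tail h2⟩
    | some a =>
      have hr : S.ObsRun (s, []) τ.reduceOption (e, β) := ⟨τ, rfl, h1⟩
      obtain ⟨s', hs', β', hβ', hr'⟩ := X.obsRun_of_run hq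
      obtain rfl := hX.start_subsingleton hs hs'
      -- A recorded call determines the symbol that it pushed, so both stacks are images of `γ`.
      obtain rfl : β' = β :=
        Relator.RightUnique.forall₂ (fun x Z Z' ⟨p, q, h, h1⟩ ⟨p', q', h', h2⟩ => by
          obtain rfl : p = p' := Option.some_injective _ (h.symm.trans h')
          rw [h1] at h2
          cases h2
          rfl) hβ' hγ
      obtain rfl := hX.rep_eq hs hr' he hst
      have key := fun d' h' => hX.unique (d' := d') hs hr hst h'
      rw [List.reduceOption_append, List.reduceOption_singleton, Option.toList_some, run_snoc, hq]
      clear hr hr' he h1 ih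
      cases hst with
      | push _ h2 =>
        obtain ⟨y, hy, hy'⟩ := (X.push_spec _ _).exists_some (x := (_, _)) h2
        cases key _ (.push β' hy')
        exact ⟨y.2, (some q, a) :: γ, by simp [step, S.push_call h2, machine, hy],
          .cons ⟨q, y.2, rfl, hy⟩ hγ, .refl⟩
      | flat _ h2 =>
        obtain ⟨y, hy, hy'⟩ := (X.simple_spec _ _).exists_some h2
        cases key _ (.flat _ hy')
        exact ⟨_, _, by simp [step, S.flat_simple h2, machine, hy], hγ, .refl⟩
      | popBot h2 =>
        obtain ⟨y, hy, hy'⟩ := (X.pop_spec _ _ _).exists_some h2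
        cases key _ (.popBot hy')
        cases hγ
        exact ⟨_, _, by simp [step, S.pop_ret h2, machine, hy], .nil, .refl⟩
      | pop _ h2 =>
        obtain ⟨y, hy, hy'⟩ := (X.pop_spec _ _ _).exists_some h2
        cases key _ (.pop _ hy')
        cases hγ with
        | @cons x _ _ _ hx hγ =>
          obtain ⟨x1, x2⟩ := x
          obtain ⟨p', q', rfl, hp'⟩ := hx
          dsimp only at hp'
          exact ⟨_, _, by simp [step, S.pop_ret h2, machine, hp', hy], hγ, .refl⟩

theorem Faithful.mem_otr (hX : X.Faithful) (σ : List L) :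
    σ ∈ S.otr ↔ (X.machine.run kind σ).1 ≠ none := by
  constructor
  · rintro ⟨s, hs, ⟨d, α⟩, h⟩
    obtain ⟨q, γ, h, -⟩ := hX.run_of_obsRun hs h
    simp [h]
  · intro h
    obtain ⟨q, hq⟩ := Option.ne_none_iff_exists'.1 h
    obtain ⟨s, hs, α, -, h⟩ := X.obsRun_of_run (Prod.ext hq rfl)
    exact ⟨s, hs, _, h⟩

/-- The chosen internal moves lead from `p` to a final state. -/
def Accepts (X : S.Selector) (final : Set S.State) (p : S.State) : Prop :=
  ∃ k ≤ S.size + 1, X.next^[k] p ∈ final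

end VPTS.Selector

namespace VPA

open CallMachine

variable {L : Type} {kind : L → LKind} {A : VPA kind}

theorem moves_iff_obsRun {s p : A.State} {σ : List L} {α β : List A.Stk} :
    A.Moves (s, σ, α) (p, [], β) ↔ A.toVPTS.ObsRun (s, α) σ (p, β) := by
  constructor
  · intro h
    generalize hc : (s, σ, α) = c at h
    induction h using Relation.ReflTransGen.head_induction_on generalizing s σ α with
    | refl => cases hc; exact .refl _
    | head h1 _ ih =>
      subst hc
      cases h1 with
      | push _ _ h =>
        obtain ⟨τ, rfl, h'⟩ := ih rfl
        exact ⟨some _ :: τ, rfl, .cons (.push _ h) h'⟩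
      | pop _ _ h =>
        obtain ⟨τ, rfl, h'⟩ := ih rfl
        exact ⟨some _ :: τ, rfl, .cons (.pop _ h) h'⟩
      | popBot _ h =>
        obtain ⟨τ, rfl, h'⟩ := ih rfl
        exact ⟨some _ :: τ, rfl, .cons (.popBot h) h'⟩
      | simple _ _ h =>
        obtain ⟨τ, rfl, h'⟩ := ih rfl
        exact ⟨some _ :: τ, rfl, .cons (.flat _ h) h'⟩
      | eps _ _ h =>
        obtain ⟨τ, rfl, h'⟩ := ih rfl
        exact ⟨none :: τ, rfl, .cons (.flat _ h) h'⟩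
  · rintro ⟨τ, rfl, h⟩
    generalize hc : (s, α) = c at h
    generalize hd : (p, β) = d at h
    induction h generalizing s α with
    | nil => subst hc; cases hd; exact .refl
    | @cons _ _ _ x _ h1 _ ih =>
      subst hc
      cases h1 with
      | push _ h => exact .head (.push _ _ h) (ih rfl hd)
      | pop _ h => exact .head (.pop _ _ h) (ih rfl hd)
      | popBot h => exact .head (.popBot _ h) (ih rfl hd)
      | flat _ h =>
        cases x with
        | none => exact .head (.eps _ _ h) (ih rfl hd)
        | some a => exact .head (.simple _ _ h) (ih rfl hd)

/-- An accepting run may stop anywhere on the ε-chain after its last letter, so the whole chain is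
searched for final states, not only its end. -/
theorem mem_language_iff (hA : A.Deterministic) (X : A.toVPTS.Selector) (σ : List L) :
    σ ∈ A.language ↔ ∃ p, (X.machine.run kind σ).1 = some p ∧ X.Accepts A.final p := by
  have hX := faithful_of_deterministic hA X
  constructor
  · rintro ⟨s, hs, p, hp, β, h⟩
    obtain ⟨q, γ, hq, -, he⟩ := hX.run_of_obsRun hs (moves_iff_obsRun.1 h)
    obtain ⟨k, hk, rfl⟩ := X.exists_iterate_of_epsReach (fun h1 h2 => hA.flat_unique h1 h2) he
    exact ⟨q, by rw [hq], k, hk, hp⟩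
  · rintro ⟨p, hp, k, -, hk⟩
    obtain ⟨s, hs, α, -, h⟩ := X.obsRun_of_run (Prod.ext hp rfl)
    exact ⟨s, hs, _, hk, α, moves_iff_obsRun.2 (h.epsReach (X.epsReach_iterate k p))⟩

end VPA

/-! ### Call machines as ε-free deterministic non-blocking automata. -/

namespace CallMachine

variable {L Q : Type} {kind : L → LKind}

/-- A machine with final states, as an automaton. -/
def toVPA (kind : L → LKind) [Finite L] [Finite Q] (M : CallMachine L Q) (final : Set Q) :
    VPA kind where
  State := Q
  Stk := Q × L
  finite_state := inferInstance
  finite_stk := inferInstance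
  start := {M.init}
  push p a Z q := kind a = LKind.call ∧ Z = (p, a) ∧ q = M.call p a
  pop p a Z q := kind a = LKind.ret ∧ q = Z.elim (M.bot p a) fun x => M.ret p a x.1 x.2
  flat p x q := ∃ a, x = some a ∧ kind a = LKind.simple ∧ q = M.simple p a
  push_call h := h.1
  pop_ret h := h.1
  flat_simple := by
    rintro p a q ⟨b, hb, h, -⟩
    cases hb
    exact h
  final := final

variable [Finite L] [Finite Q] (M : CallMachine L Q) (final : Set Q)

theorem toVPA_epsFree : (M.toVPA kind final).EpsFree := by
  rintro p q ⟨a, ha, -⟩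
  cases ha

theorem toVPA_deterministic : (M.toVPA kind final).Deterministic where
  start_subsingleton := Set.subsingleton_singleton
  push_unique := by
    rintro p a Z₁ Z₂ q₁ q₂ ⟨-, rfl, rfl⟩ ⟨-, rfl, rfl⟩
    exact ⟨rfl, rfl⟩
  pop_unique := by
    rintro p a Z q₁ q₂ ⟨-, rfl⟩ ⟨-, rfl⟩
    rfl
  flat_unique := by
    rintro p x q₁ q₂ ⟨a, rfl, -, rfl⟩ ⟨b, hb, -, rfl⟩
    cases hb
    rfl
  eps_only h := absurd h (toVPA_epsFree M final _ _)

theorem toVPA_moves (σ : List L) (q : Q) (γ : List (Q × L)) :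
    (M.toVPA kind final).Moves (q, σ, γ)
      ((σ.foldl (M.step kind) (q, γ)).1, [], (σ.foldl (M.step kind) (q, γ)).2) := by
  induction σ generalizing q γ with
  | nil => exact .refl
  | cons a σ ih =>
    rw [List.foldl_cons]
    refine .head ?_ (ih _ _)
    cases h : kind a with
    | call => simpa only [step, h] using .push (A := M.toVPA kind final) σ γ ⟨h, rfl, rfl⟩
    | simple =>
      simpa only [step, h] using .simple (A := M.toVPA kind final) σ γ ⟨a, rfl, h, rfl⟩
    | ret =>
      cases γ with
      | nil => simpa only [step, h] using .popBot (A := M.toVPA kind final) σ ⟨h, rfl⟩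
      | cons x γ =>
        simpa only [step, h] using .pop (A := M.toVPA kind final) (Z := x) σ γ ⟨h, rfl⟩

theorem toVPA_nonBlocking : (M.toVPA kind final).NonBlocking :=
  fun s σ α => ⟨_, _, toVPA_moves M final σ s α⟩

/-- Every move of the automaton reads a letter and is the step of the machine for it. -/
theorem foldl_of_moves {σ : List L} {q p : (M.toVPA kind final).State}
    {γ δ : List (M.toVPA kind final).Stk}
    (h : (M.toVPA kind final).Moves (q, σ, γ) (p, [], δ)) :
    σ.foldl (M.step kind) (q, γ) = (p, δ) := by
  generalize hc : (q, σ, γ) = c at h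
  induction h using Relation.ReflTransGen.head_induction_on generalizing q σ γ with
  | refl => cases hc; rfl
  | head h1 _ ih =>
    subst hc
    cases h1 with
    | push _ _ h =>
      obtain ⟨h, rfl, rfl⟩ := h
      exact (congrArg (List.foldl _ · _) (M.step_call h _ _)).trans (ih rfl)
    | pop _ _ h =>
      obtain ⟨h, rfl⟩ := h
      exact (congrArg (List.foldl _ · _) (M.step_ret h _ _ _)).trans (ih rfl)
    | popBot _ h =>
      obtain ⟨h, rfl⟩ := h
      exact (congrArg (List.foldl _ · _) (M.step_bot h _)).trans (ih rfl)
    | simple _ _ h =>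
      obtain ⟨b, hb, h, rfl⟩ := h
      cases hb
      exact (congrArg (List.foldl _ · _) (M.step_simple h _ _)).trans (ih rfl)
    | eps _ _ h => exact absurd h (toVPA_epsFree M final _ _)

theorem mem_toVPA_language (σ : List L) :
    σ ∈ (M.toVPA kind final).language ↔ (M.run kind σ).1 ∈ final := by
  constructor
  · rintro ⟨s, rfl, p, hp, β, h⟩
    have := foldl_of_moves M final h
    rw [show M.run kind σ = (p, β) from this]
    exact hp
  · intro h
    exact ⟨_, rfl, _, h, _, toVPA_moves M final σ _ _⟩

end CallMachine

/-! ### The complete test suite. -/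

namespace VPTS.Selector

variable {L : Type} {kind : L → LKind} {S S' : VPTS kind} (X : S.Selector) (X' : S'.Selector)

/-- In a product of two systems, the pairs with a blocked second component are identified. -/
noncomputable def collapseRight {Q : Type} (M : CallMachine L Q) :
    (M.prod X.machine).Collapse (Q × S.State) where
  proj x := x.2.map fun q => (x.1, q)
  lift y := (y.1, some y.2)
  lift_of_proj := by
    rintro ⟨x, _ | q⟩ y h <;> simp at h
    rw [← h]
  simple := by rintro ⟨x, _ | q⟩ a h <;> simp_all [CallMachine.prod, machine]
  call := by rintro ⟨x, _ | q⟩ a h <;> simp_all [CallMachine.prod, machine]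
  bot := by rintro ⟨x, _ | q⟩ a h <;> simp_all [CallMachine.prod, machine]
  ret := by rintro ⟨x, _ | q⟩ a p b h <;> simp_all [CallMachine.prod, machine]

/-- In a product of two systems, the pairs with a blocked component are identified. -/
noncomputable def collapseBoth : (X.machine.prod X'.machine).Collapse (S.State × S'.State) where
  proj x := x.1.bind fun p => x.2.map fun q => (p, q)
  lift y := (some y.1, some y.2)
  lift_of_proj := by
    rintro ⟨_ | p, _ | q⟩ y h <;> simp at h
    rw [← h]
  simple := by rintro ⟨_ | p, _ | q⟩ a h <;> simp_all [CallMachine.prod, machine]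
  call := by rintro ⟨_ | p, _ | q⟩ a h <;> simp_all [CallMachine.prod, machine]
  bot := by rintro ⟨_ | p, _ | q⟩ a h <;> simp_all [CallMachine.prod, machine]
  ret := by rintro ⟨_ | p, _ | q⟩ a p b h <;> simp_all [CallMachine.prod, machine]

end VPTS.Selector

/-- The words of `T` are exactly those whose presence in an implementation violates one of the two
clauses of conformance. -/
theorem completeSuite_iff_of_mem {L : Type} {kind : L → LKind} {T D F : Language L}
    {S : VPTS kind} (h : ∀ σ, σ ∈ T ↔ (σ ∈ F ∧ σ ∈ S.otr) ∨ (σ ∈ D ∧ σ ∉ S.otr)) :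
    CompleteSuite T S D F := by
  constructor
  · intro I hI
    exact ⟨fun σ h1 h2 h3 => hI σ h1 ((h σ).2 (.inl ⟨h2, h3⟩)),
      fun σ h1 h2 => by_contra fun h3 => hI σ h1 ((h σ).2 (.inr ⟨h2, h3⟩))⟩
  · intro I hI σ h1 h2
    rcases (h σ).1 h2 with h3 | h3
    · exact hI.1 σ h1 h3.1 h3.2
    · exact h3.2 (hI.2 σ h1 h3.1)

theorem exists_complete_suite {L : Type} [Finite L] {kind : L → LKind} (S : VPTS kind)
    (AD AF : VPA kind) (hS : S.Deterministic) (hD : AD.Deterministic) (hF : AF.Deterministic) :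
    ∃ T : VPA kind, T.Deterministic ∧ T.NonBlocking ∧ T.EpsFree ∧
      T.size ≤ (S.size * AF.size + 1) * (S.size * AD.size + AD.size + 1) ∧
      CompleteSuite T.language S AD.language AF.language := by
  obtain ⟨XS⟩ := S.nonempty_selector
  obtain ⟨XD⟩ := AD.nonempty_selector
  obtain ⟨XF⟩ := AF.nonempty_selector
  have := S.finite_state
  have := AD.finite_state
  have := AF.finite_state
  let C₁ := XS.collapseBoth XF
  let C₂ := XD.collapseRight XS.machine
  refine ⟨(C₁.machine.prod C₂.machine).toVPA kind
    -- Left: `S` is alive and `A_F` accepts. Right: `S` is blocked and `A_D` accepts.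
    {x | (∃ y, x.1 = some y ∧ XF.Accepts AF.final y.2) ∨
      ∃ q, x.2 = some (none, q) ∧ XD.Accepts AD.final q},
    CallMachine.toVPA_deterministic _ _, CallMachine.toVPA_nonBlocking _ _,
    CallMachine.toVPA_epsFree _ _, ?_, completeSuite_iff_of_mem fun σ => ?_⟩
  · change Nat.card (Option (S.State × AF.State) × Option (Option S.State × AD.State)) ≤ _
    simp only [Nat.card_prod, Finite.card_option, VPTS.size]
    exact le_of_eq (by ring)
  · rw [CallMachine.mem_toVPA_language, CallMachine.prod_run_fst, (C₁.run_spec σ).1,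
      (C₂.run_spec σ).1, CallMachine.prod_run_fst, CallMachine.prod_run_fst,
      VPA.mem_language_iff hF XF, VPA.mem_language_iff hD XD,
      (XS.faithful_of_deterministic hS).mem_otr]
    simp only [C₁, C₂, VPTS.Selector.collapseBoth, VPTS.Selector.collapseRight,
      Set.mem_ofPred_eq]
    cases (XS.machine.run kind σ).1 <;> cases (XF.machine.run kind σ).1 <;>
      cases (XD.machine.run kind σ).1 <;> simp

/-! ### Programs with counting loops: evaluation and static running time. -/

namespace RAM

@[simp] theorem Mem.setReg_reg (m : Mem) (x v y : ℕ) :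
    (m.setReg x v).reg y = if y = x then v else m.reg y :=
  Function.update_apply _ _ _ _

@[simp] theorem Mem.setReg_arr (m : Mem) (x v : ℕ) : (m.setReg x v).arr = m.arr := rfl

@[simp] theorem Mem.setArr_reg (m : Mem) (a : ℕ) (i : List ℕ) (v : ℕ) :
    (m.setArr a i v).reg = m.reg := rfl

@[simp] theorem Mem.setArr_arr (m : Mem) (a : ℕ) (i : List ℕ) (v a' : ℕ) (i' : List ℕ) :
    (m.setArr a i v).arr a' i' = if a' = a ∧ i' = i then v else m.arr a' i' := by
  by_cases h : a' = a
  · subst h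
    simp [Mem.setArr, Function.update_apply]
  · simp [Mem.setArr, h]

instance : ∀ (b : Test) (m : Mem), Decidable (b.Holds m)
  | .eq x y, m => inferInstanceAs (Decidable (m.reg x = m.reg y))
  | .ne x y, m => inferInstanceAs (Decidable (m.reg x ≠ m.reg y))
  | .lt x y, m => inferInstanceAs (Decidable (m.reg x < m.reg y))
  | .le x y, m => inferInstanceAs (Decidable (m.reg x ≤ m.reg y))

/-- Programs whose only loops are counting loops: `rep i n P` runs `P` with the values
`0, 1, …, reg n - 1` in register `i`. -/
inductive Cmd where
  | skip
  | const (x c : ℕ)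
  | copy (x y : ℕ)
  | succ (x y : ℕ)
  | pred (x y : ℕ)
  | load (x a : ℕ) (is : List ℕ)
  | store (a : ℕ) (is : List ℕ) (y : ℕ)
  | seq (P Q : Cmd)
  | cond (b : Test) (P Q : Cmd)
  | rep (i n : ℕ) (P : Cmd)

namespace Cmd

def block : List Cmd → Cmd
  | [] => skip
  | P :: Ps => seq P (block Ps)

def toProgram : Cmd → Program
  | skip => .skip
  | const x c => .const x c
  | copy x y => .copy x y
  | succ x y => .succ x y
  | pred x y => .pred x y
  | load x a is => .load x a is
  | store a is y => .store a is y
  | seq P Q => .seq P.toProgram Q.toProgram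
  | cond b P Q => .cond b P.toProgram Q.toProgram
  | rep i n P => .seq (.const i 0) (.loop (.lt i n) (.seq P.toProgram (.succ i i)))

/-- A loop leaves its limit in the counter, as the while loop of `toProgram` does. That the two
forms agree is shown in `exists_exec` under `ok`, which keeps loop bodies from writing counters and
limits. -/
def eval : Cmd → Mem → Mem
  | skip, m => m
  | const x c, m => m.setReg x c
  | copy x y, m => m.setReg x (m.reg y)
  | succ x y, m => m.setReg x (m.reg y + 1)
  | pred x y, m => m.setReg x (m.reg y - 1)
  | load x a is, m => m.setReg x (m.arr a (is.map m.reg))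
  | store a is y, m => m.setArr a (is.map m.reg) (m.reg y)
  | seq P Q, m => Q.eval (P.eval m)
  | cond b P Q, m => if b.Holds m then P.eval m else Q.eval m
  | rep i n P, m =>
    (Nat.rec m (fun k m' => P.eval (m'.setReg i k)) (m.reg n) : Mem).setReg i (m.reg n)

@[simp] theorem eval_skip (m : Mem) : skip.eval m = m := rfl

@[simp] theorem eval_const (x c : ℕ) (m : Mem) : (const x c).eval m = m.setReg x c := rfl

@[simp] theorem eval_copy (x y : ℕ) (m : Mem) : (copy x y).eval m = m.setReg x (m.reg y) := rfl

@[simp] theorem eval_succ (x y : ℕ) (m : Mem) :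
    (succ x y).eval m = m.setReg x (m.reg y + 1) := rfl

@[simp] theorem eval_pred (x y : ℕ) (m : Mem) :
    (pred x y).eval m = m.setReg x (m.reg y - 1) := rfl

@[simp] theorem eval_load (x a : ℕ) (is : List ℕ) (m : Mem) :
    (load x a is).eval m = m.setReg x (m.arr a (is.map m.reg)) := rfl

@[simp] theorem eval_store (a : ℕ) (is : List ℕ) (y : ℕ) (m : Mem) :
    (store a is y).eval m = m.setArr a (is.map m.reg) (m.reg y) := rfl

@[simp] theorem eval_seq (P Q : Cmd) (m : Mem) : (seq P Q).eval m = Q.eval (P.eval m) := rfl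

@[simp] theorem eval_cond_eq (x y : ℕ) (P Q : Cmd) (m : Mem) :
    (cond (.eq x y) P Q).eval m = if m.reg x = m.reg y then P.eval m else Q.eval m := rfl

@[simp] theorem eval_cond_lt (x y : ℕ) (P Q : Cmd) (m : Mem) :
    (cond (.lt x y) P Q).eval m = if m.reg x < m.reg y then P.eval m else Q.eval m := rfl

@[simp] theorem eval_block_nil (m : Mem) : (block []).eval m = m := rfl

@[simp] theorem eval_block_cons (P : Cmd) (Ps : List Cmd) (m : Mem) :
    (block (P :: Ps)).eval m = (block Ps).eval (P.eval m) := rfl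

/-- The registers that may change. -/
def writes : Cmd → List ℕ
  | skip => []
  | const x _ => [x]
  | copy x _ => [x]
  | succ x _ => [x]
  | pred x _ => [x]
  | load x _ _ => [x]
  | store _ _ _ => []
  | seq P Q => P.writes ++ Q.writes
  | cond _ P Q => P.writes ++ Q.writes
  | rep i _ P => i :: P.writes

/-- The arrays that may change. -/
def stores : Cmd → List ℕ
  | store a _ _ => [a]
  | seq P Q => P.stores ++ Q.stores
  | cond _ P Q => P.stores ++ Q.stores
  | rep _ _ P => P.stores
  | _ => []

/-- The limits of the loops are registers in `Λ`, which do not change, and no loop changes its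
counter. -/
def ok (Λ : List ℕ) : Cmd → Bool
  | skip => true
  | const x _ => x ∉ Λ
  | copy x _ => x ∉ Λ
  | succ x _ => x ∉ Λ
  | pred x _ => x ∉ Λ
  | load x _ _ => x ∉ Λ
  | store _ _ _ => true
  | seq P Q => P.ok Λ && Q.ok Λ
  | cond _ P Q => P.ok Λ && Q.ok Λ
  | rep i n P => n ∈ Λ && i ∉ Λ && i ∉ P.writes && P.ok Λ

theorem eval_reg (P : Cmd) {m : Mem} {x : ℕ} (h : x ∉ P.writes) :
    (P.eval m).reg x = m.reg x := by
  induction P generalizing m with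
  | skip => rfl
  | seq P Q ihP ihQ =>
    simp only [writes, List.mem_append, not_or] at h
    rw [eval, ihQ h.2, ihP h.1]
  | cond b P Q ihP ihQ =>
    simp only [writes, List.mem_append, not_or] at h
    rw [eval]
    split
    exacts [ihP h.1, ihQ h.2]
  | rep i n P ih =>
    simp only [writes, List.mem_cons, not_or] at h
    simp only [eval, Mem.setReg, Function.update_of_ne h.1]
    induction m.reg n with
    | zero => rfl
    | succ k ihk =>
      dsimp only
      rw [ih h.2]
      simpa only [Function.update_of_ne h.1] using ihk
  | store => rfl
  | _ =>
    simp only [writes, List.mem_singleton] at h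
    exact Function.update_of_ne h _ _

theorem eval_arr (P : Cmd) {m : Mem} {a : ℕ} (h : a ∉ P.stores) :
    (P.eval m).arr a = m.arr a := by
  induction P generalizing m with
  | seq P Q ihP ihQ =>
    simp only [stores, List.mem_append, not_or] at h
    rw [eval, ihQ h.2, ihP h.1]
  | cond b P Q ihP ihQ =>
    simp only [stores, List.mem_append, not_or] at h
    rw [eval]
    split
    exacts [ihP h.1, ihQ h.2]
  | rep i n P ih =>
    simp only [eval, Mem.setReg]
    induction m.reg n with
    | zero => rfl
    | succ k ihk => exact (ih h).trans ihk
  | store a' is y =>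
    simp only [stores, List.mem_singleton] at h
    exact Function.update_of_ne h _ _
  | _ => rfl

theorem not_mem_writes_of_ok {Λ : List ℕ} {P : Cmd} (h : P.ok Λ) {x : ℕ} (hx : x ∈ Λ) :
    x ∉ P.writes := by
  induction P with
  | skip => simp [writes]
  | store => simp [writes]
  | seq P Q ihP ihQ =>
    simp only [ok, Bool.and_eq_true] at h
    simp [writes, ihP h.1, ihQ h.2]
  | cond b P Q ihP ihQ =>
    simp only [ok, Bool.and_eq_true] at h
    simp [writes, ihP h.1, ihQ h.2]
  | rep i n P ih =>
    simp only [ok, Bool.and_eq_true, decide_eq_true_eq] at h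
    simp only [writes, List.mem_cons, not_or]
    exact ⟨fun h' => h.1.1.2 (h' ▸ hx), ih h.2⟩
  | _ =>
    simp only [ok, decide_eq_true_eq] at h
    simp only [writes, List.mem_singleton]
    exact fun h' => h (h' ▸ hx)

/-- An invariant of a counting loop. -/
theorem rep_induct {i n : ℕ} {P : Cmd} {m : Mem} (I : ℕ → Mem → Prop) (h0 : I 0 m)
    (hi : ∀ k v m', I k m' → I k (m'.setReg i v))
    (hs : ∀ k < m.reg n, ∀ m', I k m' → (∀ x, x ≠ i → x ∉ P.writes → m'.reg x = m.reg x) →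
      (∀ a ∉ P.stores, m'.arr a = m.arr a) → m'.reg i = k → I (k + 1) (P.eval m')) :
    I (m.reg n) ((rep i n P).eval m) := by
  refine hi _ _ _ ?_
  have key : ∀ N ≤ m.reg n,
      let m' : Mem := Nat.rec m (fun k m' => P.eval (m'.setReg i k)) N
      I N m' ∧ (∀ x, x ≠ i → x ∉ P.writes → m'.reg x = m.reg x) ∧
        ∀ a ∉ P.stores, m'.arr a = m.arr a := by
    intro N
    induction N with
    | zero => exact fun _ => ⟨h0, fun _ _ _ => rfl, fun _ _ => rfl⟩
    | succ N ih =>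
      intro hN
      obtain ⟨h1, h2, h3⟩ := ih (by omega)
      refine ⟨hs N (by omega) _ (hi _ _ _ h1) (fun x hx hx' => ?_) h3
        (Function.update_self _ _ _), fun x hx hx' => ?_, fun a ha => ?_⟩
      · rw [← h2 x hx hx']
        exact Function.update_of_ne hx _ _
      · dsimp only
        rw [eval_reg _ hx', ← h2 x hx hx']
        exact Function.update_of_ne hx _ _
      · exact (eval_arr _ ha).trans (h3 a ha)
  exact (key _ le_rfl).1

/-- A bound for the running time, when register `n` holds `ρ n` throughout for each limit `n` of a
loop. -/
def cost (ρ : ℕ → ℕ) : Cmd → ℕ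
  | load _ _ is => is.length + 1
  | store _ is _ => is.length + 1
  | seq P Q => P.cost ρ + Q.cost ρ
  | cond _ P Q => P.cost ρ + Q.cost ρ + 1
  | rep _ n P => 2 + ρ n * (P.cost ρ + 2)
  | _ => 1

/-- The limits never change, so the number of rounds of each loop is known in advance and the cost
depends on the syntax only. -/
theorem exists_exec {Λ : List ℕ} {ρ : ℕ → ℕ} {P : Cmd} (h : P.ok Λ) {m : Mem}
    (hm : ∀ n ∈ Λ, m.reg n = ρ n) : ∃ t ≤ P.cost ρ, Exec P.toProgram m t (P.eval m) := by
  induction P generalizing m with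
  | skip => exact ⟨_, le_rfl, .skip m⟩
  | const x c => exact ⟨_, le_rfl, .const m x c⟩
  | copy x y => exact ⟨_, le_rfl, .copy m x y⟩
  | succ x y => exact ⟨_, le_rfl, .succ m x y⟩
  | pred x y => exact ⟨_, le_rfl, .pred m x y⟩
  | load x a is => exact ⟨_, le_rfl, .load m x a is⟩
  | store a is y => exact ⟨_, le_rfl, .store m a is y⟩
  | seq P Q ihP ihQ =>
    simp only [ok, Bool.and_eq_true] at h
    obtain ⟨t, ht, h1⟩ := ihP h.1 hm
    obtain ⟨t', ht', h2⟩ := ihQ h.2 (m := P.eval m) fun n hn => by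
      rw [eval_reg _ (not_mem_writes_of_ok h.1 hn), hm n hn]
    exact ⟨_, Nat.add_le_add ht ht', .seq h1 h2⟩
  | cond b P Q ihP ihQ =>
    simp only [ok, Bool.and_eq_true] at h
    by_cases hb : b.Holds m
    · obtain ⟨t, ht, h1⟩ := ihP h.1 hm
      refine ⟨t + 1, by simp only [cost]; omega, ?_⟩
      rw [eval, if_pos hb]
      exact .cond_true hb h1
    · obtain ⟨t, ht, h1⟩ := ihQ h.2 hm
      refine ⟨t + 1, by simp only [cost]; omega, ?_⟩
      rw [eval, if_neg hb]
      exact .cond_false hb h1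
  | rep i n P ih =>
    simp only [ok, Bool.and_eq_true, decide_eq_true_eq] at h
    obtain ⟨⟨⟨hn, hi⟩, hiP⟩, hP⟩ := h
    let f : ℕ → Mem := fun k => Nat.rec m (fun k m' => P.eval (m'.setReg i k)) k
    have hf : ∀ k, ∀ x ∈ Λ, (f k).reg x = m.reg x := by
      intro k x hx
      have hxi : x ≠ i := fun h => hi (h ▸ hx)
      induction k with
      | zero => rfl
      | succ k ihk =>
        refine (eval_reg _ (not_mem_writes_of_ok hP hx)).trans (Eq.trans ?_ ihk)
        exact Function.update_of_ne hxi _ _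
    have hni : n ≠ i := fun h => hi (h ▸ hn)
    -- Induction on the number `j` of remaining rounds. Each round pays for the body, the increment
    -- and the test; the summand `1` is the final test.
    have key : ∀ j k, j + k = m.reg n → ∃ t ≤ 1 + j * (P.cost ρ + 2),
        Exec (.loop (.lt i n) (.seq P.toProgram (.succ i i))) ((f k).setReg i k) t
          ((f (m.reg n)).setReg i (m.reg n)) := by
      intro j
      induction j with
      | zero =>
        intro k hk
        obtain rfl : k = m.reg n := by omega
        refine ⟨1, by omega, .loop_false ?_⟩
        simp [Test.Holds, Mem.setReg, Function.update_of_ne hni, hf _ n hn]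
      | succ j ihj =>
        intro k hk
        obtain ⟨t, ht, h1⟩ := ihj (k + 1) (by omega)
        obtain ⟨t', ht', h2⟩ := ih hP (m := (f k).setReg i k) fun x hx => by
          rw [← hm x hx, ← hf k x hx]
          exact Function.update_of_ne (fun (h : x = i) => hi (h ▸ hx)) _ _
        refine ⟨(t' + 1) + t + 1, by rw [Nat.succ_mul]; omega, .loop_true ?_ (.seq h2 ?_) h1⟩
        · simp only [Test.Holds, Mem.setReg, Function.update_of_ne hni, Function.update_self,
            hf _ n hn]
          omega
        · have h3 := Exec.succ (P.eval ((f k).setReg i k)) i i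
          rwa [eval_reg _ hiP, show ((f k).setReg i k).reg i = k from
            Function.update_self _ _ _] at h3
    obtain ⟨t, ht, h1⟩ := key (m.reg n) 0 (by omega)
    refine ⟨1 + t, ?_, .seq (.const m i 0) h1⟩
    simp only [cost]
    rw [← hm n hn]
    omega

/-- Coefficient and exponents of a monomial that bounds the running time: register `1` limits the
loops over symbols, the other limits are numbers of states. -/
def coef : Cmd → ℕ
  | load _ _ is => is.length + 1
  | store _ is _ => is.length + 1
  | seq P Q => P.coef + Q.coef
  | cond _ P Q => P.coef + Q.coef + 1
  | rep _ _ P => P.coef + 4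
  | _ => 1

def degL : Cmd → ℕ
  | seq P Q => max P.degL Q.degL
  | cond _ P Q => max P.degL Q.degL
  | rep _ n P => if n = 1 then P.degL + 1 else P.degL
  | _ => 0

def degN : Cmd → ℕ
  | seq P Q => max P.degN Q.degN
  | cond _ P Q => max P.degN Q.degN
  | rep _ n P => if n = 1 then P.degN else P.degN + 1
  | _ => 0

/-- The overhead of a loop is absorbed by adding `4` to the coefficient: `2` for the set-up and `2`
for each round. -/
theorem loop_cost_le {B n c x y : ℕ} (hB : 0 < B) (hn : n ≤ B) (hx : x ≤ c * y) (hy : 1 ≤ y) :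
    2 + n * (x + 2) ≤ (c + 4) * (B * y) :=
  calc 2 + n * (x + 2) ≤ 2 * (B * y) + B * (c * y + 2 * y) :=
        Nat.add_le_add (by nlinarith) (Nat.mul_le_mul hn (by omega))
    _ = (c + 4) * (B * y) := by ring

theorem cost_le {Λ : List ℕ} {ρ : ℕ → ℕ} {P : Cmd} (h : P.ok Λ) {G N : ℕ} (hG : 0 < G)
    (hN : 0 < N) (hρ : ∀ n ∈ Λ, ρ n ≤ if n = 1 then G else N) :
    P.cost ρ ≤ P.coef * (G ^ P.degL * N ^ P.degN) := by
  have hmono : ∀ {a a' b b' : ℕ}, a ≤ a' → b ≤ b' → G ^ a * N ^ b ≤ G ^ a' * N ^ b' :=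
    fun h1 h2 => Nat.mul_le_mul (Nat.pow_le_pow_right hG h1) (Nat.pow_le_pow_right hN h2)
  have hpos : ∀ a b : ℕ, 1 ≤ G ^ a * N ^ b := fun a b => Nat.one_le_iff_ne_zero.2 (by positivity)
  induction P with
  | seq P Q ihP ihQ =>
    simp only [ok, Bool.and_eq_true] at h
    simp only [cost, coef, degL, degN, Nat.add_mul]
    exact Nat.add_le_add
      ((ihP h.1).trans (Nat.mul_le_mul_left _ (hmono (le_max_left _ _) (le_max_left _ _))))
      ((ihQ h.2).trans (Nat.mul_le_mul_left _ (hmono (le_max_right _ _) (le_max_right _ _))))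
  | cond b P Q ihP ihQ =>
    simp only [ok, Bool.and_eq_true] at h
    simp only [cost, coef, degL, degN, Nat.add_mul, Nat.one_mul]
    exact Nat.add_le_add (Nat.add_le_add
      ((ihP h.1).trans (Nat.mul_le_mul_left _ (hmono (le_max_left _ _) (le_max_left _ _))))
      ((ihQ h.2).trans (Nat.mul_le_mul_left _ (hmono (le_max_right _ _) (le_max_right _ _)))))
      (hpos _ _)
  | rep i n P ih =>
    simp only [ok, Bool.and_eq_true, decide_eq_true_eq] at h
    obtain ⟨⟨⟨hn, -⟩, -⟩, hP⟩ := h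
    have h1 := ih hP
    have h2 := hρ n hn
    have hx := hpos P.degL P.degN
    simp only [cost, coef, degL, degN]
    split_ifs with h3
    · rw [if_pos h3] at h2
      exact (loop_cost_le hG h2 h1 hx).trans (le_of_eq (by ring))
    · rw [if_neg h3] at h2
      exact (loop_cost_le hN h2 h1 hx).trans (le_of_eq (by ring))
  | load => simp [cost, coef, degL, degN]
  | store => simp [cost, coef, degL, degN]
  | _ => exact le_rfl

end Cmd

/-! ### Commands that compute the moves of the product. -/

/-- The code of the second component of the first pair of a list in memory. -/
def first (f : ℕ → List ℕ → ℕ) (a : ℕ) (i : List ℕ) : ℕ :=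
  if f a (i ++ [0]) = 0 then 0 else f a (i ++ [1, 1]) + 1

/-- For the system in the arrays `b, …, b + 5`: the successor of component `b` of the state `p` of
the product. The arrays `100 + b` and `102 + b` hold the ends of the chains of internal moves and
the components. -/
def simpleVal (f : ℕ → List ℕ → ℕ) (p a b : ℕ) : ℕ :=
  if f (102 + b) [p] = 0 then 0 else first f (b + 4) [f (100 + b) [f (102 + b) [p]], a]

def callVal (f : ℕ → List ℕ → ℕ) (p a b : ℕ) : ℕ :=
  if f (102 + b) [p] = 0 then 0 else first f (b + 2) [f (100 + b) [f (102 + b) [p]], a]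

def botVal (f : ℕ → List ℕ → ℕ) (p a b : ℕ) : ℕ :=
  if f (102 + b) [p] = 0 then 0 else first f (b + 3) [f (100 + b) [f (102 + b) [p]], a, 0]

/-- Here `q` and `c` are the state and symbol of the matching call. Cell `[…, 1, 0]` is the first
component of the first push move, already coded with `0` reserved for the bottom, so it indexes the
pop table directly. -/
def retVal (f : ℕ → List ℕ → ℕ) (p a q c b : ℕ) : ℕ :=
  if f (102 + b) [p] = 0 then 0 else
  if f (102 + b) [q] = 0 then 0 else
  if f (b + 2) [f (100 + b) [f (102 + b) [q]], c, 0] = 0 then 0 else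
  first f (b + 3) [f (100 + b) [f (102 + b) [p]], a,
    f (b + 2) [f (100 + b) [f (102 + b) [q]], c, 1, 0]]

/-- The number of a state of the product of the four systems. -/
def tuple (f : ℕ → List ℕ → ℕ) (v : ℕ → ℕ) : ℕ := f 200 [v 10, v 20, v 30, v 40]

namespace Cmd

def look (d a : ℕ) (is : List ℕ) : Cmd :=
  block [const 90 0, const 91 1, load 92 a (is ++ [90]),
    cond (.eq 92 90) (const d 0) (block [load 92 a (is ++ [91, 91]), succ d 92])]

theorem eval_look (d a : ℕ) (is : List ℕ) (h : ∀ x ∈ is, x < 90 ∨ 92 < x) (m : Mem) :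
    ((look d a is).eval m).reg d = first m.arr a (is.map m.reg) := by
  have h1 : ∀ m' : Mem, (∀ x, x < 90 ∨ 92 < x → m'.reg x = m.reg x) →
      is.map m'.reg = is.map m.reg := fun m' hm => List.map_congr_left fun x hx => hm x (h x hx)
  simp only [look, eval_block_cons, eval_block_nil, eval_const, eval_load, eval_cond_eq, eval_succ,
    List.map_append, List.map_cons, List.map_nil, Mem.setReg_arr]
  rw [h1 ((m.setReg 90 0).setReg 91 1) fun x hx => by
      simp [show x ≠ 90 by omega, show x ≠ 91 by omega]]
  rw [h1 (((m.setReg 90 0).setReg 91 1).setReg 92 _) fun x hx => by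
    simp [show x ≠ 90 by omega, show x ≠ 91 by omega, show x ≠ 92 by omega]]
  simp only [first]
  split_ifs <;> simp_all

theorem look_writes (d a : ℕ) (is : List ℕ) : (look d a is).writes = [90, 91, 92, d, 92, d] := rfl

theorem look_stores (d a : ℕ) (is : List ℕ) : (look d a is).stores = [] := rfl

/-- The state is in register `80`, the symbol in `81`, the result in `88`. -/
def simpleC (b : ℕ) : Cmd :=
  block [load 84 (102 + b) [80], const 93 0, cond (.eq 84 93) (const 88 0)
    (block [load 85 (100 + b) [84], look 88 (b + 4) [85, 81]])]

def callC (b : ℕ) : Cmd :=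
  block [load 84 (102 + b) [80], const 93 0, cond (.eq 84 93) (const 88 0)
    (block [load 85 (100 + b) [84], look 88 (b + 2) [85, 81]])]

def botC (b : ℕ) : Cmd :=
  block [load 84 (102 + b) [80], const 93 0, cond (.eq 84 93) (const 88 0)
    (block [load 85 (100 + b) [84], look 88 (b + 3) [85, 81, 93]])]

/-- The state and the symbol of the pending call are in the registers `82` and `83`. -/
def retC (b : ℕ) : Cmd :=
  block [load 84 (102 + b) [80], load 86 (102 + b) [82], const 93 0,
    cond (.eq 84 93) (const 88 0) (cond (.eq 86 93) (const 88 0)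
      (block [load 85 (100 + b) [84], load 87 (100 + b) [86], load 94 (b + 2) [87, 83, 93],
        cond (.eq 94 93) (const 88 0)
          (block [const 95 1, load 94 (b + 2) [87, 83, 95, 93], look 88 (b + 3) [85, 81, 94]])]))]

theorem eval_simpleC (b : ℕ) (m : Mem) :
    ((simpleC b).eval m).reg 88 = simpleVal m.arr (m.reg 80) (m.reg 81) b := by
  by_cases h : m.arr (102 + b) [m.reg 80] = 0
  · simp [simpleC, simpleVal, h]
  · simp [simpleC, simpleVal, h, eval_look]

theorem eval_callC (b : ℕ) (m : Mem) :
    ((callC b).eval m).reg 88 = callVal m.arr (m.reg 80) (m.reg 81) b := by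
  by_cases h : m.arr (102 + b) [m.reg 80] = 0
  · simp [callC, callVal, h]
  · simp [callC, callVal, h, eval_look]

theorem eval_botC (b : ℕ) (m : Mem) :
    ((botC b).eval m).reg 88 = botVal m.arr (m.reg 80) (m.reg 81) b := by
  by_cases h : m.arr (102 + b) [m.reg 80] = 0
  · simp [botC, botVal, h]
  · simp [botC, botVal, h, eval_look]

theorem eval_retC (b : ℕ) (m : Mem) :
    ((retC b).eval m).reg 88 =
      retVal m.arr (m.reg 80) (m.reg 81) (m.reg 82) (m.reg 83) b := by
  by_cases h1 : m.arr (102 + b) [m.reg 80] = 0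
  · simp [retC, retVal, h1]
  by_cases h2 : m.arr (102 + b) [m.reg 82] = 0
  · simp [retC, retVal, h2]
  by_cases h3 : m.arr (b + 2) [m.arr (100 + b) [m.arr (102 + b) [m.reg 82]], m.reg 83, 0] = 0
  · simp [retC, retVal, h1, h2, h3]
  · simp [retC, retVal, h1, h2, h3, eval_look]

/-- A command for each of the four systems, and the number of the tuple of the results. -/
def lift (c : ℕ → Cmd) : Cmd :=
  block [c 10, copy 96 88, c 20, copy 97 88, c 30, copy 98 88, c 40, copy 99 88,
    load 89 200 [96, 97, 98, 99]]

/-- The four commands share their scratch registers `84, …, 95`; the arguments below and the saved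
results above survive. -/
theorem eval_lift {c : ℕ → Cmd} {V : (ℕ → List ℕ → ℕ) → ℕ → ℕ → ℕ → ℕ → ℕ → ℕ}
    (hw : ∀ b, ∀ x ∈ (c b).writes, 84 ≤ x ∧ x < 96) (hs : ∀ b, (c b).stores = [])
    (hV : ∀ b m, ((c b).eval m).reg 88 =
      V m.arr (m.reg 80) (m.reg 81) (m.reg 82) (m.reg 83) b) (m : Mem) :
    ((lift c).eval m).reg 89 =
      tuple m.arr (V m.arr (m.reg 80) (m.reg 81) (m.reg 82) (m.reg 83)) := by
  have ha : ∀ b m, ((c b).eval m).arr = m.arr := fun b m => funext fun a =>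
    eval_arr _ (by simp [hs])
  have hr : ∀ b m x, (x < 84 ∨ 96 ≤ x) → ((c b).eval m).reg x = m.reg x := fun b m x hx =>
    eval_reg _ fun h => by have := hw b x h; omega
  simp [lift, hV, ha, hr, tuple]

theorem eval_simple (m : Mem) : ((lift simpleC).eval m).reg 89 =
    tuple m.arr (simpleVal m.arr (m.reg 80) (m.reg 81)) :=
  eval_lift (V := fun f p a _ _ => simpleVal f p a) (c := simpleC)
    (fun b => show ∀ x ∈ [84, 93, 88, 85, 90, 91, 92, 88, 92, 88], 84 ≤ x ∧ x < 96 by decide)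
    (fun _ => rfl) eval_simpleC m

theorem eval_call (m : Mem) : ((lift callC).eval m).reg 89 =
    tuple m.arr (callVal m.arr (m.reg 80) (m.reg 81)) :=
  eval_lift (V := fun f p a _ _ => callVal f p a) (c := callC)
    (fun b => show ∀ x ∈ [84, 93, 88, 85, 90, 91, 92, 88, 92, 88], 84 ≤ x ∧ x < 96 by decide)
    (fun _ => rfl) eval_callC m

theorem eval_bot (m : Mem) : ((lift botC).eval m).reg 89 =
    tuple m.arr (botVal m.arr (m.reg 80) (m.reg 81)) :=
  eval_lift (V := fun f p a _ _ => botVal f p a) (c := botC)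
    (fun b => show ∀ x ∈ [84, 93, 88, 85, 90, 91, 92, 88, 92, 88], 84 ≤ x ∧ x < 96 by decide)
    (fun _ => rfl) eval_botC m

theorem eval_ret (m : Mem) : ((lift retC).eval m).reg 89 =
    tuple m.arr (retVal m.arr (m.reg 80) (m.reg 81) (m.reg 82) (m.reg 83)) :=
  eval_lift (V := retVal) (c := retC)
    (fun b => show ∀ x ∈ [84, 86, 93, 88, 88, 85, 87, 94, 88, 95, 94, 90, 91, 92, 88, 92, 88],
      84 ≤ x ∧ x < 96 by decide)
    (fun _ => rfl) eval_retC m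

theorem eval_init (m : Mem) : ((lift fun b => look 88 (b + 1) []).eval m).reg 89 =
    tuple m.arr fun b => first m.arr (b + 1) [] :=
  eval_lift (V := fun f _ _ _ _ b => first f (b + 1) [])
    (c := fun b => look 88 (b + 1) []) (fun b => show ∀ x ∈ [90, 91, 92, 88, 92, 88], 84 ≤ x ∧ x < 96 by decide)
    (fun _ => rfl) (fun b m => eval_look _ _ _ (by simp) m) m

/-- The ends of the chains of internal moves, and whether a chain visits a final state, for the
system in the arrays `b, …, b + 6`; register `n` holds the number of its states plus one. -/
def chains (b n : ℕ) : Cmd :=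
  rep 50 n (block [const 51 0, cond (.eq 50 51) skip (block [pred 52 50, load 53 (b + 6) [52],
    rep 54 n (block [look 55 (b + 5) [52], const 51 0, cond (.eq 55 51) skip (pred 52 55),
      load 56 (b + 6) [52], const 57 1, cond (.eq 56 57) (const 53 1) skip]),
    store (100 + b) [50] 52, store (101 + b) [50] 53])])

end Cmd

/-! ### Input tables as selectors, and the chains of internal moves. -/

/-- The lists in memory agree with the choices of a selector. -/
structure Reads {L : Type} {kind : L → LKind} (f : ℕ → List ℕ → ℕ) (b : ℕ)
    (eL : L ≃ Fin (Nat.card L)) {S : VPTS kind} (X : S.Selector)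
    (eS : S.State ≃ Fin (Nat.card S.State)) (eG : S.Stk ≃ Fin (Nat.card S.Stk)) : Prop where
  init : first f (b + 1) [] = stkCode eS X.init
  eps : ∀ p, first f (b + 5) [(eS p : ℕ)] = stkCode eS (X.eps p)
  push : ∀ p a, first f (b + 2) [(eS p : ℕ), (eL a : ℕ)] =
    stkCode eS ((X.push p a).map Prod.snd)
  pushed : ∀ p a Z q, X.push p a = some (Z, q) →
    f (b + 2) [(eS p : ℕ), (eL a : ℕ), 1, 0] = stkCode eG (some Z)
  pop : ∀ p a Z, first f (b + 3) [(eS p : ℕ), (eL a : ℕ), stkCode eG Z] =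
    stkCode eS (X.pop p a Z)
  simple : ∀ p a, first f (b + 4) [(eS p : ℕ), (eL a : ℕ)] = stkCode eS (X.simple p a)

theorem Mem.Lists.first_cases {m : Mem} {a : ℕ} {i : List ℕ} {R : ℕ → ℕ → Prop}
    (h : m.Lists a i R) : (first m.arr a i = 0 ∧ ∀ u v, ¬ R u v) ∨
      R (m.arr a (i ++ [1, 0])) (m.arr a (i ++ [1, 1])) ∧
        first m.arr a i = m.arr a (i ++ [1, 1]) + 1 := by
  by_cases h0 : m.arr a (i ++ [0]) = 0
  · refine .inl ⟨if_pos h0, fun u v huv => ?_⟩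
    obtain ⟨j, h1, h2, -⟩ := (h u v).1 huv
    omega
  · exact .inr ⟨(h _ _).2 ⟨1, le_rfl, Nat.one_le_iff_ne_zero.2 h0, rfl, rfl⟩, if_neg h0⟩

theorem Mem.Lists.exists_first {Q : Type} {n : ℕ} {e : Q ≃ Fin n} {m : Mem} {a : ℕ}
    {i : List ℕ} {R : Q → Prop} (h : m.Lists a i fun u v => u = 0 ∧ ∃ q, R q ∧ v = (e q : ℕ)) :
    ∃ o, Selects o R ∧ first m.arr a i = stkCode e o := by
  rcases h.first_cases with ⟨h1, h2⟩ | ⟨⟨-, q, hq, hv⟩, h1⟩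
  · exact ⟨none, ⟨by simp, fun _ q hq => h2 0 _ ⟨rfl, q, hq, rfl⟩⟩, h1⟩
  · exact ⟨some q, ⟨by rintro _ ⟨⟩; exact hq, by simp⟩, by rw [h1, hv]; rfl⟩

/-- The selector is read off the memory: it picks the first entry of each list. Lists may have any
order and repetitions, so determinism is not needed here. -/
theorem Mem.HoldsSystem.exists_reads {L : Type} {kind : L → LKind} {m : Mem} {b : ℕ}
    {eL : L ≃ Fin (Nat.card L)} {S : VPTS kind} {eS : S.State ≃ Fin (Nat.card S.State)}
    {eG : S.Stk ≃ Fin (Nat.card S.Stk)} (h : m.HoldsSystem b eL S eS eG) :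
    ∃ X : S.Selector, Reads m.arr b eL X eS eG := by
  obtain ⟨i, hi, hi'⟩ := h.start.exists_first
  choose e he he' using fun p => (h.internal p).exists_first
  choose g hg hg' using fun p a Z => (h.pop p a Z).exists_first
  choose s hs hs' using fun p a => (h.simple p a).exists_first
  have : ∀ p a, ∃ o, Selects o (fun Zq => S.push p a Zq.1 Zq.2) ∧
      first m.arr (b + 2) [(eS p : ℕ), (eL a : ℕ)] = stkCode eS (o.map Prod.snd) ∧
      ∀ Z q, o = some (Z, q) →
        m.arr (b + 2) [(eS p : ℕ), (eL a : ℕ), 1, 0] = stkCode eG (some Z) := by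
    intro p a
    rcases (h.push p a).first_cases with ⟨h1, h2⟩ | ⟨⟨Z, q, hq, hu, hv⟩, h1⟩
    · exact ⟨none, ⟨by simp, fun _ Zq hq => h2 _ _ ⟨Zq.1, Zq.2, hq, rfl, rfl⟩⟩, h1, by simp⟩
    · refine ⟨some (Z, q), ⟨by rintro _ ⟨⟩; exact hq, by simp⟩, by rw [h1, hv]; rfl, ?_⟩
      rintro _ _ ⟨⟩
      exact hu
  choose f hf hf' hf'' using this
  exact ⟨⟨i, e, f, g, s, hi, he, hf, hg, hs⟩, hi', he', hf', hf'', hg', hs'⟩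

theorem Reads.congr {L : Type} {kind : L → LKind} {f g : ℕ → List ℕ → ℕ} {b : ℕ}
    {eL : L ≃ Fin (Nat.card L)} {S : VPTS kind} {X : S.Selector}
    {eS : S.State ≃ Fin (Nat.card S.State)} {eG : S.Stk ≃ Fin (Nat.card S.Stk)}
    (h : Reads f b eL X eS eG) (hfg : ∀ a < b + 6, g a = f a) : Reads g b eL X eS eG := by
  obtain ⟨h1, h2, h3, h4, h5, h6⟩ := h
  constructor <;> simpa (disch := omega) only [first, hfg]

open Cmd

section chains

variable {L : Type} {kind : L → LKind} {S : VPTS kind} {X : S.Selector} {b n : ℕ}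
  {eL : L ≃ Fin (Nat.card L)} {eS : S.State ≃ Fin (Nat.card S.State)}
  {eG : S.Stk ≃ Fin (Nat.card S.Stk)}

/-- The body of the inner loop of `chains`, named so that it can be evaluated separately. -/
def Cmd.chainStep (b : ℕ) : Cmd :=
  block [look 55 (b + 5) [52], const 51 0, cond (.eq 55 51) skip (pred 52 55),
    load 56 (b + 6) [52], const 57 1, cond (.eq 56 57) (const 53 1) skip]

theorem eval_chainStep {m : Mem} (hR : Reads m.arr b eL X eS eG) {p : S.State}
    (hp : m.reg 52 = eS p) : ((chainStep b).eval m).reg 52 = eS (X.next p) ∧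
      ((chainStep b).eval m).reg 53 =
        if m.arr (b + 6) [(eS (X.next p) : ℕ)] = 1 then 1 else m.reg 53 := by
  have h1 : ∀ x, x ≠ 55 → (x < 90 ∨ 92 < x) →
      ((look 55 (b + 5) [52]).eval m).reg x = m.reg x := fun x hx hx' =>
    eval_reg _ (by simp [look_writes]; omega)
  have h2 : ((look 55 (b + 5) [52]).eval m).arr = m.arr := funext fun a => eval_arr _ (by
    simp [look_stores])
  have h3 : ((look 55 (b + 5) [52]).eval m).reg 55 = stkCode eS (X.eps p) := by
    rw [eval_look _ _ _ (by simp), ← hR.eps p]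
    simp [hp]
  cases he : X.eps p with
  | none =>
    have h4 : X.next p = p := by simp [VPTS.Selector.next, he]
    have h3 : ((look 55 (b + 5) [52]).eval m).reg 55 = 0 := by rw [h3, he]; rfl
    rw [h4]
    constructor
    · simp [chainStep, h1, h2, h3, hp]
      split_ifs <;> simp [h1, hp]
    · simp [chainStep, h1, h2, h3, hp]
      split_ifs <;> simp [h1]
  | some q =>
    have h4 : X.next p = q := by simp [VPTS.Selector.next, he]
    have h3 : ((look 55 (b + 5) [52]).eval m).reg 55 = (eS q : ℕ) + 1 := by rw [h3, he]; rfl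
    rw [h4]
    constructor
    · simp [chainStep, h2, h3]
      split_ifs <;> simp
    · simp [chainStep, h2, h3]
      split_ifs <;> simp [h1]

/-- The `S.size + 1` rounds are the iterations in `rep`, and the flag records whether one of the
iterates, the start included, is final. The claim about the flag is conditional because plain
transition systems have no table of final states. -/
theorem eval_chain {m : Mem} (hR : Reads m.arr b eL X eS eG) (hn : m.reg n = S.size + 1)
    {q : S.State} (hq : m.reg 52 = eS q) (hf : m.reg 53 = m.arr (b + 6) [(eS q : ℕ)]) :
    ((rep 54 n (chainStep b)).eval m).reg 52 = eS (X.rep q) ∧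
      ∀ F, m.HoldsFinal (b + 6) eS F →
        (X.Accepts F q → ((rep 54 n (chainStep b)).eval m).reg 53 = 1) ∧
        (¬ X.Accepts F q → ((rep 54 n (chainStep b)).eval m).reg 53 = 0) := by
  have := rep_induct (i := 54) (n := n) (P := chainStep b) (m := m)
    (fun k m' => m'.reg 52 = eS (X.next^[k] q) ∧ ∀ F, m.HoldsFinal (b + 6) eS F →
      ((∃ j ≤ k, X.next^[j] q ∈ F) → m'.reg 53 = 1) ∧
      ((¬ ∃ j ≤ k, X.next^[j] q ∈ F) → m'.reg 53 = 0)) ?_ ?_ ?_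
  · rw [hn] at this
    exact this
  · refine ⟨hq, fun F hF => ⟨?_, fun h => ?_⟩⟩
    · rintro ⟨j, hj, h⟩
      obtain rfl : j = 0 := by omega
      rw [hf]
      exact hF.1 _ h
    · rw [hf]
      exact hF.2 _ fun h' => h ⟨0, le_rfl, h'⟩
  · intro k v m' h
    simpa using h
  · rintro k - m' ⟨h1, h2⟩ - ha -
    have ha' : m'.arr = m.arr := funext fun a => ha a (by simp [chainStep, stores, block, look])
    obtain ⟨h3, h4⟩ := eval_chainStep (m := m') (by rwa [ha']) h1
    rw [← Function.iterate_succ_apply' X.next, Nat.succ_eq_add_one] at h3 h4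
    refine ⟨h3, fun F hF => ?_⟩
    rw [h4, ha']
    have h5 : (∃ j ≤ k + 1, X.next^[j] q ∈ F) ↔
        (∃ j ≤ k, X.next^[j] q ∈ F) ∨ X.next^[k + 1] q ∈ F := by
      simp only [Nat.le_succ_iff, or_and_right, exists_or, exists_eq_left]
    rw [h5]
    by_cases h6 : X.next^[k + 1] q ∈ F
    · rw [hF.1 _ h6]
      exact ⟨fun _ => if_pos rfl, fun h => absurd (.inr h6) h⟩
    · rw [hF.2 _ h6, if_neg (by decide)]
      simpa only [h6, or_false] using h2 F hF

theorem eval_chains {m : Mem} (hb : b < 90) (hn5 : n < 50) (hR : Reads m.arr b eL X eS eG)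
    (hn : m.reg n = S.size + 1) (hz : m.arr (101 + b) [0] = 0) :
    ((chains b n).eval m).arr (101 + b) [0] = 0 ∧
    ∀ q, ((chains b n).eval m).arr (100 + b) [(eS q : ℕ) + 1] = eS (X.rep q) ∧
      ∀ F, m.HoldsFinal (b + 6) eS F →
        (X.Accepts F q → ((chains b n).eval m).arr (101 + b) [(eS q : ℕ) + 1] = 1) ∧
        (¬ X.Accepts F q → ((chains b n).eval m).arr (101 + b) [(eS q : ℕ) + 1] = 0) := by
  rw [chains]
  refine (rep_induct (m := m)
    (fun k m' => m'.arr (101 + b) [0] = 0 ∧ ∀ q, (eS q : ℕ) + 1 < k →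
      m'.arr (100 + b) [(eS q : ℕ) + 1] = eS (X.rep q) ∧
      ∀ F, m.HoldsFinal (b + 6) eS F →
        (X.Accepts F q → m'.arr (101 + b) [(eS q : ℕ) + 1] = 1) ∧
        (¬ X.Accepts F q → m'.arr (101 + b) [(eS q : ℕ) + 1] = 0))
    ⟨hz, by simp⟩ ?_ ?_).imp_right fun h q => h q (by
      rw [hn]; have := (eS q).2; simp only [VPTS.size]; omega)
  · intro k v m' h
    simpa using h
  · rintro k hk m' ⟨h0, h1⟩ hr ha hi
    have hrn : m'.reg n = m.reg n := hr n (by omega)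
      (by simp [writes, block, look]; omega)
    have ha' : ∀ a < 100, m'.arr a = m.arr a := fun a h => ha a (by
      simp [stores, block, look]; omega)
    -- Code `0` stands for the blocked state; it is skipped, so its flag keeps the value `0`.
    rcases Nat.eq_zero_or_pos k with rfl | hk0
    · simp [hi, h0]
    · obtain ⟨q, hq⟩ : ∃ q, (eS q : ℕ) = k - 1 := by
        rw [hn, VPTS.size] at hk
        exact ⟨eS.symm ⟨k - 1, by omega⟩, by simp⟩
      obtain ⟨h3, h4⟩ := eval_chain (n := n)
        (m := ((m'.setReg 51 0).setReg 52 (k - 1)).setReg 53 (m'.arr (b + 6) [k - 1]))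
        (hR.congr fun a h => ha' a (by omega))
        (by simp [hrn, hn, show n ≠ 51 by omega, show n ≠ 52 by omega, show n ≠ 53 by omega])
        (q := q) (by simp [hq]) (by simp [hq])
      have hF : ∀ F, m.HoldsFinal (b + 6) eS F →
          (((m'.setReg 51 0).setReg 52 (k - 1)).setReg 53
            (m'.arr (b + 6) [k - 1])).HoldsFinal (b + 6) eS F := fun F hF => by
        simpa only [Mem.HoldsFinal, Mem.setReg_arr, ha' (b + 6) (by omega)] using hF
      have h5 : ∀ m'', ((rep 54 n (chainStep b)).eval m'').reg 50 = m''.reg 50 := fun m'' =>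
        eval_reg _ (by simp [writes, chainStep, block, look])
      have h6 : ∀ m'', ((rep 54 n (chainStep b)).eval m'').arr = m''.arr := fun m'' =>
        funext fun a => eval_arr _ (by simp [stores, chainStep, block, look])
      simp only [chainStep] at h3 h4 h5 h6
      have hk1 : k ≠ 0 := by omega
      simp only [eval_block_cons, eval_block_nil, eval_const, eval_cond_eq, eval_pred, eval_load,
        eval_store, Mem.setReg_reg, hi, hk1, Mem.setReg_arr, List.map_cons, List.map_nil,
        Mem.setArr_arr, Mem.setArr_reg, h5, h6, h3, if_true, if_false, Nat.reduceEqDiff]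
      refine ⟨by simp [h0, hk1.symm], fun q' hq' => ?_⟩
      by_cases hqq : q' = q
      · subst hqq
        simp only [show (eS q' : ℕ) + 1 = k by omega]
        simpa using fun F hF' => h4 F (hF F hF')
      · have : (eS q' : ℕ) ≠ eS q := fun h => hqq (eS.injective (Fin.ext h))
        have h7 := h1 q' (by omega)
        simp [show (eS q' : ℕ) + 1 ≠ k by omega]
        exact h7

end chains

/-! ### Numbering the states of the product. -/

/-- The number of a tuple in the product of four intervals. -/
def num4 (n₂ n₃ n₄ i₁ i₂ i₃ i₄ : ℕ) : ℕ := ((i₁ * n₂ + i₂) * n₃ + i₃) * n₄ + i₄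

theorem mul_add_inj {n a b c d : ℕ} (hb : b < n) (hd : d < n) (h : a * n + b = c * n + d) :
    a = c ∧ b = d := by
  have key : ∀ {x y : ℕ}, y < n → (x * n + y) / n = x := fun {x y} hy => by
    rw [Nat.mul_comm, Nat.mul_add_div (by omega), Nat.div_eq_of_lt hy, Nat.add_zero]
  have h1 : a = c := (key hb).symm.trans (h ▸ key hd)
  subst h1
  exact ⟨rfl, by omega⟩

theorem num4_inj {n₂ n₃ n₄ i₁ i₂ i₃ i₄ j₁ j₂ j₃ j₄ : ℕ} (hi₂ : i₂ < n₂) (hi₃ : i₃ < n₃)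
    (hi₄ : i₄ < n₄) (hj₂ : j₂ < n₂) (hj₃ : j₃ < n₃) (hj₄ : j₄ < n₄)
    (h : num4 n₂ n₃ n₄ i₁ i₂ i₃ i₄ = num4 n₂ n₃ n₄ j₁ j₂ j₃ j₄) :
    i₁ = j₁ ∧ i₂ = j₂ ∧ i₃ = j₃ ∧ i₄ = j₄ := by
  obtain ⟨h, h4⟩ := mul_add_inj hi₄ hj₄ h
  obtain ⟨h, h3⟩ := mul_add_inj hi₃ hj₃ h
  obtain ⟨h, h2⟩ := mul_add_inj hi₂ hj₂ h
  exact ⟨h, h2, h3, h4⟩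

theorem num4_lt {n₁ n₂ n₃ n₄ i₁ i₂ i₃ i₄ : ℕ} (h₁ : i₁ < n₁) (h₂ : i₂ < n₂) (h₃ : i₃ < n₃)
    (h₄ : i₄ < n₄) : num4 n₂ n₃ n₄ i₁ i₂ i₃ i₄ < n₁ * n₂ * n₃ * n₄ := by
  have key : ∀ {a b n k : ℕ}, a < n → b < k → a * k + b < n * k := fun {a b n k} ha hb => by
    have := Nat.mul_le_mul_right k (show a + 1 ≤ n from ha)
    rw [Nat.succ_mul] at this
    omega
  exact key (key (key h₁ h₂) h₃) h₄

theorem exists_num4 {n₁ n₂ n₃ n₄ p : ℕ} (h : p < n₁ * n₂ * n₃ * n₄) :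
    ∃ i₁ i₂ i₃ i₄, i₁ < n₁ ∧ i₂ < n₂ ∧ i₃ < n₃ ∧ i₄ < n₄ ∧ num4 n₂ n₃ n₄ i₁ i₂ i₃ i₄ = p := by
  have key : ∀ {q n k : ℕ}, q < n * k → ∃ a b, a < n ∧ b < k ∧ a * k + b = q :=
    fun {q n k} hq => ⟨q / k, q % k, Nat.div_lt_of_lt_mul (by rwa [Nat.mul_comm]),
      Nat.mod_lt _ (Nat.pos_of_ne_zero (by rintro rfl; simp at hq)), Nat.div_add_mod' q k⟩
  obtain ⟨q, i₄, hq, h₄, rfl⟩ := key h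
  obtain ⟨r, i₃, hr, h₃, rfl⟩ := key hq
  obtain ⟨i₁, i₂, h₁, h₂, rfl⟩ := key hr
  exact ⟨i₁, i₂, i₃, i₄, h₁, h₂, h₃, h₄, rfl⟩

/-- The components of the states of the product with numbers below `v`, and the numbers of the
tuples, are in memory. -/
def Numbered (f : ℕ → List ℕ → ℕ) (n₁ n₂ n₃ n₄ v : ℕ) : Prop :=
  ∀ i₁ < n₁, ∀ i₂ < n₂, ∀ i₃ < n₃, ∀ i₄ < n₄, num4 n₂ n₃ n₄ i₁ i₂ i₃ i₄ < v →
    f 112 [num4 n₂ n₃ n₄ i₁ i₂ i₃ i₄] = i₁ ∧ f 122 [num4 n₂ n₃ n₄ i₁ i₂ i₃ i₄] = i₂ ∧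
    f 132 [num4 n₂ n₃ n₄ i₁ i₂ i₃ i₄] = i₃ ∧ f 142 [num4 n₂ n₃ n₄ i₁ i₂ i₃ i₄] = i₄ ∧
    f 200 [i₁, i₂, i₃, i₄] = num4 n₂ n₃ n₄ i₁ i₂ i₃ i₄

def Cmd.numberStep : Cmd :=
  block [store 112 [6] 50, store 122 [6] 51, store 132 [6] 52, store 142 [6] 53,
    store 200 [50, 51, 52, 53] 6, succ 6 6]

/-- Numbers the product of the four intervals whose lengths are in the registers `2, …, 5`, and
counts it in register `6`. -/
def Cmd.numbering : Cmd :=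
  block [const 6 0, rep 50 2 (rep 51 3 (rep 52 4 (rep 53 5 numberStep)))]

theorem eval_numberStep {n₁ n₂ n₃ n₄ i₁ i₂ i₃ i₄ : ℕ} (hi₁ : i₁ < n₁) (hi₂ : i₂ < n₂)
    (hi₃ : i₃ < n₃) (hi₄ : i₄ < n₄) {m : Mem} (h₁ : m.reg 50 = i₁) (h₂ : m.reg 51 = i₂)
    (h₃ : m.reg 52 = i₃) (h₄ : m.reg 53 = i₄) (h₆ : m.reg 6 = num4 n₂ n₃ n₄ i₁ i₂ i₃ i₄)
    (hm : Numbered m.arr n₁ n₂ n₃ n₄ (num4 n₂ n₃ n₄ i₁ i₂ i₃ i₄)) :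
    (numberStep.eval m).reg 6 = num4 n₂ n₃ n₄ i₁ i₂ i₃ i₄ + 1 ∧
      Numbered (numberStep.eval m).arr n₁ n₂ n₃ n₄ (num4 n₂ n₃ n₄ i₁ i₂ i₃ i₄ + 1) := by
  refine ⟨by simp [numberStep, h₆], fun j₁ hj₁ j₂ hj₂ j₃ hj₃ j₄ hj₄ hlt => ?_⟩
  simp only [numberStep, eval_block_cons, eval_block_nil, eval_store, eval_succ, Mem.setReg_arr,
    Mem.setArr_arr, Mem.setArr_reg, List.map_cons, List.map_nil, h₁, h₂, h₃, h₄, h₆]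
  rcases Nat.lt_succ_iff_lt_or_eq.1 hlt with hlt | heq
  · have hne : [j₁, j₂, j₃, j₄] ≠ [i₁, i₂, i₃, i₄] := by
      intro h
      simp only [List.cons.injEq, and_true] at h
      obtain ⟨rfl, rfl, rfl, rfl⟩ := h
      exact lt_irrefl _ hlt
    have := hm j₁ hj₁ j₂ hj₂ j₃ hj₃ j₄ hj₄ hlt
    simpa [hlt.ne, hne] using this
  · obtain ⟨rfl, rfl, rfl, rfl⟩ := num4_inj hj₂ hj₃ hj₄ hi₂ hi₃ hi₄ heq
    simp

/-- Lexicographic enumeration visits the mixed-radix numbers in increasing order, so a counter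
replaces the multiplications that the machine lacks. -/
theorem eval_numbering (m : Mem) :
    (numbering.eval m).reg 6 = m.reg 2 * m.reg 3 * m.reg 4 * m.reg 5 ∧
      Numbered (numbering.eval m).arr (m.reg 2) (m.reg 3) (m.reg 4) (m.reg 5)
        (m.reg 2 * m.reg 3 * m.reg 4 * m.reg 5) := by
  obtain ⟨n₁, h₁⟩ : ∃ n, n = m.reg 2 := ⟨_, rfl⟩
  obtain ⟨n₂, h₂⟩ : ∃ n, n = m.reg 3 := ⟨_, rfl⟩
  obtain ⟨n₃, h₃⟩ : ∃ n, n = m.reg 4 := ⟨_, rfl⟩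
  obtain ⟨n₄, h₄⟩ : ∃ n, n = m.reg 5 := ⟨_, rfl⟩
  simp only [← h₁, ← h₂, ← h₃, ← h₄]
  -- One invariant for all four loops; a full inner loop advances `v` by the corresponding product
  -- of lengths.
  let J : ℕ → Mem → Prop := fun v m' => m'.reg 6 = v ∧ Numbered m'.arr n₁ n₂ n₃ n₄ v
  have hJ : ∀ v m' x u, x ≠ 6 → J v m' → J v (m'.setReg x u) := fun v m' x u hx h =>
    ⟨by simpa [hx.symm] using h.1, h.2⟩
  have hw : ∀ x, x < 50 → x ≠ 6 → x ∉ numberStep.writes := by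
    intro x hx hx'
    simp [numberStep, writes, block, hx']
  have l4 : ∀ i₁ < n₁, ∀ i₂ < n₂, ∀ i₃ < n₃, ∀ m' : Mem, m'.reg 50 = i₁ → m'.reg 51 = i₂ →
      m'.reg 52 = i₃ → m'.reg 5 = n₄ → J (((i₁ * n₂ + i₂) * n₃ + i₃) * n₄) m' →
      J (((i₁ * n₂ + i₂) * n₃ + (i₃ + 1)) * n₄) ((rep 53 5 numberStep).eval m') := by
    intro i₁ hi₁ i₂ hi₂ i₃ hi₃ m' e₁ e₂ e₃ e₅ h
    have := rep_induct (i := 53) (n := 5) (P := numberStep) (m := m')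
      (fun k => J (((i₁ * n₂ + i₂) * n₃ + i₃) * n₄ + k)) h
      (fun k v m'' => hJ _ _ _ _ (by decide)) ?_
    · rw [e₅] at this
      rwa [← Nat.add_assoc, Nat.add_mul _ 1, Nat.one_mul]
    · intro k hk m'' hm'' hr _ hk'
      exact eval_numberStep hi₁ hi₂ hi₃ (e₅ ▸ hk) (by rw [hr _ (by decide) (by decide), e₁])
        (by rw [hr _ (by decide) (by decide), e₂]) (by rw [hr _ (by decide) (by decide), e₃]) hk'
        hm''.1 hm''.2
  have l3 : ∀ i₁ < n₁, ∀ i₂ < n₂, ∀ m' : Mem, m'.reg 50 = i₁ → m'.reg 51 = i₂ →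
      m'.reg 4 = n₃ → m'.reg 5 = n₄ → J ((i₁ * n₂ + i₂) * n₃ * n₄) m' →
      J ((i₁ * n₂ + (i₂ + 1)) * n₃ * n₄) ((rep 52 4 (rep 53 5 numberStep)).eval m') := by
    intro i₁ hi₁ i₂ hi₂ m' e₁ e₂ e₄ e₅ h
    have := rep_induct (i := 52) (n := 4) (P := rep 53 5 numberStep) (m := m')
      (fun k => J (((i₁ * n₂ + i₂) * n₃ + k) * n₄)) h
      (fun k v m'' => hJ _ _ _ _ (by decide)) ?_
    · rw [e₄] at this
      rwa [← Nat.add_assoc, Nat.add_mul _ 1, Nat.one_mul]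
    · intro k hk m'' hm'' hr _ hk'
      exact l4 i₁ hi₁ i₂ hi₂ k (e₄ ▸ hk) m'' (by rw [hr _ (by decide) (by decide), e₁])
        (by rw [hr _ (by decide) (by decide), e₂]) hk' (by rw [hr _ (by decide) (by decide), e₅])
        hm''
  have l2 : ∀ i₁ < n₁, ∀ m' : Mem, m'.reg 50 = i₁ → m'.reg 3 = n₂ →
      m'.reg 4 = n₃ → m'.reg 5 = n₄ → J (i₁ * n₂ * n₃ * n₄) m' →
      J ((i₁ + 1) * n₂ * n₃ * n₄) ((rep 51 3 (rep 52 4 (rep 53 5 numberStep))).eval m') := by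
    intro i₁ hi₁ m' e₁ e₃ e₄ e₅ h
    have := rep_induct (i := 51) (n := 3) (P := rep 52 4 (rep 53 5 numberStep)) (m := m')
      (fun k => J ((i₁ * n₂ + k) * n₃ * n₄)) h
      (fun k v m'' => hJ _ _ _ _ (by decide)) ?_
    · rw [e₃] at this
      rwa [Nat.add_mul _ 1, Nat.one_mul]
    · intro k hk m'' hm'' hr _ hk'
      exact l3 i₁ hi₁ k (e₃ ▸ hk) m'' (by rw [hr _ (by decide) (by decide), e₁]) hk'
        (by rw [hr _ (by decide) (by decide), e₄]) (by rw [hr _ (by decide) (by decide), e₅]) hm''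
  have := rep_induct (i := 50) (n := 2) (P := rep 51 3 (rep 52 4 (rep 53 5 numberStep)))
    (m := m.setReg 6 0) (fun k => J (k * n₂ * n₃ * n₄)) ?_
    (fun k v m'' => hJ _ _ _ _ (by decide)) ?_
  · simpa [J, numbering, ← h₁] using this
  · exact ⟨by simp, fun i₁ _ i₂ _ i₃ _ i₄ _ h => by simp at h⟩
  · intro k hk m'' hm'' hr _ hk'
    exact l2 k (by simpa [← h₁] using hk) m'' hk'
      (by rw [hr _ (by decide) (by decide), h₂]; rfl)
      (by rw [hr _ (by decide) (by decide), h₃]; rfl)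
      (by rw [hr _ (by decide) (by decide), h₄]; rfl) hm''

/-! ### Saturation rules and closure of a worklist. -/

/-- A machine whose states and symbols are the numbers below `N` and `l`. -/
structure NumSystem where
  N : ℕ
  l : ℕ
  kind : ℕ → ℕ
  init : ℕ
  simple : ℕ → ℕ → ℕ
  call : ℕ → ℕ → ℕ
  bot : ℕ → ℕ → ℕ
  ret : ℕ → ℕ → ℕ → ℕ → ℕ

namespace NumSystem

variable (X : NumSystem)

/-- Saturation rules. For `p < N`, `Der p q` says that a well-matched word leads from `p` to `q`;
`Der N q` says that `q` is reachable with the empty stack, and `Der (N + 1) q` that `q` is reachable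
with some stack. -/
inductive Der : ℕ → ℕ → Prop
  | refl {p} : p < X.N → Der p p
  | simple {p a} : p < X.N → a < X.l → X.kind a = 2 → Der p (X.simple p a)
  | ret {p a q b} : p < X.N → a < X.l → X.kind a = 0 → Der (X.call p a) q → b < X.l →
      X.kind b = 1 → Der p (X.ret q b p a)
  | trans {e q r} : Der e q → Der q r → Der e r
  | init : Der X.N X.init
  | bot {q b} : Der X.N q → b < X.l → X.kind b = 1 → Der X.N (X.bot q b)
  | any {q} : Der X.N q → Der (X.N + 1) q
  | call {q a} : Der (X.N + 1) q → a < X.l → X.kind a = 0 → Der (X.N + 1) (X.call q a)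

structure Bounded : Prop where
  init : X.init < X.N
  simple : ∀ {p a}, p < X.N → a < X.l → X.simple p a < X.N
  call : ∀ {p a}, p < X.N → a < X.l → X.call p a < X.N
  bot : ∀ {p a}, p < X.N → a < X.l → X.bot p a < X.N
  ret : ∀ {p a q b}, p < X.N → a < X.l → q < X.N → b < X.l → X.ret p a q b < X.N

variable {X}

/-- Targets are always states, so the second premise of `trans` never uses one of the two extra
rows. These bounds also limit the length of the worklist. -/
theorem Der.lt (hX : X.Bounded) {e q : ℕ} (h : X.Der e q) : e < X.N + 2 ∧ q < X.N := by
  induction h with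
  | refl h => omega
  | simple hp ha _ => exact ⟨by omega, hX.simple hp ha⟩
  | ret hp ha _ _ hb _ ih => exact ⟨by omega, hX.ret ih.2 hb hp ha⟩
  | trans _ _ h1 h2 => exact ⟨h1.1, h2.2⟩
  | init => exact ⟨by omega, hX.init⟩
  | bot _ hb _ ih => exact ⟨by omega, hX.bot ih.2 hb⟩
  | any _ ih => exact ⟨by omega, ih.2⟩
  | call _ ha _ ih => exact ⟨by omega, hX.call ih.2 ha⟩

variable (X)

/-- The list contains the conclusions of the rules with the single premise `Der x.1 x.2`. -/
structure Unary (W : List (ℕ × ℕ)) (x : ℕ × ℕ) : Prop where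
  ret : ∀ p < X.N, ∀ a < X.l, X.kind a = 0 → X.call p a = x.1 → ∀ b < X.l, X.kind b = 1 →
    (p, X.ret x.2 b p a) ∈ W
  bot : x.1 = X.N → ∀ b < X.l, X.kind b = 1 → (X.N, X.bot x.2 b) ∈ W
  any : x.1 = X.N → (X.N + 1, x.2) ∈ W
  call : x.1 = X.N + 1 → ∀ a < X.l, X.kind a = 0 → (X.N + 1, X.call x.2 a) ∈ W

structure Base (W : List (ℕ × ℕ)) : Prop where
  refl : ∀ p < X.N, (p, p) ∈ W
  simple : ∀ p < X.N, ∀ a < X.l, X.kind a = 2 → (p, X.simple p a) ∈ W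
  init : (X.N, X.init) ∈ W

/-- The list is closed under the rules whose premises are among its first `h` elements. -/
structure ClosedUpTo (h : ℕ) (W : List (ℕ × ℕ)) : Prop where
  unary : ∀ x ∈ W.take h, X.Unary W x
  trans : ∀ x ∈ W.take h, ∀ y ∈ W.take h, x.2 = y.1 → (x.1, y.2) ∈ W

variable {X}

theorem Unary.mono {W W' : List (ℕ × ℕ)} {x : ℕ × ℕ} (h : X.Unary W x) (hW : W ⊆ W') :
    X.Unary W' x :=
  ⟨fun p hp a ha h1 h2 b hb h3 => hW (h.ret p hp a ha h1 h2 b hb h3),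
    fun h1 b hb h2 => hW (h.bot h1 b hb h2), fun h1 => hW (h.any h1),
    fun h1 a ha h2 => hW (h.call h1 a ha h2)⟩

theorem Base.mono {W W' : List (ℕ × ℕ)} (h : X.Base W) (hW : W ⊆ W') : X.Base W' :=
  ⟨fun p hp => hW (h.refl p hp), fun p hp a ha h1 => hW (h.simple p hp a ha h1), hW h.init⟩

theorem Der.mem {W : List (ℕ × ℕ)} (hB : X.Base W) (hW : X.ClosedUpTo W.length W) {e q : ℕ}
    (h : X.Der e q) : (e, q) ∈ W := by
  obtain ⟨h1, h2⟩ := hW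
  rw [List.take_length] at h1 h2
  induction h with
  | refl h => exact hB.refl _ h
  | simple hp ha h => exact hB.simple _ hp _ ha h
  | ret hp ha h _ hb h' ih => exact (h1 _ ih).ret _ hp _ ha h rfl _ hb h'
  | trans _ _ ih ih' => exact h2 _ ih _ ih' rfl
  | init => exact hB.init
  | bot _ hb h ih => exact (h1 _ ih).bot rfl _ hb h
  | any _ ih => exact (h1 _ ih).any rfl
  | call _ ha h ih => exact (h1 _ ih).call rfl _ ha h

/-- The only new premises are `W[h]` alone and pairs that contain it. It suffices to combine `W[h]`
with the entries of the old list `W`, because later entries lie beyond position `h`. -/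
theorem ClosedUpTo.step {h : ℕ} {W W' : List (ℕ × ℕ)} (hW : X.ClosedUpTo h W)
    (hWW : W <+: W') (hh : h < W.length) (hu : X.Unary W' W[h])
    (hr : ∀ r, (W[h].2, r) ∈ W → (W[h].1, r) ∈ W')
    (hl : ∀ e, (e, W[h].1) ∈ W → (e, W[h].2) ∈ W') : X.ClosedUpTo (h + 1) W' := by
  have hsub := hWW.subset
  have htake : W'.take (h + 1) = W.take h ++ [W[h]] := by
    rw [List.take_append_getElem hh]
    obtain ⟨t, rfl⟩ := hWW
    rw [List.take_append_of_le_length (by omega)]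
  constructor
  · intro x hx
    rw [htake, List.mem_append, List.mem_singleton] at hx
    rcases hx with hx | rfl
    · exact (hW.unary x hx).mono hsub
    · exact hu
  · intro x hx y hy hxy
    rw [htake, List.mem_append, List.mem_singleton] at hx hy
    rcases hx with hx | rfl
    · rcases hy with hy | rfl
      · exact hsub (hW.trans x hx y hy hxy)
      · exact hl _ (by rw [← hxy]; exact List.mem_of_mem_take hx)
    · rcases hy with hy | rfl
      · exact hr _ (by rw [hxy]; exact List.mem_of_mem_take hy)
      -- `W[h]` composed with itself: its components are equal, so it is its own partner in `W`.
      · refine hr _ ?_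
        have h1 : (W[h].1, W[h].2) ∈ W := List.getElem_mem hh
        have h2 := congrArg (fun x => (x, W[h].2)) hxy
        rwa [h2]

end NumSystem

/-- The machine described by the tables in memory. -/
def numSystem (f : ℕ → List ℕ → ℕ) (N l : ℕ) : NumSystem where
  N := N
  l := l
  kind a := f 1 [a]
  init := tuple f fun b => first f (b + 1) []
  simple p a := tuple f (simpleVal f p a)
  call p a := tuple f (callVal f p a)
  bot p a := tuple f (botVal f p a)
  ret p a q b := tuple f (retVal f p a q b)

/-- The arrays `210` and `211` are the workspace of the saturation, so the machine does not change
while the list grows. -/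
theorem numSystem_congr {f g : ℕ → List ℕ → ℕ} (h : ∀ a < 210, f a = g a) (N l : ℕ) :
    numSystem f N l = numSystem g N l := by
  simp (disch := omega) only [numSystem, tuple, first, simpleVal, callVal, botVal, retVal, h]

/-! ### The worklist program. -/

/-- The array `210` marks the elements of the list `W`, which is in the array `211`, and whose
length is in register `9`; all elements are derivable in the machine in the other arrays. -/
structure Holds (f : ℕ → List ℕ → ℕ) (N l : ℕ) (W : List (ℕ × ℕ)) (m : Mem) : Prop where
  arr : ∀ a < 210, m.arr a = f a
  symbols : m.reg 1 = l
  states : m.reg 6 = N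
  rows : m.reg 7 = N + 2
  top : m.reg 11 = N + 1
  tail : m.reg 9 = W.length
  mark : ∀ e q, m.arr 210 [e, q] = if (e, q) ∈ W then 1 else 0
  work : ∀ k, (hk : k < W.length) → m.arr 211 [k, 0] = W[k].1 ∧ m.arr 211 [k, 1] = W[k].2
  nodup : W.Nodup
  sound : ∀ x ∈ W, (numSystem f N l).Der x.1 x.2

section

variable {f : ℕ → List ℕ → ℕ} {N l : ℕ} {W : List (ℕ × ℕ)} {m : Mem}

theorem Holds.congr (h : Holds f N l W m) {m' : Mem} (ha : m'.arr = m.arr)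
    (hr : ∀ x ∈ [1, 6, 7, 9, 11], m'.reg x = m.reg x) : Holds f N l W m' := by
  obtain ⟨h1, h2, h3, h4, h5, h6, h7, h8, h9, h10⟩ := h
  simp only [List.mem_cons, List.not_mem_nil, or_false, forall_eq_or_imp, forall_eq] at hr
  constructor <;> simpa only [ha, hr]

theorem Holds.eval (h : Holds f N l W m) (P : Cmd) (hs : P.stores = [] := by rfl)
    (hw : ∀ x ∈ [1, 6, 7, 9, 11], x ∉ P.writes := by decide) : Holds f N l W (P.eval m) :=
  h.congr (funext fun a => Cmd.eval_arr _ (by simp [hs])) fun x hx => Cmd.eval_reg _ (hw x hx)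

theorem Holds.system_eq (h : Holds f N l W m) : numSystem m.arr N l = numSystem f N l :=
  numSystem_congr h.arr N l

end

/-- Adds the pair in the registers `40`, `41` to the list. -/
def Cmd.add : Cmd :=
  block [load 42 210 [40, 41], const 43 0, cond (.eq 42 43)
    (block [const 44 1, store 210 [40, 41] 44, store 211 [9, 43] 40, store 211 [9, 44] 41,
      succ 9 9]) skip]

section

variable {f : ℕ → List ℕ → ℕ} {N l : ℕ} {W : List (ℕ × ℕ)} {m : Mem}

/-- The list has grown, and satisfies `C`. -/
def Grown (f : ℕ → List ℕ → ℕ) (N l : ℕ) (W : List (ℕ × ℕ)) (C : List (ℕ × ℕ) → Prop)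
    (m : Mem) : Prop :=
  ∃ W', Holds f N l W' m ∧ W <+: W' ∧ C W'

theorem Holds.grown (h : Holds f N l W m) {C : List (ℕ × ℕ) → Prop} (hC : C W) :
    Grown f N l W C m :=
  ⟨W, h, List.prefix_rfl, hC⟩

/-- The mark makes the membership test a single access and keeps the list free of repetitions, on
which the time bound rests. -/
theorem eval_add (h : Holds f N l W m) (hd : (numSystem f N l).Der (m.reg 40) (m.reg 41)) :
    Grown f N l W ((m.reg 40, m.reg 41) ∈ ·) (add.eval m) := by
  by_cases hmem : (m.reg 40, m.reg 41) ∈ W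
  · have h1 : m.arr 210 [m.reg 40, m.reg 41] = 1 := by rw [h.mark, if_pos hmem]
    refine ⟨W, h.congr ?_ ?_, List.prefix_rfl, hmem⟩
    · simp [add, h1]
    · simp [add, h1]
  · have h1 : m.arr 210 [m.reg 40, m.reg 41] = 0 := by rw [h.mark, if_neg hmem]
    refine ⟨W ++ [(m.reg 40, m.reg 41)], ?_, List.prefix_append _ _, by simp⟩
    constructor
    · intro a ha
      funext i
      simp [add, h1, show a ≠ 210 by omega, show a ≠ 211 by omega, h.arr a ha]
    · simp [add, h1, h.symbols]
    · simp [add, h1, h.states]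
    · simp [add, h1, h.rows]
    · simp [add, h1, h.top]
    · simp [add, h1, h.tail]
    · intro e q
      simp only [add, eval_block_cons, eval_block_nil, eval_load, eval_const, eval_cond_eq, h1,
        eval_store, eval_succ, Mem.setReg_reg, Mem.setArr_reg, List.map_cons, List.map_nil, List.mem_append, List.mem_singleton, Prod.mk.injEq]
      by_cases he : e = m.reg 40 ∧ q = m.reg 41
      · simp [he]
      · have : [e, q] ≠ [m.reg 40, m.reg 41] := by simpa using he
        simpa [he, this] using h.mark e q
    · intro k hk
      rw [List.length_append, List.length_singleton] at hk
      rcases Nat.lt_succ_iff_lt_or_eq.1 hk with hk | rfl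
      · simpa [add, h1, h.tail, hk.ne, List.getElem_append_left hk] using h.work k hk
      · simp [add, h1, h.tail]
    · exact h.nodup.append (List.nodup_singleton _) (by simpa using hmem)
    · intro x hx
      rw [List.mem_append, List.mem_singleton] at hx
      rcases hx with hx | rfl
      exacts [h.sound x hx, hd]

theorem eval_seq_add (h : Holds f N l W m) (P : Cmd) {e q : ℕ} (he : (P.eval m).reg 40 = e)
    (hq : (P.eval m).reg 41 = q) (hd : (numSystem f N l).Der e q) (hs : P.stores = [] := by rfl)
    (hw : ∀ x ∈ [1, 6, 7, 9, 11], x ∉ P.writes := by decide) :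
    Grown f N l W ((e, q) ∈ ·) ((seq P add).eval m) := by
  subst he hq
  exact eval_add (h.eval P hs hw) hd

theorem Grown.trans {C C' : List (ℕ × ℕ) → Prop} {m' : Mem} (h : Grown f N l W C m)
    (hmono : ∀ {W' W''}, C W' → W' <+: W'' → C W'')
    (h' : ∀ W', Holds f N l W' m → W <+: W' → Grown f N l W' C' m') :
    Grown f N l W (fun W' => C W' ∧ C' W') m' := by
  obtain ⟨W', h1, h2, h3⟩ := h
  obtain ⟨W'', h4, h5, h6⟩ := h' W' h1 h2
  exact ⟨W'', h4, h2.trans h5, hmono h3 h5, h6⟩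

/-- A counting loop whose body makes the list grow. -/
theorem grown_rep {i n : ℕ} {P : Cmd} (h : Holds f N l W m) (C : ℕ → List (ℕ × ℕ) → Prop)
    (hmono : ∀ k {W' W''}, C k W' → W' <+: W'' → C k W'')
    (hi : i ∉ [1, 6, 7, 9, 11])
    (hP : ∀ k < m.reg n, ∀ m' W', Holds f N l W' m' → W <+: W' →
      (∀ x, x ≠ i → x ∉ P.writes → m'.reg x = m.reg x) → m'.reg i = k →
      Grown f N l W' (C k) (P.eval m')) :
    Grown f N l W (fun W' => ∀ k < m.reg n, C k W') ((rep i n P).eval m) := by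
  refine rep_induct (i := i) (n := n) (P := P) (m := m)
    (fun k => Grown f N l W fun W' => ∀ j < k, C j W') (h.grown (by simp)) ?_ ?_
  · rintro k v m' ⟨W', h1, h2, h3⟩
    refine ⟨W', h1.congr (by simp) fun x hx => ?_, h2, h3⟩
    simp [show x ≠ i by rintro rfl; exact hi hx]
  · rintro k hk m' ⟨W', h1, h2, h3⟩ hr - hk'
    obtain ⟨W'', h4, h5, h6⟩ := hP k hk m' W' h1 h2 hr hk'
    refine ⟨W'', h4, h2.trans h5, fun j hj => ?_⟩
    rcases Nat.lt_succ_iff_lt_or_eq.1 hj with hj | rfl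
    exacts [hmono j (h3 j hj) h5, h6]

end

namespace Cmd

/-- The pair being processed is in the registers `20`, `21`. -/
def transRight : Cmd :=
  block [load 24 210 [21, 22], const 43 0,
    cond (.eq 24 43) skip (seq (block [copy 40 20, copy 41 22]) add)]

def transLeft : Cmd :=
  block [load 24 210 [22, 20], const 43 0,
    cond (.eq 24 43) skip (seq (block [copy 40 22, copy 41 21]) add)]

def retStep : Cmd :=
  block [load 24 1 [25], const 43 1, cond (.eq 24 43)
    (seq (block [copy 80 21, copy 81 25, copy 82 22, copy 83 23, lift retC, copy 40 22,
      copy 41 89]) add) skip]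

def retLoop : Cmd :=
  block [load 24 1 [23], const 43 0, cond (.eq 24 43)
    (block [copy 80 22, copy 81 23, lift callC, cond (.eq 89 20) (rep 25 1 retStep) skip]) skip]

def botStep : Cmd :=
  block [load 24 1 [25], const 43 1, cond (.eq 24 43)
    (seq (block [copy 80 21, copy 81 25, lift botC, copy 40 20, copy 41 89]) add) skip]

def callStep : Cmd :=
  block [load 24 1 [25], const 43 0, cond (.eq 24 43)
    (seq (block [copy 80 21, copy 81 25, lift callC, copy 40 20, copy 41 89]) add) skip]

def bottomRow : Cmd :=
  cond (.eq 20 6) (block [rep 25 1 botStep, seq (block [copy 40 11, copy 41 21]) add]) skip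

def topRow : Cmd := cond (.eq 20 11) (rep 25 1 callStep) skip

def process : Cmd :=
  block [const 43 0, const 44 1, load 20 211 [8, 43], load 21 211 [8, 44], succ 8 8,
    rep 22 6 transRight, rep 22 7 transLeft, rep 22 6 (rep 23 1 retLoop), bottomRow, topRow]

def simpleStep : Cmd :=
  block [load 24 1 [21], const 43 2, cond (.eq 24 43)
    (seq (block [copy 80 20, copy 81 21, lift simpleC, copy 40 20, copy 41 89]) add) skip]

def loadRules : Cmd :=
  block [rep 20 6 (block [seq (block [copy 40 20, copy 41 20]) add, rep 21 1 simpleStep]),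
    seq (block [lift fun b => look 88 (b + 1) [], copy 40 6, copy 41 89]) add]

def saturate : Cmd := rep 30 7 (rep 31 7 (cond (.lt 8 9) process skip))

end Cmd

section

variable {f : ℕ → List ℕ → ℕ} {N l : ℕ} {W : List (ℕ × ℕ)} {m : Mem}

theorem eval_transRight (h : Holds f N l W m)
    (hd : (numSystem f N l).Der (m.reg 20) (m.reg 21)) :
    Grown f N l W (fun W' => (m.reg 21, m.reg 22) ∈ W → (m.reg 20, m.reg 22) ∈ W')
      (transRight.eval m) := by
  simp only [transRight, eval_block_cons, eval_block_nil, eval_cond_eq]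
  split_ifs with h1
  · refine ((h.eval (block [load 24 210 [21, 22], const 43 0])).grown ?_)
    intro h2
    simp [h.mark, h2] at h1
  · have h2 : (m.reg 21, m.reg 22) ∈ W := by
      by_contra h2
      simp [h.mark, h2] at h1
    obtain ⟨W', h3, h4, h5⟩ := eval_seq_add (h.eval (block [load 24 210 [21, 22], const 43 0]))
      (block [copy 40 20, copy 41 22]) (e := m.reg 20) (q := m.reg 22) (by simp) (by simp)
      (hd.trans (h.sound _ h2))
    exact ⟨W', h3, h4, fun _ => h5⟩

theorem eval_transLeft (h : Holds f N l W m)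
    (hd : (numSystem f N l).Der (m.reg 20) (m.reg 21)) :
    Grown f N l W (fun W' => (m.reg 22, m.reg 20) ∈ W → (m.reg 22, m.reg 21) ∈ W')
      (transLeft.eval m) := by
  simp only [transLeft, eval_block_cons, eval_block_nil, eval_cond_eq]
  split_ifs with h1
  · refine ((h.eval (block [load 24 210 [22, 20], const 43 0])).grown ?_)
    intro h2
    simp [h.mark, h2] at h1
  · have h2 : (m.reg 22, m.reg 20) ∈ W := by
      by_contra h2
      simp [h.mark, h2] at h1
    obtain ⟨W', h3, h4, h5⟩ := eval_seq_add (h.eval (block [load 24 210 [22, 20], const 43 0]))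
      (block [copy 40 22, copy 41 21]) (e := m.reg 22) (q := m.reg 21) (by simp) (by simp)
      (.trans (h.sound _ h2) hd)
    exact ⟨W', h3, h4, fun _ => h5⟩

/-- A step for a symbol of a given class. -/
theorem eval_guarded {x k : ℕ} {P : Cmd} {e q : ℕ} (h : Holds f N l W m)
    (he : f 1 [m.reg x] = k → (P.eval ((m.setReg 24 k).setReg 43 k)).reg 40 = e)
    (hq : f 1 [m.reg x] = k → (P.eval ((m.setReg 24 k).setReg 43 k)).reg 41 = q)
    (hd : f 1 [m.reg x] = k → (numSystem f N l).Der e q) (hs : P.stores = [] := by rfl)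
    (hw : ∀ x ∈ [1, 6, 7, 9, 11], x ∉ P.writes := by decide) :
    Grown f N l W (fun W' => f 1 [m.reg x] = k → (e, q) ∈ W')
      ((block [load 24 1 [x], const 43 k, cond (.eq 24 43) (seq P add) skip]).eval m) := by
  by_cases h1 : f 1 [m.reg x] = k
  · have h2 : (block [load 24 1 [x], const 43 k, cond (.eq 24 43) (seq P add) skip]).eval m =
        (seq P add).eval ((m.setReg 24 k).setReg 43 k) := by
      simp [h.arr, h1]
    rw [h2]
    obtain ⟨W', h3, h4, h5⟩ := eval_seq_add (m := (m.setReg 24 k).setReg 43 k)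
      (h.congr rfl (by simp)) P (he h1) (hq h1) (hd h1) hs hw
    exact ⟨W', h3, h4, fun _ => h5⟩
  · have h2 : (block [load 24 1 [x], const 43 k, cond (.eq 24 43) (seq P add) skip]).eval m =
        (m.setReg 24 (f 1 [m.reg x])).setReg 43 k := by
      simp [h.arr, h1]
    rw [h2]
    refine Holds.grown (m := (m.setReg 24 _).setReg 43 k) (h.congr rfl (by simp)) ?_
    exact fun h3 => absurd h3 h1

theorem eval_retStep (h : Holds f N l W m) (hp : m.reg 22 < N) (ha : m.reg 23 < l)
    (hk : f 1 [m.reg 23] = 0) (hb : m.reg 25 < l)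
    (hd : (numSystem f N l).Der ((numSystem f N l).call (m.reg 22) (m.reg 23)) (m.reg 21)) :
    Grown f N l W (fun W' => f 1 [m.reg 25] = 1 →
      (m.reg 22, (numSystem f N l).ret (m.reg 21) (m.reg 25) (m.reg 22) (m.reg 23)) ∈ W')
      (retStep.eval m) := by
  refine eval_guarded h (fun _ => ?_) (fun _ => ?_) fun hk' =>
    .ret hp ha hk hd hb hk'
  · simp [eval_reg (lift retC) (x := 22) (by decide)]
  · rw [← h.system_eq]
    simp [eval_ret, numSystem]

theorem eval_botStep (h : Holds f N l W m) (hb : m.reg 25 < l)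
    (hd : (numSystem f N l).Der N (m.reg 21)) (hN : m.reg 20 = N) :
    Grown f N l W (fun W' => f 1 [m.reg 25] = 1 →
      (N, (numSystem f N l).bot (m.reg 21) (m.reg 25)) ∈ W') (botStep.eval m) := by
  refine eval_guarded h (fun _ => ?_) (fun _ => ?_) fun hk' => .bot hd hb hk'
  · simp [eval_reg (lift botC) (x := 20) (by decide), hN]
  · rw [← h.system_eq]
    simp [eval_bot, numSystem]

theorem eval_callStep (h : Holds f N l W m) (hb : m.reg 25 < l)
    (hd : (numSystem f N l).Der (N + 1) (m.reg 21)) (hN : m.reg 20 = N + 1) :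
    Grown f N l W (fun W' => f 1 [m.reg 25] = 0 →
      (N + 1, (numSystem f N l).call (m.reg 21) (m.reg 25)) ∈ W') (callStep.eval m) := by
  refine eval_guarded h (fun _ => ?_) (fun _ => ?_) fun hk' => .call hd hb hk'
  · simp [eval_reg (lift callC) (x := 20) (by decide), hN]
  · rw [← h.system_eq]
    simp [eval_call, numSystem]

theorem eval_simpleStep (h : Holds f N l W m) (hp : m.reg 20 < N) (ha : m.reg 21 < l) :
    Grown f N l W (fun W' => f 1 [m.reg 21] = 2 →
      (m.reg 20, (numSystem f N l).simple (m.reg 20) (m.reg 21)) ∈ W') (simpleStep.eval m) := by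
  refine eval_guarded h (fun _ => ?_) (fun _ => ?_) fun hk' => .simple hp ha hk'
  · simp [eval_reg (lift simpleC) (x := 20) (by decide)]
  · rw [← h.system_eq]
    simp [eval_simple, numSystem]

/-- The rule `ret` used backwards: the current pair starts after a call, and the calls that lead to
its source are found by trying every state and symbol. -/
theorem eval_retLoop (h : Holds f N l W m) (hp : m.reg 22 < N) (ha : m.reg 23 < l)
    (hd : (numSystem f N l).Der (m.reg 20) (m.reg 21)) :
    Grown f N l W (fun W' => f 1 [m.reg 23] = 0 →
      (numSystem f N l).call (m.reg 22) (m.reg 23) = m.reg 20 →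
      ∀ b < l, f 1 [b] = 1 →
        (m.reg 22, (numSystem f N l).ret (m.reg 21) b (m.reg 22) (m.reg 23)) ∈ W')
      (retLoop.eval m) := by
  let P := block [load 24 1 [23], const 43 0]
  let Q := block [copy 80 22, copy 81 23, lift callC]
  have hP : Holds f N l W (P.eval m) := h.eval P
  have hQ : Holds f N l W (Q.eval (P.eval m)) := hP.eval Q
  have h1 : (P.eval m).reg 24 = f 1 [m.reg 23] := by simp [P, h.arr]
  have h2 : (P.eval m).reg 43 = 0 := by simp [P]
  have h3 : (Q.eval (P.eval m)).reg 89 = (numSystem f N l).call (m.reg 22) (m.reg 23) := by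
    rw [← h.system_eq]
    simp [P, Q, eval_call, numSystem]
  have hr : ∀ x ∈ [20, 21, 22, 23], (Q.eval (P.eval m)).reg x = m.reg x := by
    intro x hx
    have : x ∉ P.writes ∧ x ∉ Q.writes := by revert x; decide
    rw [eval_reg _ this.2, eval_reg _ this.1]
  have he : retLoop.eval m = if f 1 [m.reg 23] = 0 then
      if (numSystem f N l).call (m.reg 22) (m.reg 23) = m.reg 20 then
        (rep 25 1 retStep).eval (Q.eval (P.eval m)) else Q.eval (P.eval m) else P.eval m := by
    rw [← h1, ← h3, ← hr 20 (by decide), ← h2]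
    rfl
  rw [he]
  split_ifs with c1 c2
  · obtain ⟨W', h4, h5, h6⟩ := grown_rep (i := 25) (n := 1) (P := retStep) hQ
      (fun b W' => f 1 [b] = 1 →
        (m.reg 22, (numSystem f N l).ret (m.reg 21) b (m.reg 22) (m.reg 23)) ∈ W')
      (fun b _ _ h h' hb => h'.subset (h hb)) (by decide) (by
        intro k hk m' W' hm' _ hr' hk'
        have hr'' : ∀ x ∈ [21, 22, 23], m'.reg x = m.reg x := fun x hx => by
          have : x ≠ 25 ∧ x ∉ retStep.writes := by revert x; decide
          rw [hr' x this.1 this.2, hr x (List.mem_cons_of_mem _ hx)]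
        have := eval_retStep hm'
        rw [hr'' 21 (by decide), hr'' 22 (by decide), hr'' 23 (by decide), hk'] at this
        exact this hp ha c1 (hQ.symbols ▸ hk) (c2 ▸ hd))
    exact ⟨W', h4, h5, fun _ _ b hb => h6 b (hQ.symbols.symm ▸ hb)⟩
  · exact hQ.grown fun _ h => absurd h c2
  · exact hP.grown fun h => absurd h c1

theorem eval_bottomRow (h : Holds f N l W m)
    (hd : (numSystem f N l).Der (m.reg 20) (m.reg 21)) :
    Grown f N l W (fun W' => m.reg 20 = N →
      (∀ b < l, f 1 [b] = 1 → (N, (numSystem f N l).bot (m.reg 21) b) ∈ W') ∧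
      (N + 1, m.reg 21) ∈ W') (bottomRow.eval m) := by
  simp only [bottomRow, eval_cond_eq, h.states]
  split_ifs with hN
  · rw [hN] at hd
    have hr : ∀ x ∈ [21, 11], ((rep 25 1 botStep).eval m).reg x = m.reg x := by
      intro x hx
      have : x ∉ (rep 25 1 botStep).writes := by revert x; decide
      exact eval_reg _ this
    have h1 := grown_rep (i := 25) (n := 1) (P := botStep) h
      (fun b W' => f 1 [b] = 1 → (N, (numSystem f N l).bot (m.reg 21) b) ∈ W')
      (fun b _ _ h h' hb => h'.subset (h hb)) (by decide) (by
        intro k hk m' W' hm' _ hr' hk'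
        have := eval_botStep hm'
        rw [hr' 21 (by decide) (by decide), hr' 20 (by decide) (by decide), hk'] at this
        exact this (h.symbols ▸ hk) hd hN)
    obtain ⟨W', h2, h3, h4, h5⟩ := h1.trans (fun h h' k hk hk' => h'.subset (h k hk hk'))
      fun W' h' _ => eval_seq_add h' (block [copy 40 11, copy 41 21])
        (e := N + 1) (q := m.reg 21) (by simp [hr, h.top]) (by simp [hr]) hd.any
    exact ⟨W', h2, h3, fun _ => ⟨fun b hb => h4 b (h.symbols.symm ▸ hb), h5⟩⟩
  · exact h.grown fun h => absurd h hN

theorem eval_topRow (h : Holds f N l W m)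
    (hd : (numSystem f N l).Der (m.reg 20) (m.reg 21)) :
    Grown f N l W (fun W' => m.reg 20 = N + 1 →
      ∀ b < l, f 1 [b] = 0 → (N + 1, (numSystem f N l).call (m.reg 21) b) ∈ W')
      (topRow.eval m) := by
  simp only [topRow, eval_cond_eq, h.top]
  split_ifs with hN
  · rw [hN] at hd
    obtain ⟨W', h2, h3, h4⟩ := grown_rep (i := 25) (n := 1) (P := callStep) h
      (fun b W' => f 1 [b] = 0 → (N + 1, (numSystem f N l).call (m.reg 21) b) ∈ W')
      (fun b _ _ h h' hb => h'.subset (h hb)) (by decide) (by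
        intro k hk m' W' hm' _ hr' hk'
        have := eval_callStep hm'
        rw [hr' 21 (by decide) (by decide), hr' 20 (by decide) (by decide), hk'] at this
        exact this (h.symbols ▸ hk) hd hN)
    exact ⟨W', h2, h3, fun _ b hb => h4 b (h.symbols.symm ▸ hb)⟩
  · exact h.grown fun h => absurd h hN

/-- Each loop contributes the conclusions of one rule with the current pair as a premise. Growth by
prefixes preserves them, and `ClosedUpTo.step` collects them. -/
theorem eval_process (hX : (numSystem f N l).Bounded) (h : Holds f N l W m)
    (hh : m.reg 8 < W.length) (hc : (numSystem f N l).ClosedUpTo (m.reg 8) W) :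
    Grown f N l W ((numSystem f N l).ClosedUpTo (m.reg 8 + 1)) (process.eval m) ∧
      (process.eval m).reg 8 = m.reg 8 + 1 := by
  let P := block [const 43 0, const 44 1, load 20 211 [8, 43], load 21 211 [8, 44], succ 8 8]
  have hP : Holds f N l W (P.eval m) := h.eval P
  set x := W[m.reg 8] with hx
  have h20 : (P.eval m).reg 20 = x.1 := by simp [P, h.work _ hh, hx]
  have h21 : (P.eval m).reg 21 = x.2 := by simp [P, h.work _ hh, hx]
  have hd : (numSystem f N l).Der x.1 x.2 := h.sound _ (List.getElem_mem hh)
  constructor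
  swap
  · have : 8 ∉ (block [rep 22 6 transRight, rep 22 7 transLeft, rep 22 6 (rep 23 1 retLoop),
      bottomRow, topRow]).writes := by decide
    exact (eval_reg _ (m := P.eval m) this).trans (by simp [P])
  have g1 := grown_rep (i := 22) (n := 6) (P := transRight) hP
    (fun r W' => (x.2, r) ∈ W → (x.1, r) ∈ W')
    (fun b _ _ h h' hb => h'.subset (h hb)) (by decide) (by
      intro k hk m' W' hm' hW hr' hk'
      have := eval_transRight hm'
      rw [hr' 21 (by decide) (by decide), hr' 20 (by decide) (by decide), hk', h20, h21] at this
      obtain ⟨W'', h1, h2, h3⟩ := this hd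
      exact ⟨W'', h1, h2, fun h => h3 (hW.subset h)⟩)
  rw [hP.states] at g1
  set m1 := (rep 22 6 transRight).eval (P.eval m) with hm1
  have r1 : ∀ x ∈ [20, 21], m1.reg x = (P.eval m).reg x := fun x hx =>
    eval_reg _ (by revert x; decide)
  have g2 := g1.trans (fun h h' k hk hk' => h'.subset (h k hk hk')) fun W1 h1 hW1 => by
    have := grown_rep (i := 22) (n := 7) (P := transLeft) h1
      (fun r W' => (r, x.1) ∈ W1 → (r, x.2) ∈ W')
      (fun b _ _ h h' hb => h'.subset (h hb)) (by decide) (by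
        intro k hk m' W' hm' hW hr' hk'
        have := eval_transLeft hm'
        rw [hr' 21 (by decide) (by decide), hr' 20 (by decide) (by decide), hk',
          r1 20 (by decide), r1 21 (by decide), h20, h21] at this
        obtain ⟨W'', h1, h2, h3⟩ := this hd
        exact ⟨W'', h1, h2, fun h => h3 (hW.subset h)⟩)
    rw [h1.rows] at this
    obtain ⟨W'', h2, h3, h4⟩ := this
    exact (⟨W'', h2, h3, fun k hk hk' => h4 k hk (hW1.subset hk')⟩ :
      Grown f N l W1 (fun W' => ∀ k < N + 2, (k, x.1) ∈ W → (k, x.2) ∈ W') _)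
  set m2 := (rep 22 7 transLeft).eval m1 with hm2
  have r2 : ∀ x ∈ [20, 21], m2.reg x = (P.eval m).reg x := fun x hx =>
    (eval_reg _ (by revert x; decide)).trans (r1 x hx)
  have g3 := g2.trans (fun h h' => ⟨fun k hk hk' => h'.subset (h.1 k hk hk'),
      fun k hk hk' => h'.subset (h.2 k hk hk')⟩) fun W2 h2 hW2 => by
    have := grown_rep (i := 22) (n := 6) (P := rep 23 1 retLoop) h2
      (fun p W' => ∀ a < l, f 1 [a] = 0 → (numSystem f N l).call p a = x.1 →
        ∀ b < l, f 1 [b] = 1 → (p, (numSystem f N l).ret x.2 b p a) ∈ W')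
      (fun p _ _ h h' a h1 h2 h3 b h4 h5 => h'.subset (h a h1 h2 h3 b h4 h5)) (by decide) (by
        intro p hp m' W' hm' hW hr' hk'
        have := grown_rep (i := 23) (n := 1) (P := retLoop) hm'
          (fun a W' => f 1 [a] = 0 → (numSystem f N l).call p a = x.1 →
            ∀ b < l, f 1 [b] = 1 → (p, (numSystem f N l).ret x.2 b p a) ∈ W')
          (fun a _ _ h h' h2 h3 b h4 h5 => h'.subset (h h2 h3 b h4 h5)) (by decide) (by
            intro a ha m'' W'' hm'' hW' hr'' hk''
            have := eval_retLoop hm''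
            rw [hr'' 20 (by decide) (by decide), hr'' 21 (by decide) (by decide),
              hr'' 22 (by decide) (by decide), hk', hk'', hr' 21 (by decide) (by decide),
              hr' 20 (by decide) (by decide), r2 20 (by decide), r2 21 (by decide), h20, h21]
              at this
            exact this (h2.states ▸ hp) (hm'.symbols ▸ ha) hd)
        rwa [hm'.symbols] at this)
    rwa [h2.states] at this
  set m3 := (rep 22 6 (rep 23 1 retLoop)).eval m2 with hm3
  have r3 : ∀ x ∈ [20, 21], m3.reg x = (P.eval m).reg x := fun x hx =>
    (eval_reg _ (by revert x; decide)).trans (r2 x hx)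
  obtain ⟨W3, h3, hW3, ⟨c1, c2⟩, c3⟩ := g3
  have g4 := eval_bottomRow h3
  rw [r3 20 (by decide), r3 21 (by decide), h20, h21] at g4
  obtain ⟨W4, h4, hW4, c4⟩ := g4 hd
  have r4 : ∀ x ∈ [20, 21], (bottomRow.eval m3).reg x = (P.eval m).reg x := fun x hx =>
    (eval_reg _ (by revert x; decide)).trans (r3 x hx)
  have g5 := eval_topRow h4
  rw [r4 20 (by decide), r4 21 (by decide), h20, h21] at g5
  obtain ⟨W5, h5, hW5, c5⟩ := g5 hd
  have h35 : W3 ⊆ W5 := (hW4.trans hW5).subset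
  refine ⟨W5, h5, hW3.trans (hW4.trans hW5), hc.step (hW3.trans (hW4.trans hW5)) hh
    ⟨fun p hp a ha e1 e2 b hb e3 => h35 (c3 p hp a ha e1 e2 b hb e3),
      fun e1 b hb e2 => hW5.subset ((c4 e1).1 b hb e2), fun e1 => hW5.subset (c4 e1).2, c5⟩
    -- The loops over `r < N` and `e < N + 2` miss no entry, because all entries are derivable and
    -- hence within these bounds.
    (fun r hr => h35 (c1 r (((h.sound _ hr).lt hX).2) hr))
    fun e he => h35 (c2 e (((h.sound _ he).lt hX).1) he)⟩

end

section

variable {f : ℕ → List ℕ → ℕ} {N l : ℕ} {W : List (ℕ × ℕ)} {m : Mem}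

theorem eval_loadRules (h : Holds f N l W m) :
    Grown f N l W (numSystem f N l).Base (loadRules.eval m) := by
  have g1 := grown_rep (i := 20) (n := 6)
    (P := block [seq (block [copy 40 20, copy 41 20]) add, rep 21 1 simpleStep]) h
    (fun p W' => (p, p) ∈ W' ∧ ∀ a < l, f 1 [a] = 2 → (p, (numSystem f N l).simple p a) ∈ W')
    (fun p _ _ h h' => ⟨h'.subset h.1, fun a h1 h2 => h'.subset (h.2 a h1 h2)⟩) (by decide) (by
      intro p hp m' W' hm' _ _ hp'
      rw [h.states] at hp
      have g2 := (eval_seq_add hm' (block [copy 40 20, copy 41 20]) (e := p) (q := p)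
        (by simp [hp']) (by simp [hp']) (.refl hp)).trans (fun h h' => h'.subset h)
        fun W1 h1 _ => by
        have := grown_rep (i := 21) (n := 1) (P := simpleStep) h1
          (fun a W' => f 1 [a] = 2 → (p, (numSystem f N l).simple p a) ∈ W')
          (fun a _ _ h h' h2 => h'.subset (h h2)) (by decide) (by
            intro a ha m2 W2 hm2 _ hr ha'
            have hr20 : m2.reg 20 = p := by
              rw [hr 20 (by decide) (by decide), eval_reg _ (by decide), hp']
            have := eval_simpleStep hm2
            rw [hr20, ha'] at this
            exact this hp (h1.symbols ▸ ha))
        rwa [h1.symbols] at this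
      exact g2)
  rw [h.states] at g1
  obtain ⟨W2, h2, h3, h4, h5⟩ := g1.trans (fun h h' k hk => ⟨h'.subset (h k hk).1, fun a h1 h2 =>
    h'.subset ((h k hk).2 a h1 h2)⟩) fun W1 h1 _ =>
      eval_seq_add h1 (block [lift fun b => look 88 (b + 1) [], copy 40 6, copy 41 89])
        (e := N) (q := (numSystem f N l).init)
        (by simp [eval_reg (lift fun b => look 88 (b + 1) []) (x := 6) (by decide), h1.states])
        (by rw [← h1.system_eq]; simp [eval_init, numSystem]) .init
  exact ⟨W2, h2, h3, fun p hp => (h4 p hp).1, fun p hp => (h4 p hp).2, h5⟩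

theorem Holds.length_le (hX : (numSystem f N l).Bounded) (h : Holds f N l W m) :
    W.length ≤ (N + 2) * N := by
  rw [← List.toFinset_card_of_nodup h.nodup]
  calc W.toFinset.card ≤ (Finset.range (N + 2) ×ˢ Finset.range N).card := by
        refine Finset.card_le_card fun x hx => ?_
        have := (h.sound x (List.mem_toFinset.1 hx)).lt hX
        exact Finset.mem_product.2 ⟨Finset.mem_range.2 this.1, Finset.mem_range.2 this.2⟩
    _ = (N + 2) * N := by simp

/-- The two nested loops give `(N + 2) ^ 2` rounds, at least as many as there can be pairs; rounds
after the list is exhausted do nothing. A fixed number of rounds keeps the cost static. -/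
theorem eval_saturate (hX : (numSystem f N l).Bounded) (h : Holds f N l W m)
    (hB : (numSystem f N l).Base W) (h8 : m.reg 8 = 0) :
    Grown f N l W (fun W' => ∀ e q, (numSystem f N l).Der e q ↔ (e, q) ∈ W')
      (saturate.eval m) := by
  -- After `v` rounds, at least `v` entries have been processed or the list is exhausted.
  let J : ℕ → Mem → Prop := fun v m' => ∃ W', Holds f N l W' m' ∧ W <+: W' ∧
    m'.reg 8 ≤ W'.length ∧ (numSystem f N l).ClosedUpTo (m'.reg 8) W' ∧
    (v ≤ m'.reg 8 ∨ m'.reg 8 = W'.length)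
  have hJ : ∀ v m' x u, (x = 30 ∨ x = 31) → J v m' → J v (m'.setReg x u) := by
    rintro v m' x u hx ⟨W', h1, h2, h3, h4, h5⟩
    have h8 : (m'.setReg x u).reg 8 = m'.reg 8 := by
      simp [show 8 ≠ x by omega]
    refine ⟨W', h1.congr rfl fun y hy => ?_, h2, by rwa [h8], by rwa [h8], by rwa [h8]⟩
    have : y ≠ x := by
      rintro rfl
      rcases hx with rfl | rfl <;> revert hy <;> decide
    simp [this]
  have step : ∀ v m', J v m' → J (v + 1) ((Cmd.cond (.lt 8 9) process skip).eval m') := by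
    rintro v m' ⟨W', h1, h2, h3, h4, h5⟩
    simp only [eval_cond_lt, eval_skip, h1.tail]
    split_ifs with hlt
    · obtain ⟨⟨W2, h6, h7, h8⟩, h9⟩ := eval_process hX h1 hlt h4
      refine ⟨W2, h6, h2.trans h7, ?_, by rwa [h9], ?_⟩
      · rw [h9]
        have := h7.length_le
        omega
      · rw [h9]
        left
        omega
    · exact ⟨W', h1, h2, h3, h4, .inr (by omega)⟩
  have inner : ∀ i m', m'.reg 7 = N + 2 → J (i * (N + 2)) m' →
      J ((i + 1) * (N + 2)) ((rep 31 7 (Cmd.cond (.lt 8 9) process skip)).eval m') := by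
    intro i m' h7 hm'
    have := rep_induct (i := 31) (n := 7) (P := Cmd.cond (.lt 8 9) process skip) (m := m')
      (fun k => J (i * (N + 2) + k)) hm' (fun k v m' => hJ _ _ _ _ (.inr rfl))
      fun k _ m' hm' _ _ _ => step _ _ hm'
    rwa [h7, ← Nat.succ_mul] at this
  have outer := rep_induct (i := 30) (n := 7) (P := rep 31 7 (Cmd.cond (.lt 8 9) process skip))
      (m := m) (fun k => J (k * (N + 2)))
      ⟨W, h, List.prefix_rfl, by omega, by rw [h8]; exact ⟨by simp, by simp⟩, .inl (by omega)⟩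
      (fun k v m' => hJ _ _ _ _ (.inl rfl))
      fun k _ m' hm' hr _ _ => inner _ _ (by rw [hr 7 (by decide) (by decide), h.rows]) hm'
  rw [h.rows] at outer
  obtain ⟨W', h1, h2, h3, h4, h5⟩ := outer
  have h6 : (saturate.eval m).reg 8 = W'.length := by
    have h7 := h1.length_le hX
    have h8 : (N + 2) * N ≤ (N + 2) * (N + 2) := Nat.mul_le_mul_left _ (by omega)
    simp only [saturate]
    omega
  simp only [saturate] at h6
  rw [h6] at h4
  exact ⟨W', h1, h2, fun e q => ⟨fun h => h.mem (hB.mono h2.subset) h4, fun h => h1.sound _ h⟩⟩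

/-! ### The verdict. -/

/-- The state `q` of the product witnesses that the implementation does not conform. -/
def Bad (f : ℕ → List ℕ → ℕ) (q : ℕ) : Prop :=
  f 112 [q] ≠ 0 ∧
    ((f 122 [q] = 0 ∧ f 131 [f 132 [q]] ≠ 0) ∨ (f 122 [q] ≠ 0 ∧ f 141 [f 142 [q]] ≠ 0))

def Cmd.verdictStep : Cmd :=
  block [load 21 210 [11, 20], const 43 0, cond (.eq 21 43) skip
    (block [load 22 112 [20], cond (.eq 22 43) skip
      (block [load 23 122 [20], cond (.eq 23 43) (block [load 24 132 [20], load 25 131 [24]])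
        (block [load 24 142 [20], load 25 141 [24]]), cond (.eq 25 43) skip (const 0 0)])])]

def Cmd.verdict : Cmd := block [const 0 1, rep 20 6 verdictStep]

theorem eval_verdictStep (h : Holds f N l W m) :
    ((N + 1, m.reg 20) ∈ W ∧ Bad f (m.reg 20) → (verdictStep.eval m).reg 0 = 0) ∧
    (¬ ((N + 1, m.reg 20) ∈ W ∧ Bad f (m.reg 20)) →
      (verdictStep.eval m).reg 0 = m.reg 0) := by
  by_cases h1 : (N + 1, m.reg 20) ∈ W
  swap
  · simp [verdictStep, h1, h.mark, h.top]
  by_cases h2 : f 112 [m.reg 20] = 0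
  · simp [verdictStep, h1, h.mark, h.top, h2, h.arr, Bad]
  by_cases h3 : f 122 [m.reg 20] = 0
  · by_cases h4 : f 131 [f 132 [m.reg 20]] = 0 <;>
      simp [verdictStep, h1, h.mark, h.top, h2, h3, h4, h.arr, Bad]
  · by_cases h4 : f 141 [f 142 [m.reg 20]] = 0 <;>
      simp [verdictStep, h1, h.mark, h.top, h2, h3, h4, h.arr, Bad]

theorem eval_verdict (h : Holds f N l W m) :
    ((∃ q < N, (N + 1, q) ∈ W ∧ Bad f q) → (verdict.eval m).reg 0 = 0) ∧
    ((¬ ∃ q < N, (N + 1, q) ∈ W ∧ Bad f q) → (verdict.eval m).reg 0 = 1) := by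
  have hs : Holds f N l W (m.setReg 0 1) := h.congr rfl (by simp)
  have := rep_induct (i := 20) (n := 6) (P := verdictStep) (m := m.setReg 0 1)
    (fun k m' => Holds f N l W m' ∧
      ((∃ q < k, (N + 1, q) ∈ W ∧ Bad f q) → m'.reg 0 = 0) ∧
      ((¬ ∃ q < k, (N + 1, q) ∈ W ∧ Bad f q) → m'.reg 0 = 1))
    ⟨hs, by simp, by simp⟩ ?_ ?_
  · rw [hs.states] at this
    exact this.2
  · rintro k v m' ⟨h1, h2⟩
    exact ⟨h1.congr rfl (by simp), by simpa using h2⟩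
  · rintro k - m' ⟨h1, h2, h3⟩ - - hk
    have h4 := eval_verdictStep h1
    rw [hk] at h4
    have h5 : (∃ q < k + 1, (N + 1, q) ∈ W ∧ Bad f q) ↔
        (∃ q < k, (N + 1, q) ∈ W ∧ Bad f q) ∨ ((N + 1, k) ∈ W ∧ Bad f k) := by
      simp only [Nat.lt_succ_iff_lt_or_eq, or_and_right, exists_or, exists_eq_left]
    refine ⟨h1.eval verdictStep, ?_, ?_⟩
    · rw [h5]
      intro h6
      by_cases h7 : (N + 1, k) ∈ W ∧ Bad f k
      · exact h4.1 h7
      · rw [h4.2 h7]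
        exact h2 (h6.resolve_right h7)
    · rw [h5, not_or]
      rintro ⟨h6, h7⟩
      rw [h4.2 h7]
      exact h3 h6

end

/-! ### Soundness and completeness of the saturation rules. -/

namespace NumSystem

variable {L : Type} {kind : L → LKind} (X : NumSystem) (eL : L → ℕ)

def machine : CallMachine L ℕ where
  init := X.init
  simple p a := X.simple p (eL a)
  call p a := X.call p (eL a)
  bot p a := X.bot p (eL a)
  ret q b p a := X.ret q (eL b) p (eL a)

/-- The symbols are numbered, with their classes. -/
structure Codes (kind : L → LKind) : Prop where
  lt : ∀ a, eL a < X.l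
  surj : ∀ b < X.l, ∃ a, eL a = b
  call : ∀ a, X.kind (eL a) = 0 ↔ kind a = LKind.call
  ret : ∀ a, X.kind (eL a) = 1 ↔ kind a = LKind.ret
  simple : ∀ a, X.kind (eL a) = 2 ↔ kind a = LKind.simple

/-- A configuration reached by a run, as the saturation rules see it. -/
def Derives (kind : L → LKind) (q : ℕ) : List (ℕ × L) → Prop
  | [] => X.Der X.N q
  | (p, a) :: γ => kind a = LKind.call ∧ p < X.N ∧ X.Der (X.call p (eL a)) q ∧ Derives kind p γ

variable {X eL}

/-- The pending calls are replayed from the bottom of the stack: row `N + 1` forgets the stack, so a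
call applies there as an ordinary move. -/
theorem Derives.top (hL : X.Codes eL kind) {γ : List (ℕ × L)} {q : ℕ}
    (h : X.Derives eL kind q γ) : X.Der (X.N + 1) q := by
  induction γ generalizing q with
  | nil => exact .any h
  | cons x γ ih =>
    obtain ⟨p, a⟩ := x
    obtain ⟨h1, h2, h3, h4⟩ := h
    exact (Der.call (ih h4) (hL.lt a) ((hL.call a).2 h1)).trans h3

theorem Derives.trans {γ : List (ℕ × L)} {q r : ℕ} (h : X.Derives eL kind q γ)
    (hr : X.Der q r) : X.Derives eL kind r γ := by
  cases γ with
  | nil => exact Der.trans h hr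
  | cons x γ => exact ⟨h.1, h.2.1, h.2.2.1.trans hr, h.2.2.2⟩

/-- Completeness. A run splits at its pending calls into well-matched pieces, and a return merges
the last piece into the one below it by the rule `ret`. -/
theorem derives_run (hX : X.Bounded) (hL : X.Codes eL kind) (σ : List L) :
    X.Derives eL kind ((X.machine eL).run kind σ).1 ((X.machine eL).run kind σ).2 := by
  induction σ using List.reverseRecOn with
  | nil => exact Der.init
  | append_singleton σ a ih =>
    rw [CallMachine.run_snoc]
    generalize (X.machine eL).run kind σ = c at ih ⊢
    obtain ⟨q, γ⟩ := c
    have hq : q < X.N := ((ih.top hL).lt hX).2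
    cases ha : kind a with
    | simple =>
      rw [CallMachine.step_simple _ ha]
      exact ih.trans (.simple hq (hL.lt a) ((hL.simple a).2 ha))
    | call =>
      rw [CallMachine.step_call _ ha]
      exact ⟨ha, hq, .refl (hX.call hq (hL.lt a)), ih⟩
    | ret =>
      cases γ with
      | nil =>
        rw [CallMachine.step_bot _ ha]
        exact Der.bot ih (hL.lt a) ((hL.ret a).2 ha)
      | cons x γ =>
        obtain ⟨p, c⟩ := x
        rw [CallMachine.step_ret _ ha]
        obtain ⟨h1, h2, h3, h4⟩ := ih
        exact h4.trans (.ret h2 (hL.lt c) ((hL.call c).2 h1) h3 (hL.lt a) ((hL.ret a).2 ha))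

/-- Soundness of the saturation rules. -/
theorem Der.sound (hX : X.Bounded) (hL : X.Codes eL kind) {e q : ℕ} (h : X.Der e q) :
    (∀ σ γ, e < X.N → (X.machine eL).run kind σ = (e, γ) →
      ∃ σ', (X.machine eL).run kind σ' = (q, γ)) ∧
    (e = X.N → ∃ σ, (X.machine eL).run kind σ = (q, [])) ∧
    (e = X.N + 1 → ∃ σ γ, (X.machine eL).run kind σ = (q, γ)) := by
  induction h with
  | refl hp => exact ⟨fun σ γ _ h => ⟨σ, h⟩, fun h => by omega, fun h => by omega⟩
  | @simple p a hp ha hk =>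
    refine ⟨fun σ γ _ h => ?_, fun h => by omega, fun h => by omega⟩
    obtain ⟨a, rfl⟩ := hL.surj a ha
    exact ⟨σ ++ [a], by rw [CallMachine.run_snoc, h,
      CallMachine.step_simple _ ((hL.simple a).1 hk)]; rfl⟩
  | @ret p a q b hp ha hk hd hb hk' ih =>
    refine ⟨fun σ γ _ h => ?_, fun h => by omega, fun h => by omega⟩
    obtain ⟨a, rfl⟩ := hL.surj a ha
    obtain ⟨b, rfl⟩ := hL.surj b hb
    obtain ⟨σ', h'⟩ := ih.1 (σ ++ [a]) ((p, a) :: γ) (hX.call hp ha) (by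
      rw [CallMachine.run_snoc, h, CallMachine.step_call _ ((hL.call a).1 hk)]; rfl)
    exact ⟨σ' ++ [b], by rw [CallMachine.run_snoc, h',
      CallMachine.step_ret _ ((hL.ret b).1 hk')]; rfl⟩
  | trans h1 h2 ih1 ih2 =>
    -- The middle index is a state, so the first clause applies to the second premise in all three
    -- cases.
    have hq := (h1.lt hX).2
    refine ⟨fun σ γ he h => ?_, fun he => ?_, fun he => ?_⟩
    · obtain ⟨σ', h'⟩ := ih1.1 σ γ he h
      exact ih2.1 σ' γ hq h'
    · obtain ⟨σ', h'⟩ := ih1.2.1 he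
      exact ih2.1 σ' _ hq h'
    · obtain ⟨σ', γ, h'⟩ := ih1.2.2 he
      obtain ⟨σ'', h''⟩ := ih2.1 σ' _ hq h'
      exact ⟨σ'', γ, h''⟩
  | init => exact ⟨fun _ _ h => absurd h (lt_irrefl _), fun _ => ⟨[], rfl⟩, fun h => by omega⟩
  | @bot q b hd hb hk ih =>
    refine ⟨fun _ _ h => absurd h (lt_irrefl _), fun _ => ?_, fun h => by omega⟩
    obtain ⟨b, rfl⟩ := hL.surj b hb
    obtain ⟨σ, h⟩ := ih.2.1 rfl
    exact ⟨σ ++ [b], by rw [CallMachine.run_snoc, h,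
      CallMachine.step_bot _ ((hL.ret b).1 hk)]; rfl⟩
  | any hd ih =>
    refine ⟨fun _ _ h => by omega, fun h => by omega, fun _ => ?_⟩
    obtain ⟨σ, h⟩ := ih.2.1 rfl
    exact ⟨σ, _, h⟩
  | @call q a hd ha hk ih =>
    refine ⟨fun _ _ h => by omega, fun h => by omega, fun _ => ?_⟩
    obtain ⟨a, rfl⟩ := hL.surj a ha
    obtain ⟨σ, γ, h⟩ := ih.2.2 rfl
    exact ⟨σ ++ [a], _, by rw [CallMachine.run_snoc, h,
      CallMachine.step_call _ ((hL.call a).1 hk)]; rfl⟩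

theorem der_top_iff (hX : X.Bounded) (hL : X.Codes eL kind) (q : ℕ) :
    X.Der (X.N + 1) q ↔ ∃ σ, ((X.machine eL).run kind σ).1 = q := by
  constructor
  · intro h
    obtain ⟨σ, γ, h⟩ := (h.sound hX hL).2.2 rfl
    exact ⟨σ, by rw [h]⟩
  · rintro ⟨σ, rfl⟩
    exact (derives_run hX hL σ).top hL

end NumSystem

/-! ### The machine in memory is the product of the four machines. -/

open CallMachine

/-- The tables of the system in the arrays `b, …, b + 5` agree with a selector and its chains of
internal moves. -/
structure Tables {L : Type} {kind : L → LKind} (f : ℕ → List ℕ → ℕ) (b : ℕ)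
    (eL : L ≃ Fin (Nat.card L)) {S : VPTS kind} (X : S.Selector)
    (eS : S.State ≃ Fin (Nat.card S.State)) (eG : S.Stk ≃ Fin (Nat.card S.Stk)) : Prop where
  reads : Reads f b eL X eS eG
  rep : ∀ q, f (100 + b) [(eS q : ℕ) + 1] = eS (X.rep q)

section

variable {L : Type} {kind : L → LKind} {f : ℕ → List ℕ → ℕ} {b : ℕ}
  {eL : L ≃ Fin (Nat.card L)} {S : VPTS kind} {X : S.Selector}
  {eS : S.State ≃ Fin (Nat.card S.State)} {eG : S.Stk ≃ Fin (Nat.card S.Stk)}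

theorem stkCode_lt {Γ : Type} {g : ℕ} (e : Γ ≃ Fin g) (o : Option Γ) : stkCode e o < g + 1 := by
  cases o with
  | none => exact Nat.succ_pos _
  | some Z => exact Nat.succ_lt_succ (e Z).2

theorem exists_stkCode {Γ : Type} {g : ℕ} (e : Γ ≃ Fin g) {u : ℕ} (hu : u < g + 1) :
    ∃ o, stkCode e o = u := by
  cases u with
  | zero => exact ⟨none, rfl⟩
  | succ u => exact ⟨some (e.symm ⟨u, by omega⟩), by simp [stkCode]⟩

theorem stkCode_eq_zero {Γ : Type} {g : ℕ} (e : Γ ≃ Fin g) (o : Option Γ) :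
    stkCode e o = 0 ↔ o = none := by
  cases o <;> simp [stkCode]

variable {p : ℕ} {o : Option S.State}

theorem Tables.simpleVal_eq (h : Tables f b eL X eS eG)
    (hp : f (102 + b) [p] = stkCode eS o) (a : L) :
    simpleVal f p (eL a) b = stkCode eS (X.machine.simple o a) := by
  rw [simpleVal, hp]
  cases o with
  | none => rfl
  | some q => simp [stkCode, h.rep, h.reads.simple, VPTS.Selector.machine]

theorem Tables.callVal_eq (h : Tables f b eL X eS eG)
    (hp : f (102 + b) [p] = stkCode eS o) (a : L) :
    callVal f p (eL a) b = stkCode eS (X.machine.call o a) := by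
  rw [callVal, hp]
  cases o with
  | none => rfl
  | some q => simp [stkCode, h.rep, h.reads.push, VPTS.Selector.machine]

theorem Tables.botVal_eq (h : Tables f b eL X eS eG)
    (hp : f (102 + b) [p] = stkCode eS o) (a : L) :
    botVal f p (eL a) b = stkCode eS (X.machine.bot o a) := by
  rw [botVal, hp]
  cases o with
  | none => rfl
  | some q =>
    have := h.reads.pop (X.rep q) a none
    simp only [stkCode] at this
    simp [stkCode, h.rep, this, VPTS.Selector.machine]

/-- Both sides recompute the pushed symbol from the call. If the call had no push move, the return
is blocked on both sides, hence the separate test for an empty list. -/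
theorem Tables.retVal_eq (h : Tables f b eL X eS eG) (hp : f (102 + b) [p] = stkCode eS o)
    (a : L) {q : ℕ} {o' : Option S.State} (hq : f (102 + b) [q] = stkCode eS o') (c : L) : retVal f p (eL a) q (eL c) b = stkCode eS (X.machine.ret o a o' c) := by
  rw [retVal, hp, hq]
  cases o with
  | none => rfl
  | some r =>
    cases o' with
    | none => rfl
    | some r' =>
      have h1 := h.reads.push (X.rep r') c
      cases hpush : X.push (X.rep r') c with
      | none =>
        rw [hpush] at h1
        have h2 : f (b + 2) [(eS (X.rep r') : ℕ), (eL c : ℕ), 0] = 0 := by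
          by_contra h2
          simp [first, stkCode, h2] at h1
        simp [stkCode, h.rep, h2, VPTS.Selector.machine, hpush]
      | some Zq =>
        rw [hpush] at h1
        have h2 : f (b + 2) [(eS (X.rep r') : ℕ), (eL c : ℕ), 0] ≠ 0 := by
          intro h2
          simp [first, stkCode, h2] at h1
        have h3 := h.reads.pushed (X.rep r') c Zq.1 Zq.2 hpush
        have h4 := h.reads.pop (X.rep r) a (some Zq.1)
        rw [← h3] at h4
        simp [stkCode, h.rep, h2, VPTS.Selector.machine, hpush]
        exact h4

end

/-- The tables of four systems, and the numbering of the states of their product. -/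
structure ProductTables {L : Type} {kind : L → LKind} (f : ℕ → List ℕ → ℕ)
    (eL : L ≃ Fin (Nat.card L)) {S₁ S₂ S₃ S₄ : VPTS kind} (X₁ : S₁.Selector) (X₂ : S₂.Selector)
    (X₃ : S₃.Selector) (X₄ : S₄.Selector) (e₁ : S₁.State ≃ Fin (Nat.card S₁.State))
    (e₂ : S₂.State ≃ Fin (Nat.card S₂.State)) (e₃ : S₃.State ≃ Fin (Nat.card S₃.State))
    (e₄ : S₄.State ≃ Fin (Nat.card S₄.State)) (N : ℕ) : Prop where
  tables₁ : ∃ g, Tables f 10 eL X₁ e₁ g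
  tables₂ : ∃ g, Tables f 20 eL X₂ e₂ g
  tables₃ : ∃ g, Tables f 30 eL X₃ e₃ g
  tables₄ : ∃ g, Tables f 40 eL X₄ e₄ g
  card : N = (S₁.size + 1) * (S₂.size + 1) * (S₃.size + 1) * (S₄.size + 1)
  numbered : Numbered f (S₁.size + 1) (S₂.size + 1) (S₃.size + 1) (S₄.size + 1) N

namespace ProductTables

variable {L : Type} {kind : L → LKind} {f : ℕ → List ℕ → ℕ} {eL : L ≃ Fin (Nat.card L)}
  {S₁ S₂ S₃ S₄ : VPTS kind} {X₁ : S₁.Selector} {X₂ : S₂.Selector} {X₃ : S₃.Selector}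
  {X₄ : S₄.Selector} {e₁ : S₁.State ≃ Fin (Nat.card S₁.State)}
  {e₂ : S₂.State ≃ Fin (Nat.card S₂.State)} {e₃ : S₃.State ≃ Fin (Nat.card S₃.State)}
  {e₄ : S₄.State ≃ Fin (Nat.card S₄.State)} {N : ℕ}
  (h : ProductTables f eL X₁ X₂ X₃ X₄ e₁ e₂ e₃ e₄ N)

/-- The number of a state of the product. -/
noncomputable def code (_ : ProductTables f eL X₁ X₂ X₃ X₄ e₁ e₂ e₃ e₄ N)
    (x : (Option S₁.State × Option S₂.State) × (Option S₃.State × Option S₄.State)) : ℕ :=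
  num4 (S₂.size + 1) (S₃.size + 1) (S₄.size + 1) (stkCode e₁ x.1.1) (stkCode e₂ x.1.2)
    (stkCode e₃ x.2.1) (stkCode e₄ x.2.2)

theorem code_lt (x) : h.code x < N := by
  exact (num4_lt (stkCode_lt _ _) (stkCode_lt _ _) (stkCode_lt _ _) (stkCode_lt _ _)).trans_eq
    h.card.symm

theorem exists_code {p : ℕ} (hp : p < N) : ∃ x, h.code x = p := by
  rw [h.card] at hp
  obtain ⟨i₁, i₂, i₃, i₄, h₁, h₂, h₃, h₄, rfl⟩ := exists_num4 hp
  obtain ⟨o₁, rfl⟩ := exists_stkCode e₁ h₁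
  obtain ⟨o₂, rfl⟩ := exists_stkCode e₂ h₂
  obtain ⟨o₃, rfl⟩ := exists_stkCode e₃ h₃
  obtain ⟨o₄, rfl⟩ := exists_stkCode e₄ h₄
  exact ⟨((o₁, o₂), (o₃, o₄)), rfl⟩

theorem numbered_code (x) : f 112 [h.code x] = stkCode e₁ x.1.1 ∧
    f 122 [h.code x] = stkCode e₂ x.1.2 ∧ f 132 [h.code x] = stkCode e₃ x.2.1 ∧
    f 142 [h.code x] = stkCode e₄ x.2.2 ∧
    f 200 [stkCode e₁ x.1.1, stkCode e₂ x.1.2, stkCode e₃ x.2.1, stkCode e₄ x.2.2] = h.code x :=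
  h.numbered _ (stkCode_lt _ _) _ (stkCode_lt _ _) _ (stkCode_lt _ _) _ (stkCode_lt _ _)
    (h.code_lt x)

theorem tuple_eq {v : ℕ → ℕ} (x) (h₁ : v 10 = stkCode e₁ x.1.1) (h₂ : v 20 = stkCode e₂ x.1.2)
    (h₃ : v 30 = stkCode e₃ x.2.1) (h₄ : v 40 = stkCode e₄ x.2.2) : tuple f v = h.code x := by
  rw [tuple, h₁, h₂, h₃, h₄]
  exact (h.numbered_code x).2.2.2.2

/-- The machine in memory is the product of the four machines. -/
noncomputable def hom (l : ℕ) :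
    Hom ((X₁.machine.prod X₂.machine).prod (X₃.machine.prod X₄.machine))
      ((numSystem f N l).machine fun a => (eL a : ℕ)) where
  toFun := h.code
  init := by
    obtain ⟨⟨_, h₁⟩, ⟨_, h₂⟩, ⟨_, h₃⟩, ⟨_, h₄⟩, -, -⟩ := id h
    exact (h.tuple_eq (v := fun b => first f (b + 1) []) ((X₁.init, X₂.init), (X₃.init, X₄.init))
      h₁.reads.init h₂.reads.init h₃.reads.init h₄.reads.init).symm
  simple x a := by
    obtain ⟨⟨_, h₁⟩, ⟨_, h₂⟩, ⟨_, h₃⟩, ⟨_, h₄⟩, -, -⟩ := id h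
    obtain ⟨c₁, c₂, c₃, c₄, -⟩ := h.numbered_code x
    exact (h.tuple_eq _ (h₁.simpleVal_eq c₁ a) (h₂.simpleVal_eq c₂ a) (h₃.simpleVal_eq c₃ a)
      (h₄.simpleVal_eq c₄ a)).symm
  call x a := by
    obtain ⟨⟨_, h₁⟩, ⟨_, h₂⟩, ⟨_, h₃⟩, ⟨_, h₄⟩, -, -⟩ := id h
    obtain ⟨c₁, c₂, c₃, c₄, -⟩ := h.numbered_code x
    exact (h.tuple_eq _ (h₁.callVal_eq c₁ a) (h₂.callVal_eq c₂ a) (h₃.callVal_eq c₃ a)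
      (h₄.callVal_eq c₄ a)).symm
  bot x a := by
    obtain ⟨⟨_, h₁⟩, ⟨_, h₂⟩, ⟨_, h₃⟩, ⟨_, h₄⟩, -, -⟩ := id h
    obtain ⟨c₁, c₂, c₃, c₄, -⟩ := h.numbered_code x
    exact (h.tuple_eq _ (h₁.botVal_eq c₁ a) (h₂.botVal_eq c₂ a) (h₃.botVal_eq c₃ a)
      (h₄.botVal_eq c₄ a)).symm
  ret x a y c := by
    obtain ⟨⟨_, h₁⟩, ⟨_, h₂⟩, ⟨_, h₃⟩, ⟨_, h₄⟩, -, -⟩ := id h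
    obtain ⟨c₁, c₂, c₃, c₄, -⟩ := h.numbered_code x
    obtain ⟨d₁, d₂, d₃, d₄, -⟩ := h.numbered_code y
    exact (h.tuple_eq _ (h₁.retVal_eq c₁ a d₁ c) (h₂.retVal_eq c₂ a d₂ c)
      (h₃.retVal_eq c₃ a d₃ c) (h₄.retVal_eq c₄ a d₄ c)).symm

/-- Every number below `N` codes a state of the product, so values of the operations are again codes
by `hom`. -/
theorem bounded (h : ProductTables f eL X₁ X₂ X₃ X₄ e₁ e₂ e₃ e₄ N) :
    (numSystem f N (Nat.card L)).Bounded := by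
  have hL : ∀ {a}, a < Nat.card L → ∃ a', (eL a' : ℕ) = a := fun {a} ha =>
    ⟨eL.symm ⟨a, ha⟩, by simp⟩
  constructor
  · exact ((h.hom (Nat.card L)).init).symm.trans_lt (h.code_lt _)
  · intro p a hp ha
    obtain ⟨x, rfl⟩ := h.exists_code hp
    obtain ⟨a, rfl⟩ := hL ha
    exact ((h.hom (Nat.card L)).simple x a).symm.trans_lt (h.code_lt _)
  · intro p a hp ha
    obtain ⟨x, rfl⟩ := h.exists_code hp
    obtain ⟨a, rfl⟩ := hL ha
    exact ((h.hom (Nat.card L)).call x a).symm.trans_lt (h.code_lt _)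
  · intro p a hp ha
    obtain ⟨x, rfl⟩ := h.exists_code hp
    obtain ⟨a, rfl⟩ := hL ha
    exact ((h.hom (Nat.card L)).bot x a).symm.trans_lt (h.code_lt _)
  · intro p a q b hp ha hq hb
    obtain ⟨x, rfl⟩ := h.exists_code hp
    obtain ⟨y, rfl⟩ := h.exists_code hq
    obtain ⟨a, rfl⟩ := hL ha
    obtain ⟨b, rfl⟩ := hL hb
    exact ((h.hom (Nat.card L)).ret x a y b).symm.trans_lt (h.code_lt _)

end ProductTables

/-- The table of the states from which a chain of internal moves visits a final state. -/
def HoldsAccepts {L : Type} {kind : L → LKind} (f : ℕ → List ℕ → ℕ) (b : ℕ) {S : VPTS kind}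
    (X : S.Selector) (eS : S.State ≃ Fin (Nat.card S.State)) (F : Set S.State) : Prop :=
  ∀ o, f (101 + b) [stkCode eS o] ≠ 0 ↔ ∃ q, o = some q ∧ X.Accepts F q

/-- A violating word drives the product to a state that displays the violation, and every reachable
state of that kind comes from such a word. The verdict thus depends on the state only, not on the
stack. -/
theorem not_conforms_iff {L : Type} {kind : L → LKind} {f : ℕ → List ℕ → ℕ}
    {eL : L ≃ Fin (Nat.card L)} {I S : VPTS kind} {AD AF : VPA kind} {XI : I.Selector}
    {XS : S.Selector} {XD : AD.toVPTS.Selector} {XF : AF.toVPTS.Selector}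
    {eI : I.State ≃ Fin (Nat.card I.State)} {eS : S.State ≃ Fin (Nat.card S.State)}
    {eD : AD.State ≃ Fin (Nat.card AD.State)} {eF : AF.State ≃ Fin (Nat.card AF.State)} {N : ℕ}
    (h : ProductTables f eL XI XS XD XF eI eS eD eF N)
    (hL : (numSystem f N (Nat.card L)).Codes (fun a => (eL a : ℕ)) kind)
    (hD : HoldsAccepts f 30 XD eD AD.final) (hF : HoldsAccepts f 40 XF eF AF.final)
    (dI : I.Deterministic) (dS : S.Deterministic) (dD : AD.Deterministic)
    (dF : AF.Deterministic) :
    ¬ Conforms AD.language AF.language I S ↔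
      ∃ q < N, (numSystem f N (Nat.card L)).Der (N + 1) q ∧ Bad f q := by
  have hder := fun q => NumSystem.der_top_iff h.bounded hL q
  have hrun : ∀ σ, (((numSystem f N (Nat.card L)).machine fun a => (eL a : ℕ)).run kind σ).1 =
      h.code (((XI.machine.run kind σ).1, (XS.machine.run kind σ).1),
        ((XD.machine.run kind σ).1, (XF.machine.run kind σ).1)) := fun σ => by
    rw [(h.hom (Nat.card L)).run kind σ, prod_run_fst, prod_run_fst, prod_run_fst]
    rfl
  have hbad : ∀ x, Bad f (h.code x) ↔ x.1.1 ≠ none ∧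
      ((x.1.2 = none ∧ ∃ q, x.2.1 = some q ∧ XD.Accepts AD.final q) ∨
        (x.1.2 ≠ none ∧ ∃ q, x.2.2 = some q ∧ XF.Accepts AF.final q)) := fun x => by
    obtain ⟨c₁, c₂, c₃, c₄, -⟩ := h.numbered_code x
    rw [← hD, ← hF, Bad, c₁, c₂, c₃, c₄]
    simp only [ne_eq, stkCode_eq_zero]
  have key : (∃ q < N, (numSystem f N (Nat.card L)).Der (N + 1) q ∧ Bad f q) ↔
      ∃ σ, σ ∈ I.otr ∧ ((σ ∉ S.otr ∧ σ ∈ AD.language) ∨ (σ ∈ S.otr ∧ σ ∈ AF.language)) := by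
    simp only [(XI.faithful_of_deterministic dI).mem_otr,
      (XS.faithful_of_deterministic dS).mem_otr, VPA.mem_language_iff dD XD,
      VPA.mem_language_iff dF XF, not_not]
    constructor
    · rintro ⟨q, -, hq, hb⟩
      obtain ⟨σ, rfl⟩ := (hder q).1 hq
      rw [hrun, hbad] at hb
      exact ⟨σ, hb⟩
    · rintro ⟨σ, hb⟩
      refine ⟨_, h.code_lt _, (hder _).2 ⟨σ, hrun σ⟩, ?_⟩
      rw [hbad]
      exact hb
  rw [key, Conforms]
  constructor
  · intro hc
    by_contra! hn
    refine hc ⟨fun σ h1 h2 h3 => (hn σ h1).2 h3 h2, fun σ h1 h2 => ?_⟩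
    by_contra h3
    exact (hn σ h1).1 h3 h2
  · rintro ⟨σ, h1, ⟨h2, h3⟩ | ⟨h2, h3⟩⟩ ⟨c1, c2⟩
    · exact h2 (c2 σ h1 h3)
    · exact c1 σ h1 h3 h2

/-! ### The decision program, its correctness and its running time. -/

/-- Loads the number of symbols and the numbers of states, plus one, of the four systems. -/
def Cmd.loadSizes : Cmd :=
  block [const 90 0, load 1 0 [90], load 2 10 [90], succ 2 2, load 3 20 [90], succ 3 3,
    load 4 30 [90], succ 4 4, load 5 40 [90], succ 5 5]

def Cmd.allChains : Cmd := block [chains 10 2, chains 20 3, chains 30 4, chains 40 5]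

def Cmd.prepareRows : Cmd := block [succ 11 6, succ 7 11, const 8 0, const 9 0]

def Cmd.decideBad : Cmd := block [loadRules, saturate, verdict]

/-- The decision procedure. -/
def conformance : Program :=
  .seq loadSizes.toProgram (.seq allChains.toProgram (.seq numbering.toProgram
    (.seq prepareRows.toProgram decideBad.toProgram)))

theorem Cmd.exists_exec_le {Λ : List ℕ} {P : Cmd} (h : P.ok Λ) (hL : P.degL ≤ 2)
    (hN : P.degN ≤ 3) {m : Mem} {G N : ℕ} (hG : 0 < G) (hN0 : 0 < N)
    (hm : ∀ n ∈ Λ, m.reg n ≤ if n = 1 then G else N) :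
    ∃ t ≤ P.coef * (G ^ 2 * N ^ 3), Exec P.toProgram m t (P.eval m) := by
  obtain ⟨t, ht, he⟩ := exists_exec h (m := m) (ρ := m.reg) fun _ _ => rfl
  exact ⟨t, ht.trans ((cost_le h hG hN0 hm).trans (Nat.mul_le_mul_left _ (Nat.mul_le_mul
    (Nat.pow_le_pow_right hG hL) (Nat.pow_le_pow_right hN0 hN)))), he⟩

/-- Bounding each of the four nested limits by `N` would give `N ^ 4`; the loops are bounded by the
product of their limits instead, which is `N` itself. -/
theorem exists_exec_numbering {m : Mem} (h₂ : 0 < m.reg 2) (h₃ : 0 < m.reg 3) (h₄ : 0 < m.reg 4)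
    (h₅ : 0 < m.reg 5) : ∃ t ≤ numbering.coef * (m.reg 2 * (m.reg 3 * (m.reg 4 * m.reg 5))),
      Exec numbering.toProgram m t (numbering.eval m) := by
  obtain ⟨t, ht, he⟩ := exists_exec (Λ := [2, 3, 4, 5]) (P := numbering) (by decide) (m := m)
    (ρ := m.reg) fun _ _ => rfl
  refine ⟨t, ht.trans ?_, he⟩
  have h1 : numberStep.cost m.reg ≤ numberStep.coef * 1 := le_of_eq rfl
  have h2 := loop_cost_le h₅ le_rfl h1 le_rfl
  rw [Nat.mul_one] at h2
  have h3 := loop_cost_le h₄ le_rfl h2 h₅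
  have h4 := loop_cost_le h₃ le_rfl h3 (Nat.mul_pos h₄ h₅)
  have h5 := loop_cost_le h₂ le_rfl h4 (Nat.mul_pos h₃ (Nat.mul_pos h₄ h₅))
  have h6 : 0 < m.reg 2 * (m.reg 3 * (m.reg 4 * m.reg 5)) := by positivity
  have h7 : numbering.coef = numberStep.coef + 4 + 4 + 4 + 4 + 2 := rfl
  rw [h7, Nat.add_mul _ 2]
  refine le_trans (le_of_eq ?_) (Nat.add_le_add h5 (show 2 ≤ _ by omega))
  simp only [numbering, block, cost]
  omega

/-- The commands around `chains b n` write neither the input arrays nor the two result arrays of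
this system, so its tables are still valid at the end. -/
theorem tables_of_chains {L : Type} {kind : L → LKind} {S : VPTS kind} {X : S.Selector}
    {b n : ℕ} {eL : L ≃ Fin (Nat.card L)} {eS : S.State ≃ Fin (Nat.card S.State)}
    {eG : S.Stk ≃ Fin (Nat.card S.Stk)} {m : Mem} (pre post : Cmd) (hb : b < 90) (hn5 : n < 50)
    (hR : Reads m.arr b eL X eS eG) (hn : m.reg n = S.size + 1) (hz : m.arr (101 + b) [0] = 0)
    (hpre : ∀ a ∈ pre.stores, 100 ≤ a ∧ a ≠ 101 + b) (hpren : n ∉ pre.writes)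
    (hpost : ∀ a ∈ post.stores, 100 ≤ a ∧ a ≠ 100 + b ∧ a ≠ 101 + b) :
    Tables ((seq pre (seq (chains b n) post)).eval m).arr b eL X eS eG ∧
      ∀ F, m.HoldsFinal (b + 6) eS F →
        HoldsAccepts ((seq pre (seq (chains b n) post)).eval m).arr b X eS F := by
  have h1 : ∀ a < 100, (pre.eval m).arr a = m.arr a := fun a ha =>
    eval_arr _ fun h => by have := (hpre a h).1; omega
  have h2 : ∀ a < 100, ((seq pre (seq (chains b n) post)).eval m).arr a = m.arr a := fun a ha => by
    have h3 : a ∉ post.stores := fun h => by have := (hpost a h).1; omega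
    have h4 : a ∉ (chains b n).stores := by
      show a ∉ [100 + b, 101 + b]
      simp only [List.mem_cons, List.not_mem_nil, or_false]
      omega
    rw [eval_seq, eval_seq, eval_arr _ h3, eval_arr _ h4, h1 a ha]
  have h100 : ((seq pre (seq (chains b n) post)).eval m).arr (100 + b) =
      ((chains b n).eval (pre.eval m)).arr (100 + b) :=
    eval_arr _ fun h => (hpost _ h).2.1 rfl
  have h101 : ((seq pre (seq (chains b n) post)).eval m).arr (101 + b) =
      ((chains b n).eval (pre.eval m)).arr (101 + b) :=
    eval_arr _ fun h => (hpost _ h).2.2 rfl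
  obtain ⟨h3, h4⟩ := eval_chains (m := pre.eval m) (n := n) hb hn5
    (hR.congr fun a h => h1 a (by omega))
    (by rw [eval_reg _ hpren, hn]) (by rw [eval_arr _ fun h => (hpre _ h).2 rfl, hz])
  refine ⟨⟨hR.congr fun a h => h2 a (by omega), fun q => ?_⟩, fun F hF o => ?_⟩
  · rw [h100]
    exact (h4 q).1
  · rw [h101]
    cases o with
    | none => simp [stkCode, h3]
    | some q =>
      obtain ⟨h5, h6⟩ := (h4 q).2 F (by
        simpa only [Mem.HoldsFinal, h1 (b + 6) (by omega)] using hF)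
      by_cases hq : X.Accepts F q
      · simp [stkCode, h5 hq, hq]
      · simp [stkCode, h6 hq, hq]

theorem eval_loadSizes (m : Mem) : (loadSizes.eval m).arr = m.arr ∧
    (loadSizes.eval m).reg 1 = m.arr 0 [0] ∧ (loadSizes.eval m).reg 2 = m.arr 10 [0] + 1 ∧
    (loadSizes.eval m).reg 3 = m.arr 20 [0] + 1 ∧ (loadSizes.eval m).reg 4 = m.arr 30 [0] + 1 ∧
    (loadSizes.eval m).reg 5 = m.arr 40 [0] + 1 := by
  simp [loadSizes]

theorem Mem.HoldsAlphabet.codes {L : Type} {kind : L → LKind} {m : Mem}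
    {eL : L ≃ Fin (Nat.card L)} (h : m.HoldsAlphabet kind eL) {f : ℕ → List ℕ → ℕ}
    (hf : f 1 = m.arr 1) (N : ℕ) :
    (numSystem f N (Nat.card L)).Codes (fun a => (eL a : ℕ)) kind := by
  have hk : ∀ a, (numSystem f N (Nat.card L)).kind (eL a) = m.arr 1 [(eL a : ℕ)] := fun a => by
    simp [numSystem, hf]
  refine ⟨fun a => (eL a).2, fun b hb => ⟨eL.symm ⟨b, hb⟩, by simp⟩, ?_, ?_, ?_⟩ <;> intro a <;>
    rw [hk] <;> cases hc : kind a <;> simp [h.call, h.ret, h.simple, hc]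

theorem le_cost_bound (l n : ℕ) : n ≤ (l + 1) ^ 2 * (n + 2) ^ 3 := by
  have h1 : 1 ≤ (l + 1) ^ 2 := Nat.one_le_pow _ _ l.succ_pos
  have h2 : (n + 2) ^ 1 ≤ (n + 2) ^ 3 := Nat.pow_le_pow_right (by omega) (by omega)
  calc n ≤ 1 * (n + 2) ^ 1 := by rw [pow_one]; omega
    _ ≤ _ := Nat.mul_le_mul h1 h2

set_option maxRecDepth 20000 in
theorem conformance_spec {L : Type} {kind : L → LKind} {I S : VPTS kind} {AD AF : VPA kind}
    (dI : I.Deterministic) (dS : S.Deterministic) (dD : AD.Deterministic)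
    (dF : AF.Deterministic) {m : Mem} (hm : m.IsInput I S AD AF) :
    ∃ t m', Exec conformance m t m' ∧
      t ≤ (loadSizes.coef + allChains.coef + numbering.coef + prepareRows.coef + decideBad.coef) *
        ((Nat.card L + 1) ^ 2 *
          ((I.size + 1) * (S.size + 1) * (AD.size + 1) * (AF.size + 1) + 2) ^ 3) ∧
      (Conforms AD.language AF.language I S → m'.reg 0 = 1) ∧
      (¬ Conforms AD.language AF.language I S → m'.reg 0 = 0) := by
  obtain ⟨⟨eL, hA, ⟨eI, gI, hI⟩, ⟨eS, gS, hS⟩, ⟨eD, gD, hD, hDF⟩, eF, gF, hF, hFF⟩, -, hz⟩ := hm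
  obtain ⟨XI, rI⟩ := hI.exists_reads
  obtain ⟨XS, rS⟩ := hS.exists_reads
  obtain ⟨XD, rD⟩ := hD.exists_reads
  obtain ⟨XF, rF⟩ := hF.exists_reads
  obtain ⟨a1, s1, s2, s3, s4, s5⟩ := eval_loadSizes m
  rw [hA.card] at s1
  rw [hI.states] at s2
  rw [hS.states] at s3
  rw [hD.states] at s4
  rw [hF.states] at s5
  set m1 := loadSizes.eval m with hm1
  rw [← a1] at rI rS rD rF
  have hz1 : ∀ a, 100 ≤ a → ∀ i, m1.arr a i = 0 := by rwa [a1]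
  have hDF1 : m1.HoldsFinal 36 eD AD.final := by simpa only [Mem.HoldsFinal, a1] using hDF
  have hFF1 : m1.HoldsFinal 46 eF AF.final := by simpa only [Mem.HoldsFinal, a1] using hFF
  set m2 := allChains.eval m1 with hm2
  set m3 := numbering.eval m2 with hm3
  set m4 := prepareRows.eval m3 with hm4
  -- The four applications cut the same sequence of commands around different calls of `chains`; the
  -- resulting memories are definitionally `m4`.
  have tI := (tables_of_chains skip
    (block [chains 20 3, chains 30 4, chains 40 5, numbering, prepareRows]) (n := 2)
    (by decide) (by decide) rI s2 (hz1 _ (by decide) _) (by decide) (by decide) (by decide)).1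
  have tS := (tables_of_chains (chains 10 2)
    (block [chains 30 4, chains 40 5, numbering, prepareRows]) (n := 3)
    (by decide) (by decide) rS s3 (hz1 _ (by decide) _) (by decide) (by decide) (by decide)).1
  obtain ⟨tD, fD⟩ := tables_of_chains (block [chains 10 2, chains 20 3])
    (block [chains 40 5, numbering, prepareRows]) (n := 4)
    (by decide) (by decide) rD s4 (hz1 _ (by decide) _) (by decide) (by decide) (by decide)
  obtain ⟨tF, fF⟩ := tables_of_chains (block [chains 10 2, chains 20 3, chains 30 4])
    (block [numbering, prepareRows]) (n := 5)
    (by decide) (by decide) rF s5 (hz1 _ (by decide) _) (by decide) (by decide) (by decide)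
  replace fD := fD _ hDF1
  replace fF := fF _ hFF1
  have hr2 : ∀ x ∈ [1, 2, 3, 4, 5], m2.reg x = m1.reg x := fun x hx =>
    eval_reg _ (by revert x; decide)
  obtain ⟨hN, hnum⟩ := eval_numbering m2
  rw [hr2 2 (by decide), hr2 3 (by decide), hr2 4 (by decide), hr2 5 (by decide), s2, s3, s4, s5]
    at hN hnum
  set N := (Nat.card I.State + 1) * (Nat.card S.State + 1) * (Nat.card AD.State + 1) *
    (Nat.card AF.State + 1) with hNdef
  replace hN : m3.reg 6 = N := hN
  have ha4 : m4.arr = m3.arr := by simp [hm4, prepareRows]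
  have hT : ProductTables m4.arr eL XI XS XD XF eI eS eD eF N :=
    ⟨⟨_, tI⟩, ⟨_, tS⟩, ⟨_, tD⟩, ⟨_, tF⟩, rfl, by rw [ha4]; exact hnum⟩
  have hr3 : m3.reg 1 = Nat.card L := by
    rw [hm3, eval_reg _ (by decide), hr2 1 (by decide), s1]
  have h0 : ∀ a, a = 210 ∨ a = 211 → m4.arr a = m1.arr a := by
    intro a ha
    rw [ha4, hm3, eval_arr _ (by rcases ha with rfl | rfl <;> decide), hm2,
      eval_arr _ (by rcases ha with rfl | rfl <;> decide)]
  -- The saturation starts from the empty list: the marks are zero in the input memory and no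
  -- earlier command touches them.
  have hH : Holds m4.arr N (Nat.card L) [] m4 := by
    constructor
    · exact fun _ _ => rfl
    · simp [hm4, prepareRows, hr3]
    · simp [hm4, prepareRows, hN]
    · simp [hm4, prepareRows, hN]
    · simp [hm4, prepareRows, hN]
    · simp [hm4, prepareRows]
    · intro e q
      rw [h0 210 (.inl rfl), hz1 _ (by decide)]
      simp
    · intro k hk
      simp at hk
    · exact List.nodup_nil
    · simp
  have hB := hT.bounded
  obtain ⟨W5, h5, -, hbase⟩ := eval_loadRules hH
  obtain ⟨W6, h6, -, hder⟩ := eval_saturate hB h5 hbase (by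
    rw [eval_reg _ (by decide)]
    simp [hm4, prepareRows])
  obtain ⟨hbad, hgood⟩ := eval_verdict h6
  have hcodes := hA.codes (f := m4.arr) (by
    rw [ha4, hm3, eval_arr _ (by decide), hm2, eval_arr _ (by decide), a1]) N
  have hconf := not_conforms_iff hT hcodes fD fF dI dS dD dF
  simp only [hder] at hconf
  -- Each limit is a factor of `N`. The common bound is `N + 2` because the saturation also loops
  -- over that many rows.
  have hle : ∀ x, x ∈ [2, 3, 4, 5] → m1.reg x ≤ N + 2 := by
    have key : ∀ a b c d : ℕ, a + 1 ≤ (a + 1) * (b + 1) * (c + 1) * (d + 1) := fun a b c d => by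
      rw [Nat.mul_assoc, Nat.mul_assoc]
      exact Nat.le_mul_of_pos_right _ (by positivity)
    intro x hx
    simp only [List.mem_cons, List.not_mem_nil, or_false] at hx
    have k2 := key (Nat.card I.State) (Nat.card S.State) (Nat.card AD.State) (Nat.card AF.State)
    have k3 := (key (Nat.card S.State) (Nat.card I.State) (Nat.card AD.State)
      (Nat.card AF.State)).trans_eq (show _ = N by rw [hNdef]; ring)
    have k4 := (key (Nat.card AD.State) (Nat.card I.State) (Nat.card S.State)
      (Nat.card AF.State)).trans_eq (show _ = N by rw [hNdef]; ring)
    have k5 := (key (Nat.card AF.State) (Nat.card I.State) (Nat.card S.State)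
      (Nat.card AD.State)).trans_eq (show _ = N by rw [hNdef]; ring)
    rw [← hNdef] at k2
    clear_value N
    rcases hx with rfl | rfl | rfl | rfl <;> omega
  have hG : 0 < Nat.card L + 1 := Nat.succ_pos _
  have hN0 : 0 < N + 2 := Nat.succ_pos _
  obtain ⟨t0, ht0, x0⟩ := exists_exec_le (Λ := []) (P := loadSizes) (by decide) (by decide)
    (by decide) (m := m) hG hN0 (by simp)
  obtain ⟨t1, ht1, x1⟩ := exists_exec_le (Λ := [2, 3, 4, 5]) (P := allChains) (by decide)
    (by decide) (by decide) (m := m1) hG hN0 fun x hx => by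
      have h1 : x ≠ 1 := by revert x; decide
      rw [if_neg h1]
      exact hle x hx
  obtain ⟨t2, ht2, x2⟩ := exists_exec_numbering (m := m2)
    (by rw [hr2 2 (by decide), s2]; omega) (by rw [hr2 3 (by decide), s3]; omega)
    (by rw [hr2 4 (by decide), s4]; omega) (by rw [hr2 5 (by decide), s5]; omega)
  rw [hr2 2 (by decide), hr2 3 (by decide), hr2 4 (by decide), hr2 5 (by decide), s2, s3, s4, s5]
    at ht2
  replace ht2 : t2 ≤ numbering.coef * N := ht2.trans_eq (by rw [hNdef]; ring)
  obtain ⟨t3, ht3, x3⟩ := exists_exec_le (Λ := []) (P := prepareRows) (by decide) (by decide)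
    (by decide) (m := m3) hG hN0 (by simp)
  obtain ⟨t4, ht4, x4⟩ := exists_exec_le (Λ := [1, 6, 7]) (P := decideBad) (by decide)
    (by decide) (by decide) (m := m4) hG hN0 (by
      simp [hH.symbols, hH.states, hH.rows])
  refine ⟨_, verdict.eval (saturate.eval (loadRules.eval m4)),
    .seq x0 (.seq x1 (.seq x2 (.seq x3 x4))), ?_, fun hc => ?_, fun hc => ?_⟩
  · have h7 := le_cost_bound (Nat.card L) N
    have h8 := ht2.trans (Nat.mul_le_mul_left _ h7)
    change _ ≤ _ * ((Nat.card L + 1) ^ 2 * (N + 2) ^ 3)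
    generalize (Nat.card L + 1) ^ 2 * (N + 2) ^ 3 = B at *
    simp only [Nat.add_mul _ _ B]
    omega
  · exact hgood fun h => hconf.2 h hc
  · exact hbad (hconf.1 hc)

end RAM

theorem mainTheorem5 :
    (∀ (L : Type) [Finite L] (kind : L → LKind) (S : IOVPTS kind) (AD AF : VPA kind),
      S.toVPTS.Deterministic → AD.Deterministic → AF.Deterministic →
      ∃ T : VPA kind, T.Deterministic ∧ T.NonBlocking ∧ T.EpsFree ∧
        T.size ≤ (S.size * AF.size + 1) * (S.size * AD.size + AD.size + 1) ∧
        CompleteSuite T.language S.toVPTS AD.language AF.language) ∧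
    (∃ (P : RAM.Program) (c k : ℕ),
      ∀ (L : Type) [Finite L] (kind : L → LKind) (I S : IOVPTS kind) (AD AF : VPA kind),
      I.toVPTS.Deterministic → S.toVPTS.Deterministic → AD.Deterministic → AF.Deterministic →
      0 < I.size → 0 < S.size → 0 < AD.size → 0 < AF.size →
      ∀ m : RAM.Mem, m.IsInput I.toVPTS S.toVPTS AD AF →
      ∃ (t : ℕ) (m' : RAM.Mem), RAM.Exec P m t m' ∧
        t ≤ c * (Nat.card L + 1) ^ k * (I.size * S.size ^ 2 * AF.size * AD.size) ^ 3 ∧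
        (Conforms AD.language AF.language I.toVPTS S.toVPTS → m'.reg 0 = 1) ∧
        (¬ Conforms AD.language AF.language I.toVPTS S.toVPTS → m'.reg 0 = 0)) := by
  constructor
  · intro L _ kind S AD AF hS hD hF
    exact exists_complete_suite S.toVPTS AD AF hS hD hF
  -- With positive sizes each `n + 1` is at most `2 n`, so `N + 2` is at most `16 + 2 = 18` times
  -- the product of the sizes; its cube gives the factor `18 ^ 3`. The exponent `2` comes from the
  -- nested loops over symbols in the rule `ret`.
  · refine ⟨RAM.conformance, (RAM.Cmd.loadSizes.coef + RAM.Cmd.allChains.coef +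
      RAM.Cmd.numbering.coef + RAM.Cmd.prepareRows.coef + RAM.Cmd.decideBad.coef) * 18 ^ 3, 2,
      fun L _ kind I S AD AF dI dS dD dF hI hS hD hF m hm => ?_⟩
    obtain ⟨t, m', h1, h2, h3⟩ := RAM.conformance_spec dI dS dD dF hm
    refine ⟨t, m', h1, h2.trans ?_, h3⟩
    clear h1 h3 hm
    generalize RAM.Cmd.loadSizes.coef + RAM.Cmd.allChains.coef +
      RAM.Cmd.numbering.coef + RAM.Cmd.prepareRows.coef + RAM.Cmd.decideBad.coef = C
    revert hI hS hD hF
    generalize I.size = a, S.size = b, AF.size = c, AD.size = d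
    intro hI hS hD hF
    have h4 : (a + 1) * (b + 1) * (d + 1) * (c + 1) ≤ 2 * a * (2 * b) * (2 * d) * (2 * c) := by
      gcongr <;> omega
    have h5 : 0 < a * b * d * c := by positivity
    -- The product contains `S` only once; the second factor `n_S` of the stated bound is slack.
    have h6 : a * b * d * c * 1 ≤ a * b * d * c * b := Nat.mul_le_mul_left _ hS
    have h7 : (a + 1) * (b + 1) * (d + 1) * (c + 1) + 2 ≤ 18 * (a * b ^ 2 * c * d) := by
      calc _ ≤ 18 * (a * b * d * c * b) := by
            have : 2 * a * (2 * b) * (2 * d) * (2 * c) = 16 * (a * b * d * c) := by ring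
            omega
        _ = _ := by ring
    calc _ ≤ C * ((Nat.card L + 1) ^ 2 * (18 * (a * b ^ 2 * c * d)) ^ 3) := by gcongr
      _ = _ := by ring
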